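/- Let $R$ be a commutative ring with $1$, let $r\ge 1$ and $n\ge 0$ be integers, let $q\in R$ be invertible and let $Q_1,\dots,Q_r\in R$. Let $\mathcal H$ be the Ariki–Koike algebra: the unital associative $R$-algebra with generators $T_0,T_1,\dots,T_{n-1}$ and relations $\prod_{s=1}^r(T_0-Q_s)=0$; $T_0T_1T_0T_1=T_1T_0T_1T_0$; $(T_i-q)(T_i+1)=0$ for $1\le i\le n-1$; $T_{i+1}T_iT_{i+1}=T_iT_{i+1}T_i$ for $1\le i\le n-2$; $T_iT_j=T_jT_i$ for $0\le i<j-1\le n-2$. The symmetric group $\mathfrak S_n$ acts on $\{1,\dots,n\}$ from the right. For $w\in\mathfrak S_n$ with reduced expression $w=s_{i_1}\cdots s_{i_k}$, where $s_i=(i,i+1)$, put $\ell(w)=k$ and $T_w=T_{i_1}\cdots T_{i_k}$. Put $L_m=q^{1-m}T_{m-1}\cdots T_1T_0T_1\cdots T_{m-1}$ for $1\le m\le n$. Let $*$ be the $R$-linear anti-automorphism of $\mathcal H$ with $T_i^*=T_i$ for $0\le i\le n-1$. A multipartition of $n$ is an $r$-tuple $\lambda=(\lambda^{(1)},\dots,\lambda^{(r)})$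 of partitions with $\sum_s|\lambda^{(s)}|=n$; its diagram is the set of nodes $(i,j,s)$ (row $i$, column $j$ of the diagram of $\lambda^{(s)}$). Its conjugate $\lambda'$ has components $\lambda'^{(s)}=(\lambda^{(r-s+1)})'$. Let $\mathfrak t^\lambda$ be the filling of the diagram of $\lambda$ by $1,\dots,n$ in order along the rows of the first component, then the rows of the second component, and so on. Let $\mathfrak t_\lambda$ be the filling of the diagram of $\lambda$ whose entry at the node $(i,j,s)$ is the entry of $\mathfrak t^{\lambda'}$ at $(j,i,r-s+1)$, and let $w_\lambda\in\mathfrak S_n$ be the permutation with $\mathfrak t_\lambda=\mathfrak t^\lambda w_\lambda$. Let $\mathfrak S_\lambda$ be the row stabilizer of $\mathfrak t^\lambda$, let $\mathbf a_s=|\lambda^{(1)}|+\dots+|\lambda^{(s-1)}|$, and put $$m_\lambda=\Big(\sum_{w\in\mathfrak S_\lambda}T_w\Big)\prod_{s=2}^r\prod_{k=1}^{\mathbf a_s}(L_k-Q_s),\qquad n_\lambda=\Big(\sum_{w\in\mathfrak S_\lambda}(-q)^{-\ell(w)}T_w\Big)\prod_{s=2}^r\prod_{k=1}^{\mathbf a_s}(L_k-Q_{r-s+1}),$$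 $$z_\lambda=m_\lambda\,T_{w_\lambda}\,n_{\lambda'}.$$ **Proposition 5.13.** Let $\lambda$ be a multipartition of $n$. There is exactly one $R$-linear map $\tau:\mathcal H\to R$ such that, for all $w\in\mathfrak S_n$ and $0\le c_1,\dots,c_n<r$, $\tau(L_1^{c_1}\cdots L_n^{c_n}T_w)$ is $1$ if $c_1=\dots=c_n=0$ and $w=1$, and is $0$ otherwise; and this map satisfies $$\tau(z_\lambda T_{w_\lambda}^*)=(-1)^{n(r-1)}\,q^{\ell(w_\lambda)}\prod_{s=1}^r Q_s^{\,n-|\lambda^{(s)}|}.$$ -/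

import Mathlib

namespace AK

section Symmetric

/-- Indices `i` with `1 ≤ i ≤ n - 1` of the simple transpositions `s_i = (i, i+1)`. -/
abbrev SimpleIdx (n : ℕ) : Type := {i : Fin n // (i : ℕ) ≠ 0}

/-- The point `i - 1` of `Fin n`. -/
def predPt {n : ℕ} (i : Fin n) : Fin n := ⟨(i : ℕ) - 1, lt_of_le_of_lt (Nat.sub_le _ _) i.2⟩

/-- The simple transposition `s_i = (i, i+1)` of `{1, …, n}`.  The point `k` of `{1, …, n}` is the
element `k - 1` of `Fin n`, so `s_i` exchanges the elements `i - 1` and `i` of `Fin n`. -/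
def simpleSwap {n : ℕ} (i : SimpleIdx n) : Equiv.Perm (Fin n) := Equiv.swap (predPt i.1) i.1

/-- The product `s_{i₁} s_{i₂} ⋯ s_{iₖ}` of a word in the symmetric group acting from the right:
first apply `s_{i₁}`, then `s_{i₂}`, and so on. -/
def wordPerm {n : ℕ} : List (SimpleIdx n) → Equiv.Perm (Fin n)
  | [] => Equiv.refl _
  | i :: l => (simpleSwap i).trans (wordPerm l)

theorem wordPerm_append {n : ℕ} (l l' : List (SimpleIdx n)) :
    wordPerm (l ++ l') = (wordPerm l).trans (wordPerm l') := by
  induction l with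
  | nil => rfl
  | cons i l ih => simp [wordPerm, ih, Equiv.trans_assoc]

theorem exists_wordPerm {n : ℕ} (w : Equiv.Perm (Fin n)) :
    ∃ l : List (SimpleIdx n), wordPerm l = w := by
  cases n with
  | zero => exact ⟨[], Subsingleton.elim _ _⟩
  | succ m =>
    have hw : w ∈ Submonoid.closure
        (Set.range fun i : Fin m ↦ Equiv.swap i.castSucc i.succ) := by
      rw [Equiv.Perm.mclosure_swap_castSucc_succ]; trivial
    induction hw using Submonoid.closure_induction with
    | mem x hx =>
      obtain ⟨i, rfl⟩ := hx
      refine ⟨[⟨i.succ, by simp⟩], ?_⟩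
      have h : predPt i.succ = i.castSucc := by ext; simp [predPt]
      simp [wordPerm, simpleSwap, h]
    | one => exact ⟨[], rfl⟩
    | mul x y _ _ hx hy =>
      obtain ⟨lx, rfl⟩ := hx
      obtain ⟨ly, rfl⟩ := hy
      exact ⟨ly ++ lx, by rw [wordPerm_append]; rfl⟩

/-- The Coxeter length `ℓ(w)`: the least length of a word in the `s_i` with product `w`. -/
noncomputable def len {n : ℕ} (w : Equiv.Perm (Fin n)) : ℕ :=
  sInf {k | ∃ l : List (SimpleIdx n), wordPerm l = w ∧ l.length = k}

theorem exists_reduced {n : ℕ} (w : Equiv.Perm (Fin n)) :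
    ∃ l : List (SimpleIdx n), wordPerm l = w ∧ l.length = len w :=
  Nat.sInf_mem (s := {k | ∃ l : List (SimpleIdx n), wordPerm l = w ∧ l.length = k})
    (let ⟨l, hl⟩ := exists_wordPerm w; ⟨l.length, l, hl, rfl⟩)

/-- A reduced expression of `w`. -/
noncomputable def reducedWord {n : ℕ} (w : Equiv.Perm (Fin n)) : List (SimpleIdx n) :=
  (exists_reduced w).choose

end Symmetric

section Algebra

open Polynomial

variable {R : Type*} [CommRing R] {r : ℕ}

/-- The defining relations of the Ariki–Koike algebra with generators `T_0, …, T_{n-1}`. -/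
inductive Rel (n : ℕ) (q : Rˣ) (Q : Fin r → R) :
    FreeAlgebra R (Fin n) → FreeAlgebra R (Fin n) → Prop
  | cyclotomic (i : Fin n) (hi : (i : ℕ) = 0) :
      Rel n q Q (aeval (FreeAlgebra.ι R i) (∏ s : Fin r, (X - C (Q s)))) 0
  | quadratic (i : Fin n) (hi : (i : ℕ) ≠ 0) :
      Rel n q Q
        ((FreeAlgebra.ι R i - algebraMap R _ (q : R)) * (FreeAlgebra.ι R i + 1)) 0
  | braidFour (i j : Fin n) (hi : (i : ℕ) = 0) (hj : (j : ℕ) = 1) :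
      Rel n q Q
        (FreeAlgebra.ι R i * FreeAlgebra.ι R j * FreeAlgebra.ι R i * FreeAlgebra.ι R j)
        (FreeAlgebra.ι R j * FreeAlgebra.ι R i * FreeAlgebra.ι R j * FreeAlgebra.ι R i)
  | braidThree (i j : Fin n) (hi : (i : ℕ) ≠ 0) (hj : (j : ℕ) = i + 1) :
      Rel n q Q
        (FreeAlgebra.ι R j * FreeAlgebra.ι R i * FreeAlgebra.ι R j)
        (FreeAlgebra.ι R i * FreeAlgebra.ι R j * FreeAlgebra.ι R i)
  | comm (i j : Fin n) (hij : (i : ℕ) + 1 < j) :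
      Rel n q Q
        (FreeAlgebra.ι R i * FreeAlgebra.ι R j) (FreeAlgebra.ι R j * FreeAlgebra.ι R i)

/-- The Ariki–Koike algebra `ℋ` over `R` with parameters `q, Q_1, …, Q_r`. -/
abbrev Alg (n : ℕ) (q : Rˣ) (Q : Fin r → R) : Type _ := RingQuot (Rel n q Q)

variable (n : ℕ) (q : Rˣ) (Q : Fin r → R)

/-- The generators `T_0, …, T_{n-1}`. -/
def gen (i : Fin n) : Alg n q Q := RingQuot.mkAlgHom R (Rel n q Q) (FreeAlgebra.ι R i)

/-- `T_w = T_{i₁} ⋯ T_{iₖ}` where `w = s_{i₁} ⋯ s_{iₖ}` is a reduced expression. -/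
noncomputable def T (w : Equiv.Perm (Fin n)) : Alg n q Q :=
  ((reducedWord w).map fun i ↦ gen n q Q i.1).prod

/-- `murphyAux k = q^{-k} T_k ⋯ T_1 T_0 T_1 ⋯ T_k`. -/
def murphyAux : (k : ℕ) → k < n → Alg n q Q
  | 0, h => gen n q Q ⟨0, h⟩
  | k + 1, h =>
    ((q⁻¹ : Rˣ) : R) •
      (gen n q Q ⟨k + 1, h⟩ * murphyAux k (Nat.lt_of_succ_lt h) * gen n q Q ⟨k + 1, h⟩)

/-- The Jucys–Murphy elements: `murphy k` is `L_{k+1}`, for `k = 0, …, n - 1`. -/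
def murphy (k : Fin n) : Alg n q Q := murphyAux n q Q k.1 k.2

/-- The element `L_1^{c_1} ⋯ L_n^{c_n} T_w`. -/
noncomputable def akMonomial (c : Fin n → Fin r) (w : Equiv.Perm (Fin n)) : Alg n q Q :=
  (List.ofFn fun k : Fin n ↦ murphy n q Q k ^ (c k : ℕ)).prod * T n q Q w

/-- `τ` takes the prescribed values on the Ariki–Koike monomials `L_1^{c_1} ⋯ L_n^{c_n} T_w`,
`0 ≤ c_i < r`: it is `1` if all `c_i` vanish and `w = 1`, and it is `0` otherwise. -/
def IsCanonicalForm (τ : Alg n q Q →ₗ[R] R) : Prop :=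
  ∀ (c : Fin n → Fin r) (w : Equiv.Perm (Fin n)),
    (((∀ k, (c k : ℕ) = 0) ∧ w = 1) → τ (akMonomial n q Q c w) = 1) ∧
    (¬((∀ k, (c k : ℕ) = 0) ∧ w = 1) → τ (akMonomial n q Q c w) = 0)

theorem gen_rel {x y : FreeAlgebra R (Fin n)} (h : Rel n q Q x y) :
    FreeAlgebra.lift R (gen n q Q) x = FreeAlgebra.lift R (gen n q Q) y := by
  have e : FreeAlgebra.lift R (gen n q Q) = RingQuot.mkAlgHom R (Rel n q Q) := by
    ext i; simp [gen]
  rw [e]; exact RingQuot.mkAlgHom_rel R h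

/-- The anti-automorphism `*`, as an algebra homomorphism to the opposite algebra. -/
def starHom : Alg n q Q →ₐ[R] (Alg n q Q)ᵐᵒᵖ :=
  RingQuot.liftAlgHom R ⟨FreeAlgebra.lift R fun i ↦ MulOpposite.op (gen n q Q i), by
    intro x y h
    have key := gen_rel n q Q h
    cases h with
    | cyclotomic i hi =>
      rw [map_zero, ← aeval_algHom_apply, FreeAlgebra.lift_ι_apply] at key ⊢
      apply MulOpposite.unop_injective
      have op_aeval (p : R[X]) (a : Alg n q Q) :
          aeval (MulOpposite.op a) p = MulOpposite.op (aeval a p) := by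
        induction p using Polynomial.induction_on' with
        | add p p' hp hp' => simp [hp, hp']
        | monomial k a => simp [aeval_monomial, MulOpposite.algebraMap_apply,
            ← MulOpposite.op_pow, ← MulOpposite.op_mul, Algebra.commutes]
      rw [op_aeval, key]; rfl
    | quadratic i hi =>
      apply MulOpposite.unop_injective
      simp only [map_mul, map_sub, map_add, map_one, map_zero, AlgHom.commutes,
        FreeAlgebra.lift_ι_apply] at key ⊢
      have c : Commute (gen n q Q i + 1) (gen n q Q i - algebraMap R _ (q : R)) :=
        (Commute.add_left (Commute.refl _) (Commute.one_left _)).sub_right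
          (Algebra.commute_algebraMap_right _ _)
      simpa [MulOpposite.algebraMap_apply, c.eq] using key
    | braidFour i j hi hj =>
      apply MulOpposite.unop_injective
      simp only [map_mul, FreeAlgebra.lift_ι_apply, MulOpposite.unop_mul,
        MulOpposite.unop_op] at key ⊢
      simpa only [mul_assoc] using key.symm
    | braidThree i j hi hj =>
      apply MulOpposite.unop_injective
      simp only [map_mul, FreeAlgebra.lift_ι_apply, MulOpposite.unop_mul,
        MulOpposite.unop_op] at key ⊢
      simpa only [mul_assoc] using key
    | comm i j hij =>
      apply MulOpposite.unop_injective
      simp only [map_mul, FreeAlgebra.lift_ι_apply, MulOpposite.unop_mul,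
        MulOpposite.unop_op] at key ⊢
      exact key.symm⟩

/-- The `R`-linear anti-automorphism `*` of `ℋ` with `T_i^* = T_i` for `0 ≤ i < n`. -/
def starMap (h : Alg n q Q) : Alg n q Q := (starHom n q Q h).unop

theorem starMap_gen (i : Fin n) : starMap n q Q (gen n q Q i) = gen n q Q i := by
  simp [starMap, starHom, gen]

theorem starMap_mul (a b : Alg n q Q) :
    starMap n q Q (a * b) = starMap n q Q b * starMap n q Q a := by
  simp [starMap]

/-- `∏_{k=1}^{a} (L_k - x)`, the factors being taken in increasing order of `k`. -/
noncomputable def murphyProd (a : ℕ) (x : R) : Alg n q Q :=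
  (List.ofFn fun k : Fin n ↦
    if (k : ℕ) < a then murphy n q Q k - algebraMap R _ x else 1).prod

end Algebra

section Tableaux

/-- A multipartition of `n` with `r` components; partitions are given by their Young diagrams,
where `(i, j)` is the node in row `i` and column `j`. -/
structure Multipartition (r n : ℕ) where
  /-- The components `λ^{(1)}, …, λ^{(r)}`. -/
  part : Fin r → YoungDiagram
  sum_card : ∑ s, (part s).card = n

namespace Multipartition

variable {r n : ℕ} (lam : Multipartition r n)

/-- The conjugate multipartition, `λ'^{(s)} = (λ^{(r-s+1)})'`. -/
def conj : Multipartition r n where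
  part s := (lam.part s.rev).transpose
  sum_card := by
    refine Eq.trans (Fintype.sum_equiv Fin.revPerm _ _ fun s ↦ ?_) lam.sum_card
    simp [YoungDiagram.card, YoungDiagram.transpose]

/-- The diagram `[λ]`, whose nodes are written `(s, (i, j))` (component, row, column), ordered
lexicographically: this is the order of reading along the rows of the first component from top
to bottom, then along the rows of the second component, and so on. -/
def nodes : Finset (Fin r ×ₗ (ℕ ×ₗ ℕ)) :=
  (Finset.univ.sigma fun s : Fin r ↦ (lam.part s).cells).map
    ⟨fun x ↦ toLex (x.1, toLex x.2), by
      rintro ⟨s, x⟩ ⟨t, y⟩ h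
      obtain ⟨rfl, h⟩ := Prod.mk.inj (toLex.injective h)
      obtain rfl := toLex.injective h
      rfl⟩

theorem card_nodes : lam.nodes.card = n := by
  simpa [nodes, Finset.card_sigma] using lam.sum_card

theorem mem_nodes (s : Fin r) (i j : ℕ) :
    toLex (s, toLex (i, j)) ∈ lam.nodes ↔ (i, j) ∈ lam.part s := by
  simp only [nodes, Finset.mem_map, Finset.mem_sigma, Finset.mem_univ, true_and]
  constructor
  · rintro ⟨⟨t, y⟩, hy, h⟩
    have h1 : (t, toLex y) = (s, toLex (i, j)) := toLex.injective h
    obtain ⟨rfl, h2⟩ := Prod.mk.inj h1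
    obtain rfl : y = (i, j) := toLex.injective h2
    exact hy
  · exact fun h ↦ ⟨⟨s, (i, j)⟩, h, rfl⟩

/-- A `λ`-tableau: a bijection from `[λ]` to `{1, …, n}`. -/
abbrev Tableau : Type := lam.nodes ≃ Fin n

/-- The tableau `𝔱^λ`, in which `1, …, n` are entered in order along the rows. -/
def rowTableau : lam.Tableau := (lam.nodes.orderIsoOfFin lam.card_nodes).symm.toEquiv

/-- The bijection `(i, j, s) ↦ (j, i, r - s + 1)` from `[λ]` to `[λ']`. -/
def nodesConj : lam.nodes ≃ lam.conj.nodes where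
  toFun x := ⟨toLex ((ofLex x.1).1.rev, toLex (ofLex (ofLex x.1).2).swap), by
    rw [← Prod.mk.eta (p := (ofLex (ofLex x.1).2).swap), mem_nodes]
    have h := (lam.mem_nodes (ofLex x.1).1 (ofLex (ofLex x.1).2).1
      (ofLex (ofLex x.1).2).2).1 x.2
    simpa [conj, YoungDiagram.mem_transpose] using h⟩
  invFun y := ⟨toLex ((ofLex y.1).1.rev, toLex (ofLex (ofLex y.1).2).swap), by
    rw [← Prod.mk.eta (p := (ofLex (ofLex y.1).2).swap), mem_nodes]
    have h := (lam.conj.mem_nodes (ofLex y.1).1 (ofLex (ofLex y.1).2).1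
      (ofLex (ofLex y.1).2).2).1 y.2
    simpa [conj, YoungDiagram.mem_transpose, Prod.swap] using h⟩
  left_inv x := by simp
  right_inv y := by simp

/-- The tableau `𝔱_λ = (𝔱^{λ'})'`: its entry at a node of `[λ]` is the entry of `𝔱^{λ'}` at the
conjugate node. -/
def colTableau : lam.Tableau := lam.nodesConj.trans lam.conj.rowTableau

/-- The permutation `w_λ` with `𝔱_λ = 𝔱^λ w_λ`, i.e. `w_λ` sends the entry of `𝔱^λ` at each node
to the entry of `𝔱_λ` at that node. -/
def wPerm : Equiv.Perm (Fin n) := lam.rowTableau.symm.trans lam.colTableau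

theorem wPerm_rowTableau (x : lam.nodes) : lam.wPerm (lam.rowTableau x) = lam.colTableau x := by
  simp [wPerm]

/-- The row (component and row number) of `𝔱^λ` that contains `k`. -/
def rowOf (k : Fin n) : Fin r × ℕ :=
  ((ofLex (lam.rowTableau.symm k).1).1, (ofLex (ofLex (lam.rowTableau.symm k).1).2).1)

/-- The elements of the row stabilizer `𝔖_λ` of `𝔱^λ`. -/
def rowStab : Finset (Equiv.Perm (Fin n)) :=
  Finset.univ.filter fun w ↦ ∀ k, lam.rowOf (w k) = lam.rowOf k

/-- `𝐚_s = |λ^{(1)}| + ⋯ + |λ^{(s-1)}|`. -/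
def before (s : Fin r) : ℕ := ∑ t ∈ Finset.univ.filter (· < s), (lam.part t).card

end Multipartition

end Tableaux

section Elements

variable {R : Type*} [CommRing R] {r n : ℕ} (q : Rˣ) (Q : Fin r → R)
  (lam : Multipartition r n)

/-- `x_λ = ∑_{w ∈ 𝔖_λ} T_w`. -/
noncomputable def xElt : Alg n q Q := ∑ w ∈ lam.rowStab, T n q Q w

/-- `y_λ = ∑_{w ∈ 𝔖_λ} (-q)^{-ℓ(w)} T_w`. -/
noncomputable def yElt : Alg n q Q :=
  ∑ w ∈ lam.rowStab, ((((-q)⁻¹) ^ len w : Rˣ) : R) • T n q Q w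

/-- `u_λ^+ = ∏_{s=2}^r ∏_{k=1}^{𝐚_s} (L_k - Q_s)`; the factor for `s = 1` is `1` as `𝐚_1 = 0`. -/
noncomputable def uPlus : Alg n q Q :=
  (List.ofFn fun s : Fin r ↦ murphyProd n q Q (lam.before s) (Q s)).prod

/-- `u_λ^- = ∏_{s=2}^r ∏_{k=1}^{𝐚_s} (L_k - Q_{r-s+1})`. -/
noncomputable def uMinus : Alg n q Q :=
  (List.ofFn fun s : Fin r ↦ murphyProd n q Q (lam.before s) (Q s.rev)).prod

/-- `m_λ = x_λ u_λ^+`. -/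
noncomputable def mElt : Alg n q Q := xElt q Q lam * uPlus q Q lam

/-- `n_λ = y_λ u_λ^-`. -/
noncomputable def nElt : Alg n q Q := yElt q Q lam * uMinus q Q lam

/-- `z_λ = m_λ T_{w_λ} n_{λ'}`. -/
noncomputable def zElt : Alg n q Q :=
  mElt q Q lam * T n q Q lam.wPerm * nElt q Q lam.conj

end Elements

end AK

/-! Expand the two row sums in z_λ T_{w_λ}^*. The result is a sum over u ∈ 𝔖_λ and v ∈ 𝔖_{λ'} of
(-q)^{-ℓ(v)} T_u · u_λ^+ T_x u_{λ'}^- · T_{w_λ}^*, where x = w_λ v and T_x = T_{w_λ} T_v because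
lengths add. Group the linear factors of u^± by the index k of L_k. With comp(k) the component of
𝔱^λ containing k, this gives u_λ^+ = ∏ G_k(L_k) with G_k = ∏_{t > comp(k)} (X - Q_t), and u_{λ'}^- =
∏ F_{x⁻¹k}(L_k) with F_k = ∏_{t < comp(k)} (X - Q_t) (`uPlus_eq_ev`, `uMinus_conj_eq_ev`).
Components are filled in increasing order, so deg F_i + deg G_j < r whenever i ≤ j.

The core is `straighten`: under this degree condition ∏ G_k(L_k) · T_x · ∏ F_{x⁻¹k}(L_k) equals ∏
G_k(0) F_k(0) · T_x modulo the span of the L^c T_w with c ≠ 0 and all c_k < r. Moving F past T_x by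
the Bernstein relation pairs F_k with G_k. The corrections contain a factor L_k, where k is the
largest point not yet treated, and their degree in L_k stays below r, so that factor survives
normalization. The span is killed by τ and stable under multiplication by the T_w on both sides.
Since τ(T_a T_b) is q^{ℓ(a)} for b = a⁻¹ and 0 otherwise (`apply_T_mul_T`), only the pairs with u
w_λ v = w_λ contribute. Additivity of lengths, ℓ(u w_λ v) = ℓ(u) + ℓ(w_λ) + ℓ(v), then leaves only u
= v = 1. The constant ∏_k G_k(0) F_k(0) = ∏_k ∏_{t ≠ comp(k)} (-Q_t) gives the sign and the powers
of the Q_s.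

Uniqueness of τ holds because the monomials L^c T_w span (`span_akMonomial`): their span is stable
under left multiplication by every generator. Existence needs their linear independence, obtained
from a representation on polynomial-valued functions on 𝔖_n with all degrees below r. There T_0
multiplies by the first variable modulo ∏ (X - Q_s), and T_i acts by the Bernstein formula. The
monomials send the vector 1 at the identity to distinct basis vectors, and τ reads off a
coefficient. The delicate relation is T_0T_1T_0T_1 = T_1T_0T_1T_0 (`opD_opT_four`). -/

namespace AK

/-! ### Inversions, Coxeter length and the word property -/

section Inversions

open Equiv

variable {n : ℕ}

/-- The inversions of a permutation. -/
def inversions (w : Perm (Fin n)) : Finset (Fin n × Fin n) :=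
  Finset.univ.filter fun p ↦ p.1 < p.2 ∧ w p.2 < w p.1

/-- The number of inversions of a permutation. -/
def inv (w : Perm (Fin n)) : ℕ := (inversions w).card

theorem mem_inversions {w : Perm (Fin n)} {p : Fin n × Fin n} :
    p ∈ inversions w ↔ p.1 < p.2 ∧ w p.2 < w p.1 := by simp [inversions]

/-- Inversions add up if `w` creates no cancellation with those of `u`. -/
theorem inv_trans {u w : Perm (Fin n)}
    (h : ∀ a b, a < b → u b < u a → w (u b) < w (u a)) :
    inv (u.trans w) = inv u + inv w := by
  -- No inversion of `u` is undone by `w`, so the inversions of `u.trans w` are those of `u`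
  -- together with those of `w` pulled back along `u`.
  have e : inversions (u.trans w) =
      inversions u ∪ (inversions w).map (u.symm.prodCongr u.symm).toEmbedding := by
    ext ⟨a, b⟩
    simp only [Finset.mem_union, mem_inversions, Finset.mem_map_equiv, Equiv.prodCongr_symm,
      Equiv.symm_symm, Equiv.prodCongr_apply, Prod.map, Equiv.trans_apply]
    constructor
    · rintro ⟨hab, hw⟩
      rcases lt_trichotomy (u a) (u b) with h1 | h1 | h1
      · exact Or.inr ⟨h1, hw⟩
      · exact absurd (u.injective h1) hab.ne
      · exact Or.inl ⟨hab, h1⟩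
    · rintro (⟨hab, h1⟩ | ⟨h1, hw⟩)
      · exact ⟨hab, h a b hab h1⟩
      · refine ⟨?_, hw⟩
        rcases lt_trichotomy a b with h2 | h2 | h2
        · exact h2
        · subst h2; exact absurd h1 (lt_irrefl _)
        · exact absurd (h b a h2 h1) hw.asymm
  rw [inv, e, Finset.card_union_of_disjoint, Finset.card_map]
  · rfl
  · rw [Finset.disjoint_left]
    rintro ⟨a, b⟩ h1 h2
    simp only [mem_inversions, Finset.mem_map_equiv, Equiv.prodCongr_symm,
      Equiv.symm_symm, Equiv.prodCongr_apply, Prod.map] at h1 h2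
    exact h1.2.asymm h2.1

theorem predPt_val (i : Fin n) : (predPt i : ℕ) = i - 1 := rfl

theorem predPt_lt (i : SimpleIdx n) : predPt i.1 < i.1 := by
  have := i.2
  rw [Fin.lt_def, predPt_val]; omega

theorem predPt_ne (i : SimpleIdx n) : predPt i.1 ≠ i.1 := (predPt_lt i).ne

theorem simpleSwap_left (i : SimpleIdx n) : simpleSwap i (predPt i.1) = i.1 := by
  simp [simpleSwap]

theorem simpleSwap_right (i : SimpleIdx n) : simpleSwap i i.1 = predPt i.1 := by
  simp [simpleSwap]

theorem simpleSwap_of_ne {i : SimpleIdx n} {k : Fin n} (h : k ≠ predPt i.1) (h' : k ≠ i.1) :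
    simpleSwap i k = k := Equiv.swap_apply_of_ne_of_ne h h'

@[simp] theorem simpleSwap_simpleSwap (i : SimpleIdx n) (k : Fin n) :
    simpleSwap i (simpleSwap i k) = k := by simp [simpleSwap]

@[simp] theorem simpleSwap_symm (i : SimpleIdx n) : (simpleSwap i).symm = simpleSwap i := by
  simp [simpleSwap]

@[simp] theorem simpleSwap_trans_trans (i : SimpleIdx n) (w : Perm (Fin n)) :
    (simpleSwap i).trans ((simpleSwap i).trans w) = w := by
  ext k; simp

theorem simpleSwap_inversion {i : SimpleIdx n} {a b : Fin n} (hab : a < b)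
    (h : simpleSwap i b < simpleSwap i a) : a = predPt i.1 ∧ b = i.1 := by
  have hp := predPt_val i.1
  have hi := i.2
  rw [simpleSwap, swap_apply_def, swap_apply_def] at h
  simp only [Fin.lt_def, Fin.ext_iff] at *
  split_ifs at h <;> omega

theorem inv_simpleSwap (i : SimpleIdx n) : inv (simpleSwap i) = 1 := by
  rw [inv, Finset.card_eq_one]
  refine ⟨(predPt i.1, i.1), ?_⟩
  ext ⟨a, b⟩
  simp only [mem_inversions, Finset.mem_singleton, Prod.mk.injEq]
  constructor
  · rintro ⟨h1, h2⟩; exact simpleSwap_inversion h1 h2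
  · rintro ⟨rfl, rfl⟩
    rw [simpleSwap_left, simpleSwap_right]
    exact ⟨predPt_lt i, predPt_lt i⟩

theorem inv_simpleSwap_trans {i : SimpleIdx n} {w : Perm (Fin n)} (h : w (predPt i.1) < w i.1) :
    inv ((simpleSwap i).trans w) = inv w + 1 := by
  rw [inv_trans, inv_simpleSwap, add_comm]
  intro a b hab hu
  obtain ⟨rfl, rfl⟩ := simpleSwap_inversion hab hu
  rwa [simpleSwap_left, simpleSwap_right]

theorem inv_simpleSwap_trans' {i : SimpleIdx n} {w : Perm (Fin n)} (h : w i.1 < w (predPt i.1)) :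
    inv ((simpleSwap i).trans w) + 1 = inv w := by
  have := inv_simpleSwap_trans (i := i) (w := (simpleSwap i).trans w)
    (by simpa [simpleSwap_left, simpleSwap_right] using h)
  rw [← this, simpleSwap_trans_trans]

theorem ascent_or_descent (i : SimpleIdx n) (w : Perm (Fin n)) :
    w (predPt i.1) < w i.1 ∨ w i.1 < w (predPt i.1) :=
  lt_or_gt_of_ne fun h ↦ predPt_ne i (w.injective h)

theorem inv_symm (w : Perm (Fin n)) : inv w.symm = inv w := by
  refine Finset.card_bij (fun p _ ↦ (w.symm p.2, w.symm p.1)) ?_ ?_ ?_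
  · rintro ⟨a, b⟩ h
    rw [mem_inversions] at h ⊢
    simpa using ⟨h.2, h.1⟩
  · rintro ⟨a, b⟩ _ ⟨c, d⟩ _ h
    simp only [Prod.mk.injEq, EmbeddingLike.apply_eq_iff_eq] at h
    rw [h.1, h.2]
  · rintro ⟨a, b⟩ h
    rw [mem_inversions] at h
    exact ⟨(w b, w a), by rw [mem_inversions]; simpa using ⟨h.2, h.1⟩, by simp⟩

theorem inv_refl : inv (Equiv.refl (Fin n)) = 0 := by
  rw [inv, Finset.card_eq_zero, Finset.eq_empty_iff_forall_notMem]
  rintro ⟨a, b⟩ h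
  rw [mem_inversions] at h
  exact h.1.asymm h.2

/-- Without descents `w` is strictly monotone, and `Fin n` has only one order automorphism. -/
theorem eq_refl_of_ascents {w : Perm (Fin n)}
    (h : ∀ i : SimpleIdx n, w (predPt i.1) < w i.1) : w = Equiv.refl _ := by
  have hm : StrictMono w := by
    cases n with
    | zero => exact fun a ↦ a.elim0
    | succ m =>
      rw [Fin.strictMono_iff_lt_succ]
      intro i
      have := h ⟨i.succ, by simp⟩
      have e : predPt i.succ = i.castSucc := by ext; simp [predPt]
      simpa [e] using this
  have := Subsingleton.elim (hm.orderIsoOfSurjective w w.surjective) (OrderIso.refl _)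
  ext k
  have := congrArg (fun f : Fin n ≃o Fin n ↦ f k) this
  simpa using congrArg Fin.val this

theorem inv_wordPerm_le (l : List (SimpleIdx n)) : inv (wordPerm l) ≤ l.length := by
  induction l with
  | nil => simp [wordPerm, inv_refl]
  | cons i l ih =>
    rw [wordPerm, List.length_cons]
    rcases ascent_or_descent i (wordPerm l) with h | h
    · rw [inv_simpleSwap_trans h]; omega
    · have := inv_simpleSwap_trans' h; omega

theorem exists_wordPerm_length (w : Perm (Fin n)) :
    ∃ l : List (SimpleIdx n), wordPerm l = w ∧ l.length = inv w := by
  induction hk : inv w generalizing w with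
  | zero =>
    refine ⟨[], ?_, rfl⟩
    refine (eq_refl_of_ascents fun i ↦ (ascent_or_descent i w).resolve_right fun h ↦ ?_).symm
    have := inv_simpleSwap_trans' h
    omega
  | succ k ih =>
    by_cases h : ∀ i : SimpleIdx n, w (predPt i.1) < w i.1
    · rw [eq_refl_of_ascents h, inv_refl] at hk; omega
    · push Not at h
      obtain ⟨i, hi⟩ := h
      have hi' := (ascent_or_descent i w).resolve_left hi.not_gt
      obtain ⟨l, hl, hl'⟩ := ih ((simpleSwap i).trans w)
        (by have := inv_simpleSwap_trans' hi'; omega)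
      exact ⟨i :: l, by rw [wordPerm, hl, simpleSwap_trans_trans], by simp [hl']⟩

/-- A simple transposition changes the number of inversions by exactly one, which bounds word
lengths from below; removing descents until the identity is reached gives a word attaining the
bound. -/
theorem len_eq_inv (w : Perm (Fin n)) : len w = inv w := by
  apply le_antisymm
  · exact Nat.sInf_le (exists_wordPerm_length w)
  · obtain ⟨l, hl, hl'⟩ := exists_reduced w
    rw [← hl', ← hl]
    exact inv_wordPerm_le l

theorem wordPerm_reducedWord (w : Perm (Fin n)) : wordPerm (reducedWord w) = w :=
  (exists_reduced w).choose_spec.1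

theorem length_reducedWord (w : Perm (Fin n)) : (reducedWord w).length = inv w := by
  rw [← len_eq_inv]; exact (exists_reduced w).choose_spec.2

theorem eq_refl_of_inv_eq_zero {w : Perm (Fin n)} (h : inv w = 0) : w = Equiv.refl _ := by
  have h1 := wordPerm_reducedWord w
  have h2 := length_reducedWord w
  rw [h, List.length_eq_zero_iff] at h2
  rw [← h1, h2, wordPerm]

/-- The word of a permutation is reduced. -/
def IsReduced (l : List (SimpleIdx n)) : Prop := l.length = inv (wordPerm l)

theorem IsReduced.tail {i : SimpleIdx n} {l : List (SimpleIdx n)} (h : IsReduced (i :: l)) :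
    IsReduced l ∧ wordPerm l (predPt i.1) < wordPerm l i.1 := by
  rw [IsReduced, wordPerm, List.length_cons] at h
  have h1 := inv_wordPerm_le l
  rcases ascent_or_descent i (wordPerm l) with h' | h'
  · have := inv_simpleSwap_trans h'
    exact ⟨by rw [IsReduced]; omega, h'⟩
  · have := inv_simpleSwap_trans' h'
    omega

theorem IsReduced.cons {i : SimpleIdx n} {l : List (SimpleIdx n)} (h : IsReduced l)
    (h' : wordPerm l (predPt i.1) < wordPerm l i.1) : IsReduced (i :: l) := by
  rw [IsReduced, wordPerm, List.length_cons, inv_simpleSwap_trans h', h]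

theorem isReduced_reducedWord (w : Perm (Fin n)) : IsReduced (reducedWord w) := by
  rw [IsReduced, wordPerm_reducedWord, length_reducedWord]

theorem predPt_eq_of_val {i j : Fin n} (h : (j : ℕ) = i + 1) : predPt j = i := by
  ext; rw [predPt_val]; omega

theorem simpleSwap_comm {i j : SimpleIdx n} (hij : (i.1 : ℕ) + 1 < j.1) (k : Fin n) :
    simpleSwap i (simpleSwap j k) = simpleSwap j (simpleSwap i k) := by
  have hpi := predPt_val i.1
  have hpj := predPt_val j.1
  simp only [simpleSwap, swap_apply_def, Fin.ext_iff]
  split_ifs <;> omega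

theorem simpleSwap_braid {i j : SimpleIdx n} (hij : (j.1 : ℕ) = i.1 + 1) (k : Fin n) :
    simpleSwap i (simpleSwap j (simpleSwap i k)) =
      simpleSwap j (simpleSwap i (simpleSwap j k)) := by
  have hpj : predPt j.1 = i.1 := predPt_eq_of_val hij
  have hpi := predPt_val i.1
  have hi0 := i.2
  have si1 := simpleSwap_left i
  have si2 := simpleSwap_right i
  have si3 : simpleSwap i j.1 = j.1 := simpleSwap_of_ne
    (by rw [Ne, Fin.ext_iff]; omega) (by rw [Ne, Fin.ext_iff]; omega)
  have sj1 : simpleSwap j i.1 = j.1 := by rw [← hpj, simpleSwap_left]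
  have sj2 : simpleSwap j j.1 = i.1 := by rw [simpleSwap_right, hpj]
  have sj3 : simpleSwap j (predPt i.1) = predPt i.1 := simpleSwap_of_ne
    (by rw [hpj]; exact predPt_ne i) (by rw [Ne, Fin.ext_iff]; omega)
  by_cases k1 : k = predPt i.1
  · subst k1; simp [si1, sj1, sj3, si3]
  by_cases k2 : k = i.1
  · subst k2; simp [sj1, si2, sj3, si1, si3, sj2]
  by_cases k3 : k = j.1
  · subst k3; simp [sj2, si2, sj3, si3]
  have e1 : simpleSwap i k = k := simpleSwap_of_ne k1 k2
  have e2 : simpleSwap j k = k := simpleSwap_of_ne (by rwa [hpj]) k3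
  simp [e1, e2]

/-- The word property of the symmetric group: in a monoid in which the images of the simple
transpositions satisfy the braid relations, all reduced words of a permutation have the same
product. -/
theorem prod_eq_of_isReduced {A : Type*} [Monoid A] (g : SimpleIdx n → A)
    (hcomm : ∀ i j : SimpleIdx n, (i.1 : ℕ) + 1 < j.1 → g i * g j = g j * g i)
    (hbraid : ∀ i j : SimpleIdx n, (j.1 : ℕ) = i.1 + 1 → g j * g i * g j = g i * g j * g i)
    {l l' : List (SimpleIdx n)} (hl : IsReduced l) (hl' : IsReduced l')
    (h : wordPerm l = wordPerm l') : (l.map g).prod = (l'.map g).prod := by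
  induction hk : l.length using Nat.strong_induction_on generalizing l l' with
  | _ k ih =>
  subst hk
  have hlen : l.length = l'.length := by rw [hl, hl', h]
  match l, l', hl, hl', h, hlen with
  | [], [], _, _, _, _ => rfl
  | [], j :: b, _, _, _, hlen => simp at hlen
  | i :: a, [], _, _, _, hlen => simp at hlen
  | i :: a, j :: b, hl, hl', h, hlen =>
    have ih2 : ∀ l l' : List (SimpleIdx n), IsReduced l → IsReduced l' →
        wordPerm l = wordPerm l' → l.length = a.length → (l.map g).prod = (l'.map g).prod :=
      fun l l' h1 h2 h3 h4 ↦ ih l.length (by simp [h4]) h1 h2 h3 rfl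
    have hab : a.length = b.length := by simpa using hlen
    obtain ⟨ha, hai⟩ := hl.tail
    obtain ⟨hb, hbj⟩ := hl'.tail
    -- `w` is the common permutation
    obtain ⟨w, hw⟩ : ∃ w, w = wordPerm (i :: a) := ⟨_, rfl⟩
    have hwa : wordPerm a = (simpleSwap i).trans w := by
      rw [hw, wordPerm, simpleSwap_trans_trans]
    have hwb : wordPerm b = (simpleSwap j).trans w := by
      rw [hw, h, wordPerm, simpleSwap_trans_trans]
    have hwi : w i.1 < w (predPt i.1) := by
      rw [hwa] at hai
      simpa [simpleSwap_left, simpleSwap_right] using hai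
    have hwj : w j.1 < w (predPt j.1) := by
      rw [hwb] at hbj
      simpa [simpleSwap_left, simpleSwap_right] using hbj
    -- Both letters are descents of `w` and commute, so `w` has reduced words `i :: j :: c` and `j
    -- :: i :: c` with a common `c`. Induction compares `a` with `j :: c` and `b` with `i :: c`.
    have far : ∀ (i j : SimpleIdx n) (a b : List (SimpleIdx n)), (i.1 : ℕ) + 1 < j.1 →
        w i.1 < w (predPt i.1) → w j.1 < w (predPt j.1) → IsReduced a → IsReduced b →
        wordPerm a = (simpleSwap i).trans w → wordPerm b = (simpleSwap j).trans w →
        (∀ l l' : List (SimpleIdx n), IsReduced l → IsReduced l' →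
          wordPerm l = wordPerm l' → l.length = a.length → (l.map g).prod = (l'.map g).prod) →
        a.length = b.length →
        ((i :: a).map g).prod = ((j :: b).map g).prod := by
      intro i j a b hij hwi hwj ha hb hwa hwb ih2 hab
      have hpi := predPt_val i.1
      have hpj := predPt_val j.1
      have h1 : simpleSwap i j.1 = j.1 := simpleSwap_of_ne
        (by rw [Ne, Fin.ext_iff]; omega) (by rw [Ne, Fin.ext_iff]; omega)
      have h2 : simpleSwap i (predPt j.1) = predPt j.1 := simpleSwap_of_ne
        (by rw [Ne, Fin.ext_iff]; omega) (by rw [Ne, Fin.ext_iff]; omega)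
      have h3 : simpleSwap j i.1 = i.1 := simpleSwap_of_ne
        (by rw [Ne, Fin.ext_iff]; omega) (by rw [Ne, Fin.ext_iff]; omega)
      have h4 : simpleSwap j (predPt i.1) = predPt i.1 := simpleSwap_of_ne
        (by rw [Ne, Fin.ext_iff]; omega) (by rw [Ne, Fin.ext_iff]; omega)
      set c := reducedWord ((simpleSwap j).trans ((simpleSwap i).trans w)) with hcdef
      have hcw : wordPerm c = (simpleSwap j).trans ((simpleSwap i).trans w) :=
        wordPerm_reducedWord _
      have hcr : IsReduced c := isReduced_reducedWord _
      have hjc : IsReduced (j :: c) := by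
        apply hcr.cons
        rw [hcw]
        simpa [simpleSwap_left, simpleSwap_right, h1, h2] using hwj
      have hic : IsReduced (i :: c) := by
        apply hcr.cons
        rw [hcw]
        simpa [simpleSwap_left, simpleSwap_right, h3, h4] using hwi
      have e1 : wordPerm a = wordPerm (j :: c) := by
        rw [wordPerm, hcw, simpleSwap_trans_trans, hwa]
      have e2 : wordPerm b = wordPerm (i :: c) := by
        rw [wordPerm, hcw, hwb]
        ext k
        simp [← simpleSwap_comm hij k]
      have p1 := ih2 a (j :: c) ha hjc e1 rfl
      have p2 := ih2 b (i :: c) hb hic e2 hab.symm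
      simp only [List.map_cons, List.prod_cons] at p1 p2 ⊢
      rw [p1, p2, ← mul_assoc, ← mul_assoc, hcomm i j hij]
    -- Here `w` reverses three consecutive points, so it has reduced words beginning with either
    -- side of the braid relation, followed by the same `c`.
    have near : ∀ (i j : SimpleIdx n) (a b : List (SimpleIdx n)), (j.1 : ℕ) = i.1 + 1 →
        w i.1 < w (predPt i.1) → w j.1 < w (predPt j.1) → IsReduced a → IsReduced b →
        wordPerm a = (simpleSwap i).trans w → wordPerm b = (simpleSwap j).trans w →
        (∀ l l' : List (SimpleIdx n), IsReduced l → IsReduced l' →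
          wordPerm l = wordPerm l' → l.length = a.length → (l.map g).prod = (l'.map g).prod) →
        a.length = b.length →
        ((i :: a).map g).prod = ((j :: b).map g).prod := by
      intro i j a b hij hwi hwj ha hb hwa hwb ih2 hab
      have hpj : predPt j.1 = i.1 := predPt_eq_of_val hij
      have hpi := predPt_val i.1
      have hi0 := i.2
      rw [hpj] at hwj
      have si1 := simpleSwap_left i
      have si2 := simpleSwap_right i
      have si3 : simpleSwap i j.1 = j.1 := simpleSwap_of_ne
        (by rw [Ne, Fin.ext_iff]; omega) (by rw [Ne, Fin.ext_iff]; omega)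
      have sj1 : simpleSwap j i.1 = j.1 := by rw [← hpj, simpleSwap_left]
      have sj2 : simpleSwap j j.1 = i.1 := by rw [simpleSwap_right, hpj]
      have sj3 : simpleSwap j (predPt i.1) = predPt i.1 := simpleSwap_of_ne
        (by rw [hpj]; exact predPt_ne i) (by rw [Ne, Fin.ext_iff]; omega)
      set v := (simpleSwap i).trans ((simpleSwap j).trans ((simpleSwap i).trans w)) with hv
      have hv' : v = (simpleSwap j).trans ((simpleSwap i).trans ((simpleSwap j).trans w)) := by
        rw [hv]
        ext k
        simp [simpleSwap_braid hij k]
      set c := reducedWord v with hcdef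
      have hcw : wordPerm c = v := wordPerm_reducedWord _
      have hcr : IsReduced c := isReduced_reducedWord _
      have hic : IsReduced (i :: c) := by
        apply hcr.cons
        rw [hcw, hv]
        simpa [si1, si2, sj1, sj2, sj3, si3] using hwj
      have hjc : IsReduced (j :: c) := by
        apply hcr.cons
        rw [hcw, hpj, hv']
        simpa [si1, si2, sj1, sj2, sj3, si3] using hwi
      have hicw : wordPerm (i :: c) = (simpleSwap j).trans ((simpleSwap i).trans w) := by
        rw [wordPerm, hcw, hv, simpleSwap_trans_trans]
      have hjcw : wordPerm (j :: c) = (simpleSwap i).trans ((simpleSwap j).trans w) := by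
        rw [wordPerm, hcw, hv', simpleSwap_trans_trans]
      have hjic : IsReduced (j :: i :: c) := by
        apply hic.cons
        rw [hicw, hpj]
        simpa [si1, si2, sj1, sj2, sj3, si3] using hwj.trans hwi
      have hijc : IsReduced (i :: j :: c) := by
        apply hjc.cons
        rw [hjcw]
        simpa [si1, si2, sj1, sj2, sj3, si3] using hwj.trans hwi
      have e1 : wordPerm a = wordPerm (j :: i :: c) := by
        rw [wordPerm, hicw, simpleSwap_trans_trans, hwa]
      have e2 : wordPerm b = wordPerm (i :: j :: c) := by
        rw [wordPerm, hjcw, simpleSwap_trans_trans, hwb]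
      have p1 := ih2 a (j :: i :: c) ha hjic e1 rfl
      have p2 := ih2 b (i :: j :: c) hb hijc e2 hab.symm
      simp only [List.map_cons, List.prod_cons] at p1 p2 ⊢
      rw [p1, p2]
      simp only [← mul_assoc]
      rw [hbraid i j hij]
    rcases lt_trichotomy (i.1 : ℕ) j.1 with hlt | heq | hlt
    · rcases Nat.lt_or_ge ((i.1 : ℕ) + 1) j.1 with h1 | h1
      · exact far i j a b h1 hwi hwj ha hb hwa hwb ih2 hab
      · exact near i j a b (by omega) hwi hwj ha hb hwa hwb ih2 hab
    · obtain rfl : i = j := Subtype.ext (Fin.ext heq)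
      rw [List.map_cons, List.map_cons, List.prod_cons, List.prod_cons,
        ih2 a b ha hb (by rw [hwa, hwb]) rfl]
    · have ih3 : ∀ l l' : List (SimpleIdx n), IsReduced l → IsReduced l' →
        wordPerm l = wordPerm l' → l.length = b.length → (l.map g).prod = (l'.map g).prod :=
        fun l l' h1 h2 h3 h4 ↦ ih2 l l' h1 h2 h3 (h4.trans hab.symm)
      rcases Nat.lt_or_ge ((j.1 : ℕ) + 1) i.1 with h1 | h1
      · exact (far j i b a h1 hwj hwi hb ha hwb hwa ih3 hab.symm).symm
      · exact (near j i b a (by omega) hwj hwi hb ha hwb hwa ih3 hab.symm).symm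

end Inversions

end AK

namespace AK

open MvPolynomial

/-! ### Divided differences, degree bounds and reduction modulo a monic polynomial -/

section Polynomials

variable {R : Type*} [CommRing R] {n : ℕ}

/-- `R` may have zero divisors, so no domain argument is available. The invertible substitution X_a
↦ X_a + X_b turns the factor into a variable, which can always be cancelled. -/
theorem X_sub_X_mul_cancel {a b : Fin n} (hab : a ≠ b) {p p' : MvPolynomial (Fin n) R}
    (h : (X a - X b) * p = (X a - X b) * p') : p = p' := by
  let φ : MvPolynomial (Fin n) R →ₐ[R] MvPolynomial (Fin n) R :=
    aeval fun k ↦ if k = a then X a + X b else X k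
  let ψ : MvPolynomial (Fin n) R →ₐ[R] MvPolynomial (Fin n) R :=
    aeval fun k ↦ if k = a then X a - X b else X k
  have hψφ : ∀ p, ψ (φ p) = p := by
    intro p
    have : ψ.comp φ = AlgHom.id R _ := by
      ext1 k
      by_cases hk : k = a
      · simp [φ, ψ, hk, hab.symm]
      · simp [φ, ψ, hk]
    exact congrArg (fun f : _ →ₐ[R] _ ↦ f p) this
  have h1 := congrArg φ h
  have hφ : φ (X a - X b) = X a := by simp [φ, hab.symm]
  rw [map_mul, map_mul, hφ] at h1
  rw [← hψφ p, ← hψφ p', X_mul_cancel_left_iff.1 h1]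

theorem monomial_one_congr {e e' : Fin n →₀ ℕ} (h : e = e') :
    (monomial e 1 : MvPolynomial (Fin n) R) = monomial e' 1 := by rw [h]

/-- The action of a simple transposition on polynomials. -/
noncomputable def sw (i : SimpleIdx n) : MvPolynomial (Fin n) R →ₐ[R] MvPolynomial (Fin n) R :=
  rename (simpleSwap i)

theorem sw_X (i : SimpleIdx n) (j : Fin n) : sw (R := R) i (X j) = X (simpleSwap i j) := by
  simp [sw]

/-- Modulo the difference of the two variables the swap fixes every variable, hence every
polynomial. -/
theorem X_sub_X_dvd (i : SimpleIdx n) (p : MvPolynomial (Fin n) R) :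
    X i.1 - X (predPt i.1) ∣ p - sw i p := by
  induction p using MvPolynomial.induction_on with
  | C a => simp [sw]
  | add p p' hp hp' =>
    have := dvd_add hp hp'
    rw [map_add]
    convert this using 1; ring
  | mul_X p j hp =>
    rw [map_mul, sw_X]
    have e : p * X j - sw i p * X (simpleSwap i j) =
      (p - sw i p) * X (simpleSwap i j) + p * (X j - X (simpleSwap i j)) := by ring
    rw [e]
    refine dvd_add (dvd_mul_of_dvd_left hp _) (dvd_mul_of_dvd_right ?_ _)
    by_cases h1 : j = i.1
    · subst h1; rw [simpleSwap_right]
    by_cases h2 : j = predPt i.1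
    · subst h2; rw [simpleSwap_left]; exact ⟨-1, by ring⟩
    · rw [simpleSwap_of_ne h2 h1, sub_self]; exact dvd_zero _

/-- The divided difference `(p - s_i p) / (X_i - X_{i-1})`. -/
noncomputable def dd (i : SimpleIdx n) : MvPolynomial (Fin n) R →ₗ[R] MvPolynomial (Fin n) R where
  toFun p := (X_sub_X_dvd i p).choose
  map_add' p p' := by
    apply X_sub_X_mul_cancel (predPt_ne i).symm
    rw [mul_add, ← (X_sub_X_dvd i p).choose_spec, ← (X_sub_X_dvd i p').choose_spec,
      ← (X_sub_X_dvd i (p + p')).choose_spec, map_add]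
    ring
  map_smul' a p := by
    apply X_sub_X_mul_cancel (predPt_ne i).symm
    rw [RingHom.id_apply, mul_smul_comm, ← (X_sub_X_dvd i p).choose_spec,
      ← (X_sub_X_dvd i (a • p)).choose_spec, map_smul, smul_sub]

theorem dd_spec (i : SimpleIdx n) (p : MvPolynomial (Fin n) R) :
    (X i.1 - X (predPt i.1)) * dd i p = p - sw i p :=
  (X_sub_X_dvd i p).choose_spec.symm

theorem dd_unique {i : SimpleIdx n} {p a : MvPolynomial (Fin n) R}
    (h : (X i.1 - X (predPt i.1)) * a = p - sw i p) : dd i p = a :=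
  X_sub_X_mul_cancel (predPt_ne i).symm (by rw [dd_spec, h])

theorem dd_mul (i : SimpleIdx n) (p p' : MvPolynomial (Fin n) R) :
    dd i (p * p') = sw i p * dd i p' + dd i p * p' := by
  apply dd_unique
  have h1 := dd_spec i p
  have h2 := dd_spec i p'
  rw [map_mul]
  linear_combination sw i p * h2 + p' * h1

theorem dd_eq_zero {i : SimpleIdx n} {p : MvPolynomial (Fin n) R} (h : sw i p = p) :
    dd i p = 0 := dd_unique (by rw [h]; ring)

theorem dd_X_self (i : SimpleIdx n) : dd i (X i.1 : MvPolynomial (Fin n) R) = 1 :=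
  dd_unique (by rw [sw_X, simpleSwap_right, mul_one])

theorem dd_X_pred (i : SimpleIdx n) :
    dd i (X (predPt i.1) : MvPolynomial (Fin n) R) = -1 :=
  dd_unique (by rw [sw_X, simpleSwap_left]; ring)

theorem dd_X_of_ne {i : SimpleIdx n} {j : Fin n} (h : j ≠ predPt i.1) (h' : j ≠ i.1) :
    dd i (X j : MvPolynomial (Fin n) R) = 0 :=
  dd_eq_zero (by rw [sw_X, simpleSwap_of_ne h h'])

theorem dd_X_pow_self (i : SimpleIdx n) (k : ℕ) :
    dd i (X i.1 ^ k : MvPolynomial (Fin n) R) =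
      ∑ j ∈ Finset.range k, X i.1 ^ j * X (predPt i.1) ^ (k - 1 - j) := by
  apply dd_unique
  rw [mul_comm, Commute.geom_sum₂_mul (Commute.all _ _), map_pow, sw_X, simpleSwap_right]

theorem dd_X_pow_pred (i : SimpleIdx n) (k : ℕ) :
    dd i (X (predPt i.1) ^ k : MvPolynomial (Fin n) R) =
      -∑ j ∈ Finset.range k, X i.1 ^ j * X (predPt i.1) ^ (k - 1 - j) := by
  apply dd_unique
  rw [mul_neg, mul_comm, Commute.geom_sum₂_mul (Commute.all _ _), map_pow, sw_X, simpleSwap_left]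
  ring

/-- Polynomials whose degree in the variable `X_j` is less than `d j`, for all `j`. -/
noncomputable def Bd (R : Type*) [CommRing R] (d : Fin n → ℕ) :
    Submodule R (MvPolynomial (Fin n) R) :=
  restrictSupport R {e | ∀ j, e j < d j}

theorem monomial_mem_Bd {d : Fin n → ℕ} {e : Fin n →₀ ℕ} (a : R) (h : ∀ j, e j < d j) :
    monomial e a ∈ Bd R d := by
  nontriviality R
  exact (monomial_mem_restrictSupport R).2 (Or.inl h)

theorem Bd_eq_span (d : Fin n → ℕ) :
    Bd R d = Submodule.span R ((monomial · 1) '' {e : Fin n →₀ ℕ | ∀ j, e j < d j}) :=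
  restrictSupport_eq_span _ _

theorem Bd_mono {d d' : Fin n → ℕ} (h : ∀ j, d j ≤ d' j) : Bd R d ≤ Bd R d' :=
  restrictSupport_mono _ fun _ he j ↦ (he j).trans_le (h j)

theorem Bd_map {N : Type*} [AddCommGroup N] [Module R N] {S : Submodule R N} {d : Fin n → ℕ}
    (L : MvPolynomial (Fin n) R →ₗ[R] N)
    (h : ∀ e : Fin n →₀ ℕ, (∀ j, e j < d j) → L (monomial e 1) ∈ S)
    {p : MvPolynomial (Fin n) R} (hp : p ∈ Bd R d) : L p ∈ S := by
  have : Bd R d ≤ S.comap L := by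
    rw [Bd_eq_span, Submodule.span_le]
    rintro _ ⟨e, he, rfl⟩
    exact h e he
  exact this hp

theorem one_mem_Bd {d : Fin n → ℕ} (h : ∀ j, 0 < d j) : (1 : MvPolynomial (Fin n) R) ∈ Bd R d :=
  monomial_mem_Bd 1 h

theorem rename_mem_Bd {d : Fin n → ℕ} (π : Equiv.Perm (Fin n)) (h : ∀ j, d (π j) = d j)
    {p : MvPolynomial (Fin n) R} (hp : p ∈ Bd R d) : rename π p ∈ Bd R d := by
  refine Bd_map (rename π).toLinearMap (fun e he ↦ ?_) hp
  rw [AlgHom.toLinearMap_apply, rename_monomial]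
  refine monomial_mem_Bd _ fun j ↦ ?_
  rw [Finsupp.mapDomain_equiv_apply]
  have := he (π.symm j)
  have h2 := h (π.symm j)
  rw [Equiv.apply_symm_apply] at h2
  omega

theorem sw_mem_Bd {d : Fin n → ℕ} {i : SimpleIdx n} (h : d (predPt i.1) = d i.1)
    {p : MvPolynomial (Fin n) R} (hp : p ∈ Bd R d) : sw i p ∈ Bd R d := by
  refine rename_mem_Bd _ (fun j ↦ ?_) hp
  by_cases h1 : j = i.1
  · subst h1; rw [simpleSwap_right, h]
  by_cases h2 : j = predPt i.1
  · subst h2; rw [simpleSwap_left, h]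
  · rw [simpleSwap_of_ne h2 h1]

/-- Take out the symmetric factor (xy)^min. The divided difference of the remaining power lowers its
degree by one, so multiplying by `X i.1` never exceeds the larger of the two original exponents. The
Bernstein action therefore needs no reduction. -/
theorem X_mul_dd_mem_Bd {d : Fin n → ℕ} {i : SimpleIdx n} (h : d (predPt i.1) = d i.1)
    {p : MvPolynomial (Fin n) R} (hp : p ∈ Bd R d) : X i.1 * dd i p ∈ Bd R d := by
  refine Bd_map ((LinearMap.mulLeft R (X i.1)).comp (dd i)) (fun e he ↦ ?_) hp
  rw [LinearMap.comp_apply, LinearMap.mulLeft_apply]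
  set x : MvPolynomial (Fin n) R := X (predPt i.1) with hx
  set y : MvPolynomial (Fin n) R := X i.1 with hy
  set e' := (e.erase (predPt i.1)).erase i.1 with he'
  set g : MvPolynomial (Fin n) R := monomial e' 1 with hg
  have hne := predPt_ne i
  have mono : ∀ u v, u < d i.1 → v < d i.1 → x ^ u * y ^ v * g ∈ Bd R d := by
    intro u v hu hv
    rw [hx, hy, hg, X_pow_eq_monomial, X_pow_eq_monomial, monomial_mul, monomial_mul]
    refine monomial_mem_Bd _ fun j ↦ ?_
    have := he j
    by_cases h1 : j = i.1
    · subst h1; simpa [he', hne] using hv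
    by_cases h2 : j = predPt i.1
    · subst h2; simp [he', hne]; omega
    · have h1' : ¬ i.1 = j := fun h ↦ h1 h.symm
      have h2' : ¬ predPt i.1 = j := fun h ↦ h2 h.symm
      simpa [he', h1, h2, h1', h2'] using this
  have hsg : sw i g = g := by
    rw [hg, sw, rename_monomial]
    refine monomial_one_congr ?_
    ext j
    rw [Finsupp.mapDomain_equiv_apply, simpleSwap_symm]
    by_cases h1 : j = i.1
    · subst h1; rw [simpleSwap_right]; simp [he', hne]
    by_cases h2 : j = predPt i.1
    · subst h2; rw [simpleSwap_left]; simp [he', hne]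
    · rw [simpleSwap_of_ne h2 h1]
  have hsx : sw i x = y := by rw [hx, sw_X, simpleSwap_left]
  have hsy : sw i y = x := by rw [hy, sw_X, simpleSwap_right]
  have hmon : monomial e (1 : R) = x ^ e (predPt i.1) * y ^ e i.1 * g := by
    rw [hx, hy, hg, X_pow_eq_monomial, X_pow_eq_monomial, monomial_mul, monomial_mul]
    simp only [mul_one]
    refine monomial_one_congr ?_
    ext j
    by_cases h1 : j = i.1
    · subst h1; simp [he', hne]
    by_cases h2 : j = predPt i.1
    · subst h2; simp [he', hne]
    · have h1' : ¬ i.1 = j := fun h ↦ h1 h.symm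
      have h2' : ¬ predPt i.1 = j := fun h ↦ h2 h.symm
      simp [he', h1, h2]
  have h1 := he i.1
  have h2 := he (predPt i.1)
  rw [hmon]
  rcases le_total (e (predPt i.1)) (e i.1) with hle | hle
  · obtain ⟨k, hk⟩ := Nat.exists_eq_add_of_le hle
    have e1 : x ^ e (predPt i.1) * y ^ e i.1 * g =
        ((x * y) ^ e (predPt i.1) * g) * y ^ k := by rw [hk]; ring
    rw [e1, dd_mul, dd_eq_zero (p := (x * y) ^ e (predPt i.1) * g), dd_X_pow_self, zero_mul,
      add_zero, Finset.mul_sum, Finset.mul_sum]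
    · refine Submodule.sum_mem _ fun j hj ↦ ?_
      rw [Finset.mem_range] at hj
      rw [map_mul, map_pow, map_mul, hsx, hsy, hsg]
      convert mono (e (predPt i.1) + (k - 1 - j)) (e (predPt i.1) + j + 1) (by omega)
        (by omega) using 1
      rw [← hx, ← hy]; ring
    · rw [map_mul, map_pow, map_mul, hsx, hsy, hsg, mul_comm x]
  · obtain ⟨k, hk⟩ := Nat.exists_eq_add_of_le hle
    have e1 : x ^ e (predPt i.1) * y ^ e i.1 * g =
        ((x * y) ^ e i.1 * g) * x ^ k := by rw [hk]; ring
    rw [e1, dd_mul, dd_eq_zero (p := (x * y) ^ e i.1 * g), dd_X_pow_pred, zero_mul,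
      add_zero, mul_neg, mul_neg, Finset.mul_sum, Finset.mul_sum]
    · refine Submodule.neg_mem _ (Submodule.sum_mem _ fun j hj ↦ ?_)
      rw [Finset.mem_range] at hj
      rw [map_mul, map_pow, map_mul, hsx, hsy, hsg]
      convert mono (e i.1 + (k - 1 - j)) (e i.1 + j + 1) (by omega)
        (by omega) using 1
      rw [← hx, ← hy]; ring
    · rw [map_mul, map_pow, map_mul, hsx, hsy, hsg, mul_comm x]

/-- The coefficient of `X_i ^ k`, as a polynomial in the other variables. -/
noncomputable def cf (i : Fin n) (k : ℕ) : MvPolynomial (Fin n) R →ₗ[R] MvPolynomial (Fin n) R :=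
  (basisMonomials (Fin n) R).constr R fun e ↦ if e i = k then monomial (e.erase i) 1 else 0

theorem cf_monomial (i : Fin n) (k : ℕ) (e : Fin n →₀ ℕ) :
    cf i k (monomial e (1 : R)) = if e i = k then monomial (e.erase i) 1 else 0 := by
  have := (basisMonomials (Fin n) R).constr_basis R
    (fun e ↦ if e i = k then monomial (e.erase i) (1 : R) else 0) e
  rwa [coe_basisMonomials] at this

theorem linearMap_ext {N : Type*} [AddCommGroup N] [Module R N]
    {L L' : MvPolynomial (Fin n) R →ₗ[R] N}
    (h : ∀ e, L (monomial e 1) = L' (monomial e 1)) (p : MvPolynomial (Fin n) R) :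
    L p = L' p := by
  have : L = L' := (basisMonomials (Fin n) R).ext fun e ↦ by simpa using h e
  rw [this]

theorem cf_X_mul_of_ne {i j : Fin n} (h : j ≠ i) (k : ℕ) (p : MvPolynomial (Fin n) R) :
    cf i k (X j * p) = X j * cf i k p := by
  refine linearMap_ext (L := (cf i k).comp (LinearMap.mulLeft R (X j)))
    (L' := (LinearMap.mulLeft R (X j)).comp (cf i k)) (fun e ↦ ?_) p
  simp only [LinearMap.comp_apply, LinearMap.mulLeft_apply]
  rw [cf_monomial, X, monomial_mul, mul_one, cf_monomial]
  simp only [Finsupp.add_apply, Finsupp.single_apply, h, if_false, zero_add]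
  split_ifs
  · rw [monomial_mul, mul_one]
    refine monomial_one_congr ?_
    ext l
    by_cases hl : l = i
    · subst hl; simp [h]
    · simp [hl]
  · simp

theorem cf_X_mul_self (i : Fin n) (k : ℕ) (p : MvPolynomial (Fin n) R) :
    cf i (k + 1) (X i * p) = cf i k p := by
  suffices h : ((cf i (k + 1)).comp (LinearMap.mulLeft R (X i))) p = cf i k p from h
  refine linearMap_ext (fun e ↦ ?_) p
  simp only [LinearMap.comp_apply, LinearMap.mulLeft_apply]
  rw [cf_monomial, X, monomial_mul, mul_one, cf_monomial]
  simp only [Finsupp.add_apply, Finsupp.single_apply, if_true, add_comm 1, add_left_inj]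
  split_ifs
  · refine monomial_one_congr ?_
    ext l
    by_cases hl : l = i
    · subst hl; simp
    · simp [hl]
  · rfl

theorem cf_rename {i : Fin n} (π : Equiv.Perm (Fin n)) (h : π i = i) (k : ℕ)
    (p : MvPolynomial (Fin n) R) : cf i k (rename π p) = rename π (cf i k p) := by
  refine linearMap_ext (L := (cf i k).comp (rename π).toLinearMap)
    (L' := (rename π).toLinearMap.comp (cf i k)) (fun e ↦ ?_) p
  simp only [LinearMap.comp_apply, AlgHom.toLinearMap_apply]
  have h' : π.symm i = i := by rw [Equiv.symm_apply_eq, h]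
  rw [cf_monomial, rename_monomial, cf_monomial, Finsupp.mapDomain_equiv_apply, h']
  split_ifs
  · rw [rename_monomial]
    refine monomial_one_congr ?_
    ext l
    rw [Finsupp.mapDomain_equiv_apply]
    by_cases hl : l = i
    · subst hl; simp [h']
    · have : π.symm l ≠ i := fun h2 ↦ hl (by rw [← h, ← h2, Equiv.apply_symm_apply])
      simp [hl, this, Finsupp.mapDomain_equiv_apply]
  · simp

theorem cf_dd {j : Fin n} {i : SimpleIdx n} (h1 : j ≠ predPt i.1) (h2 : j ≠ i.1) (k : ℕ)
    (p : MvPolynomial (Fin n) R) : cf j k (dd i p) = dd i (cf j k p) := by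
  symm
  apply dd_unique
  have := congrArg (cf j k) (dd_spec i p)
  rw [sub_mul, map_sub, map_sub, cf_X_mul_of_ne h1.symm, cf_X_mul_of_ne h2.symm,
    sw, cf_rename _ (simpleSwap_of_ne h1 h2)] at this
  rw [sub_mul, this, sw]

theorem cf_eq_zero_of_mem_Bd {d : Fin n → ℕ} {i : Fin n} {k : ℕ} (hk : d i ≤ k)
    {p : MvPolynomial (Fin n) R} (hp : p ∈ Bd R d) : cf i k p = 0 := by
  have : cf i k p ∈ (⊥ : Submodule R (MvPolynomial (Fin n) R)) := by
    refine Bd_map _ (fun e he ↦ ?_) hp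
    have := he i
    rw [cf_monomial, if_neg (by omega)]; exact Submodule.zero_mem _
  simpa using this

theorem cf_cf (i : Fin n) (k l : ℕ) (p : MvPolynomial (Fin n) R) :
    cf i k (cf i l p) = if k = 0 then cf i l p else 0 := by
  split_ifs with hk
  · refine linearMap_ext (L := (cf i k).comp (cf i l)) (L' := cf i l) (fun e ↦ ?_) p
    simp only [LinearMap.comp_apply]
    rw [cf_monomial]
    split_ifs
    · rw [cf_monomial]; simp [hk]
    · simp
  · refine linearMap_ext (L := (cf i k).comp (cf i l)) (L' := 0) (fun e ↦ ?_) p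
    simp only [LinearMap.comp_apply]
    rw [cf_monomial]
    split_ifs
    · rw [cf_monomial]; simp [Ne.symm hk]
    · simp

theorem coeff_erase_cf (i : Fin n) (e : Fin n →₀ ℕ) (p : MvPolynomial (Fin n) R) :
    coeff (e.erase i) (cf i (e i) p) = coeff e p := by
  refine linearMap_ext (L := (lcoeff R (e.erase i)).comp (cf i (e i)))
    (L' := lcoeff R e) (fun e' ↦ ?_) p
  simp only [LinearMap.comp_apply, lcoeff_apply]
  rw [cf_monomial]
  split_ifs with h
  · have : e'.erase i = e.erase i ↔ e' = e := by
      constructor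
      · intro h2
        ext j
        by_cases hj : j = i
        · rw [hj, h]
        · simpa [hj] using DFunLike.congr_fun h2 j
      · rintro rfl; rfl
    simp only [coeff_monomial, this]
  · rw [coeff_zero, coeff_monomial, if_neg]
    rintro rfl; exact h rfl

theorem eq_zero_of_cf {i : Fin n} {p : MvPolynomial (Fin n) R} (h : ∀ k, cf i k p = 0) :
    p = 0 := by
  ext e
  rw [← coeff_erase_cf i, h, coeff_zero, coeff_zero]

theorem exists_forall_cf_eq_zero (i : Fin n) (p : MvPolynomial (Fin n) R) :
    ∃ N, ∀ k, N ≤ k → cf i k p = 0 := by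
  induction p using MvPolynomial.induction_on' with
  | monomial e a =>
    refine ⟨e i + 1, fun k hk ↦ ?_⟩
    rw [← mul_one a, ← smul_eq_mul, ← smul_monomial, map_smul, cf_monomial, if_neg (by omega),
      smul_zero]
  | add p p' hp hp' =>
    obtain ⟨N, hN⟩ := hp
    obtain ⟨N', hN'⟩ := hp'
    refine ⟨max N N', fun k hk ↦ ?_⟩
    rw [map_add, hN k (le_trans (le_max_left _ _) hk), hN' k (le_trans (le_max_right _ _) hk),
      add_zero]

theorem cf_X_pow_mul (i : Fin n) (k l : ℕ) (p : MvPolynomial (Fin n) R) :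
    cf i (k + l) (X i ^ l * p) = cf i k p := by
  induction l with
  | zero => simp
  | succ l ih => rw [pow_succ', mul_assoc, ← add_assoc, cf_X_mul_self, ih]

theorem cf_X_pow_mul_of_ne {i j : Fin n} (h : j ≠ i) (k l : ℕ) (p : MvPolynomial (Fin n) R) :
    cf i k (X j ^ l * p) = X j ^ l * cf i k p := by
  induction l with
  | zero => simp
  | succ l ih => rw [pow_succ', mul_assoc, cf_X_mul_of_ne h, ih, mul_assoc]

theorem cf_aeval_mul_of_ne {i j : Fin n} (h : j ≠ i) (k : ℕ) (f : Polynomial R)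
    (p : MvPolynomial (Fin n) R) :
    cf i k (Polynomial.aeval (X j) f * p) = Polynomial.aeval (X j) f * cf i k p := by
  induction f using Polynomial.induction_on' with
  | add f g hf hg => rw [map_add, add_mul, map_add, hf, hg, add_mul]
  | monomial l a =>
    rw [Polynomial.aeval_monomial, mul_assoc, ← Algebra.smul_def, map_smul,
      cf_X_pow_mul_of_ne h, mul_assoc, ← Algebra.smul_def]

theorem aeval_X_eq_sum (i : Fin n) (f : Polynomial R) :
    Polynomial.aeval (X i : MvPolynomial (Fin n) R) f =
      ∑ j ∈ Finset.range (f.natDegree + 1), f.coeff j • X i ^ j :=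
  Polynomial.aeval_eq_sum_range _

/-- As `f` is monic of degree `d i`, the leading coefficient of `p` in X_i reappears in the product
in degree at least `d i`, where nothing is allowed. Descending induction on the degree kills all
coefficients. -/
theorem eq_zero_of_aeval_mul_mem_Bd {d : Fin n → ℕ} {i : Fin n} {f : Polynomial R}
    (hf : f.Monic) (hd : f.natDegree = d i) {p : MvPolynomial (Fin n) R}
    (hp : Polynomial.aeval (X i) f * p ∈ Bd R d) : p = 0 := by
  apply eq_zero_of_cf (i := i)
  obtain ⟨N, hN⟩ := exists_forall_cf_eq_zero i p
  have step : ∀ M, (∀ k, M + 1 ≤ k → cf i k p = 0) → cf i M p = 0 := by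
    intro M hM
    have h0 := cf_eq_zero_of_mem_Bd (i := i) (k := M + d i) (by omega) hp
    rw [aeval_X_eq_sum, Finset.sum_mul, map_sum, Finset.sum_range_succ, Finset.sum_eq_zero,
      zero_add, smul_mul_assoc, map_smul, hd, cf_X_pow_mul, ← hd] at h0
    · rwa [Polynomial.Monic.coeff_natDegree hf, one_smul] at h0
    · intro j hj
      rw [Finset.mem_range, hd] at hj
      have : M + d i = (M + d i - j) + j := by omega
      rw [smul_mul_assoc, map_smul, this, cf_X_pow_mul, hM _ (by omega), smul_zero]
  have desc : ∀ t k, N ≤ k + t → cf i k p = 0 := by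
    intro t
    induction t with
    | zero => exact fun k hk ↦ hN k hk
    | succ t ih => exact fun k hk ↦ step k fun l hl ↦ ih l (by omega)
  exact fun k ↦ desc N k (by omega)

/-- Multiplication by `X_i` followed by reduction modulo the monic polynomial `f(X_i)`. -/
noncomputable def redMul (i : Fin n) (f : Polynomial R) :
    MvPolynomial (Fin n) R →ₗ[R] MvPolynomial (Fin n) R :=
  LinearMap.mulLeft R (X i) -
    (LinearMap.mulLeft R (Polynomial.aeval (X i) f)).comp (cf i (f.natDegree - 1))

theorem redMul_apply (i : Fin n) (f : Polynomial R) (p : MvPolynomial (Fin n) R) :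
    redMul i f p = X i * p - Polynomial.aeval (X i) f * cf i (f.natDegree - 1) p := rfl

theorem monomial_eq_X_pow_mul (i : Fin n) (e : Fin n →₀ ℕ) :
    monomial e (1 : R) = X i ^ e i * monomial (e.erase i) 1 := by
  rw [X_pow_eq_monomial, monomial_mul, mul_one, Finsupp.single_add_erase]

/-- Only monomials of X_i-degree `d i - 1` overflow under multiplication by X_i; for these the
subtracted multiple of `f` trades X_i^{d i} for lower powers. -/
theorem redMul_mem_Bd {d : Fin n → ℕ} {i : Fin n} {f : Polynomial R}
    (hf : f.Monic) (hd : f.natDegree = d i) {p : MvPolynomial (Fin n) R}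
    (hp : p ∈ Bd R d) : redMul i f p ∈ Bd R d := by
  refine Bd_map _ (fun e he ↦ ?_) hp
  have hei := he i
  have mono : ∀ k, k < d i → X i ^ k * monomial (e.erase i) (1 : R) ∈ Bd R d := by
    intro k hk
    rw [X_pow_eq_monomial, monomial_mul]
    refine monomial_mem_Bd _ fun j ↦ ?_
    have := he j
    by_cases hj : j = i
    · subst hj; simpa using hk
    · have : ¬ i = j := fun h ↦ hj h.symm
      simpa [hj, this]
  rw [redMul_apply, cf_monomial]
  split_ifs with h
  · rw [monomial_eq_X_pow_mul i e, ← mul_assoc, ← pow_succ', ← sub_mul, aeval_X_eq_sum,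
      Finset.sum_range_succ, hf.coeff_natDegree, one_smul, h,
      Nat.sub_add_cancel (by omega), sub_add_eq_sub_sub_swap, sub_self, zero_sub, neg_mul,
      Finset.sum_mul]
    refine Submodule.neg_mem _ (Submodule.sum_mem _ fun j hj ↦ ?_)
    rw [Finset.mem_range, hd] at hj
    rw [smul_mul_assoc]
    exact Submodule.smul_mem _ _ (mono j hj)
  · rw [mul_zero, sub_zero, monomial_eq_X_pow_mul i e, ← mul_assoc, ← pow_succ']
    exact mono _ (by omega)

theorem redMul_eq_of_mem_Bd {d : Fin n → ℕ} {i : Fin n} {f : Polynomial R}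
    (hd : d i < f.natDegree) {p : MvPolynomial (Fin n) R}
    (hp : p ∈ Bd R d) : redMul i f p = X i * p := by
  rw [redMul_apply, cf_eq_zero_of_mem_Bd (by omega) hp, mul_zero, sub_zero]

end Polynomials

/-- The ring structure of `ℋ`, over the semiring structure used in its definition. -/
@[reducible] def algRing {R : Type*} [CommRing R] {r : ℕ} (n : ℕ) (q : Rˣ) (Q : Fin r → R) :
    Ring (Alg n q Q) :=
  letI I : Ring (Alg n q Q) := RingQuot.instRing (Rel n q Q)
  { RingQuot.instSemiring (Rel n q Q) with
    neg := fun x ↦ -x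
    sub := fun x y ↦ x - y
    sub_eq_add_neg := I.sub_eq_add_neg
    zsmul := I.zsmul
    zsmul_zero' := I.zsmul_zero'
    zsmul_succ' := I.zsmul_succ'
    zsmul_neg' := I.zsmul_neg'
    neg_add_cancel := I.neg_add_cancel
    intCast := I.intCast
    intCast_ofNat := I.intCast_ofNat
    intCast_negSucc := I.intCast_negSucc }

section Algebra

attribute [local instance] algRing

/-! ### Commutation relations between the generators and the Jucys–Murphy elements -/

section Relations

variable {R : Type*} [CommRing R] {r n : ℕ} (q : Rˣ) (Q : Fin r → R)

/-- The polynomial `∏ (X - Q_s)`. -/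
noncomputable def cyclo (Q : Fin r → R) : Polynomial R :=
  ∏ s : Fin r, (Polynomial.X - Polynomial.C (Q s))

theorem cyclo_monic : (cyclo Q).Monic :=
  Polynomial.monic_prod_of_monic _ _ fun s _ ↦ Polynomial.monic_X_sub_C (Q s)

theorem natDegree_cyclo [Nontrivial R] : (cyclo Q).natDegree = r := by
  rw [cyclo, Polynomial.natDegree_prod_of_monic _ _ fun s _ ↦ Polynomial.monic_X_sub_C (Q s)]
  simp

theorem aeval_gen_cyclo (i : Fin n) (hi : (i : ℕ) = 0) :
    Polynomial.aeval (gen n q Q i) (cyclo Q) = 0 := by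
  have := gen_rel n q Q (Rel.cyclotomic i hi)
  rwa [map_zero, ← Polynomial.aeval_algHom_apply, FreeAlgebra.lift_ι_apply] at this

theorem gen_mul_self (i : SimpleIdx n) : gen n q Q i.1 * gen n q Q i.1 =
    ((q : R) - 1) • gen n q Q i.1 + (q : R) • 1 := by
  have := gen_rel n q Q (Rel.quadratic i.1 i.2)
  simp only [map_mul, map_sub, map_add, map_one, map_zero, AlgHom.commutes,
    FreeAlgebra.lift_ι_apply] at this
  rw [sub_mul, mul_add, mul_add, ← Algebra.smul_def, ← Algebra.smul_def] at this
  rw [sub_smul, one_smul]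
  simp only [mul_one] at this
  rw [← sub_eq_zero, ← this]
  abel

theorem gen_four (i j : Fin n) (hi : (i : ℕ) = 0) (hj : (j : ℕ) = 1) :
    gen n q Q i * gen n q Q j * gen n q Q i * gen n q Q j =
      gen n q Q j * gen n q Q i * gen n q Q j * gen n q Q i := by
  have := gen_rel n q Q (Rel.braidFour i j hi hj)
  simpa only [map_mul, FreeAlgebra.lift_ι_apply] using this

theorem gen_braid (i j : SimpleIdx n) (hj : (j.1 : ℕ) = i.1 + 1) :
    gen n q Q j.1 * gen n q Q i.1 * gen n q Q j.1 =
      gen n q Q i.1 * gen n q Q j.1 * gen n q Q i.1 := by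
  have := gen_rel n q Q (Rel.braidThree i.1 j.1 i.2 hj)
  simpa only [map_mul, FreeAlgebra.lift_ι_apply] using this

theorem gen_comm (i j : Fin n) (hj : (i : ℕ) + 1 < j) :
    gen n q Q i * gen n q Q j = gen n q Q j * gen n q Q i := by
  have := gen_rel n q Q (Rel.comm i j hj)
  simpa only [map_mul, FreeAlgebra.lift_ι_apply] using this

theorem murphy_zero (i : Fin n) (hi : (i : ℕ) = 0) : murphy n q Q i = gen n q Q i := by
  obtain ⟨i, h⟩ := i
  subst hi
  rfl

theorem murphy_simple (i : SimpleIdx n) : murphy n q Q i.1 =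
    ((q⁻¹ : Rˣ) : R) • (gen n q Q i.1 * murphy n q Q (predPt i.1) * gen n q Q i.1) := by
  obtain ⟨⟨i, h⟩, hi⟩ := i
  obtain ⟨k, rfl⟩ := Nat.exists_eq_succ_of_ne_zero hi
  rfl

theorem gen_murphy_gen (i : SimpleIdx n) :
    gen n q Q i.1 * murphy n q Q (predPt i.1) * gen n q Q i.1 = (q : R) • murphy n q Q i.1 := by
  rw [murphy_simple, smul_smul]
  simp

/-- `T_i L_{i-1} = L_i (T_i - (q - 1))`. -/
theorem gen_mul_murphy_pred (i : SimpleIdx n) :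
    gen n q Q i.1 * murphy n q Q (predPt i.1) =
      murphy n q Q i.1 * gen n q Q i.1 - ((q : R) - 1) • murphy n q Q i.1 := by
  have h1 : gen n q Q i.1 * murphy n q Q (predPt i.1) * gen n q Q i.1 * gen n q Q i.1 =
    (q : R) • (murphy n q Q i.1 * gen n q Q i.1) := by
    rw [gen_murphy_gen, smul_mul_assoc]
  rw [mul_assoc _ (gen n q Q i.1) (gen n q Q i.1), gen_mul_self, mul_add, mul_smul_comm,
    gen_murphy_gen, mul_smul_comm, mul_one, smul_smul] at h1
  have h2 := congrArg (fun x ↦ ((q⁻¹ : Rˣ) : R) • x) h1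
  simp only [smul_add, smul_smul] at h2
  rw [mul_left_comm, Units.inv_mul, mul_one, one_smul, one_smul] at h2
  rw [← h2]; abel

/-- `T_i L_i = L_{i-1} T_i + (q - 1) L_i`. -/
theorem gen_mul_murphy_self (i : SimpleIdx n) :
    gen n q Q i.1 * murphy n q Q i.1 =
      murphy n q Q (predPt i.1) * gen n q Q i.1 + ((q : R) - 1) • murphy n q Q i.1 := by
  have h1 : gen n q Q i.1 * (gen n q Q i.1 * murphy n q Q (predPt i.1) * gen n q Q i.1) =
    (q : R) • (gen n q Q i.1 * murphy n q Q i.1) := by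
    rw [gen_murphy_gen, mul_smul_comm]
  rw [← mul_assoc, ← mul_assoc, gen_mul_self, add_mul, add_mul, smul_mul_assoc, smul_mul_assoc,
    gen_murphy_gen, smul_mul_assoc, one_mul, smul_mul_assoc, smul_smul] at h1
  have h2 := congrArg (fun x ↦ ((q⁻¹ : Rˣ) : R) • x) h1
  simp only [smul_add, smul_smul] at h2
  rw [mul_left_comm, Units.inv_mul, mul_one, one_smul, one_smul] at h2
  rw [← h2]; abel

theorem gen_commute_murphy_of_lt {i : Fin n} {k : Fin n} (h : (k : ℕ) + 1 < i) :
    Commute (gen n q Q i) (murphy n q Q k) := by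
  obtain ⟨k, hk⟩ := k
  induction k with
  | zero =>
    rw [murphy_zero _ _ _ rfl]
    exact (gen_comm q Q ⟨0, hk⟩ i h).symm
  | succ k ih =>
    rw [murphy_simple q Q ⟨⟨k + 1, hk⟩, Nat.succ_ne_zero k⟩]
    have h1 : Commute (gen n q Q i) (gen n q Q ⟨k + 1, hk⟩) := (gen_comm q Q ⟨k + 1, hk⟩ i h).symm
    exact Commute.smul_right ((h1.mul_right (ih (Nat.lt_of_succ_lt hk)
      (by simp only at h ⊢; omega))).mul_right h1) _

/-- Peel off the outer generators of L_k. A generator far from them passes through by induction. The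
neighbouring one is handled by the four-term braid relation at the bottom, and otherwise by two
ordinary braid relations around an inner Jucys–Murphy element. -/
theorem gen_commute_murphy_of_gt {i : Fin n} {k : Fin n} (h : (i : ℕ) < k) :
    Commute (gen n q Q i) (murphy n q Q k) := by
  obtain ⟨k, hk⟩ := k
  simp only at h
  induction k with
  | zero => omega
  | succ k ih =>
    rw [murphy_simple q Q ⟨⟨k + 1, hk⟩, Nat.succ_ne_zero k⟩]
    refine Commute.smul_right ?_ _
    have hp : predPt (⟨k + 1, hk⟩ : Fin n) = ⟨k, Nat.lt_of_succ_lt hk⟩ := rfl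
    rw [hp]
    rcases Nat.lt_or_ge (i : ℕ) k with hik | hik
    · have h1 : Commute (gen n q Q i) (gen n q Q ⟨k + 1, hk⟩) :=
        gen_comm q Q i ⟨k + 1, hk⟩ (by simp only; omega)
      exact (h1.mul_right (ih (Nat.lt_of_succ_lt hk) hik)).mul_right h1
    · obtain rfl : i = ⟨k, Nat.lt_of_succ_lt hk⟩ := Fin.ext (by simp only; omega)
      by_cases hk0 : k = 0
      · subst hk0
        rw [murphy_zero _ _ _ rfl, Commute, SemiconjBy]
        have := gen_four q Q ⟨0, Nat.lt_of_succ_lt hk⟩ ⟨0 + 1, hk⟩ rfl rfl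
        simpa only [mul_assoc] using this
      · set i : SimpleIdx n := ⟨⟨k, Nat.lt_of_succ_lt hk⟩, hk0⟩ with hi
        set j : SimpleIdx n := ⟨⟨k + 1, hk⟩, Nat.succ_ne_zero k⟩ with hj
        have hb := gen_braid q Q i j rfl
        have hc : Commute (gen n q Q j.1) (murphy n q Q (predPt i.1)) :=
          gen_commute_murphy_of_lt q Q (by rw [predPt_val]; simp only [hi, hj]; omega)
        have hm := murphy_simple q Q i
        change Commute (gen n q Q i.1) (gen n q Q j.1 * murphy n q Q i.1 * gen n q Q j.1)
        rw [hm, mul_smul_comm, smul_mul_assoc]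
        refine Commute.smul_right ?_ _
        rw [Commute, SemiconjBy]
        set a := gen n q Q i.1
        set b := gen n q Q j.1
        set l := murphy n q Q (predPt i.1)
        calc a * (b * (a * l * a) * b) = (a * b * a) * l * (a * b) := by simp only [mul_assoc]
          _ = (b * a * b) * l * (a * b) := by rw [hb]
          _ = b * a * (b * l) * (a * b) := by simp only [mul_assoc]
          _ = b * a * (l * b) * (a * b) := by rw [hc.eq]
          _ = b * a * l * (b * a * b) := by simp only [mul_assoc]
          _ = b * a * l * (a * b * a) := by rw [hb]
          _ = b * (a * l * a) * b * a := by simp only [mul_assoc]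

theorem murphy_commute_of_gen {A : Alg n q Q} {k : Fin n}
    (h : ∀ i : Fin n, i ≤ k → Commute A (gen n q Q i)) : Commute A (murphy n q Q k) := by
  obtain ⟨k, hk⟩ := k
  induction k with
  | zero => rw [murphy_zero _ _ _ rfl]; exact h _ le_rfl
  | succ k ih =>
    rw [murphy_simple q Q ⟨⟨k + 1, hk⟩, Nat.succ_ne_zero k⟩]
    have h1 := h ⟨k + 1, hk⟩ le_rfl
    exact Commute.smul_right ((h1.mul_right (ih (Nat.lt_of_succ_lt hk)
      fun i hi ↦ h i (hi.trans (by simp [Fin.le_def])))).mul_right h1) _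

theorem murphy_commute (j k : Fin n) : Commute (murphy n q Q j) (murphy n q Q k) := by
  rcases lt_trichotomy j k with h | h | h
  · exact (murphy_commute_of_gen q Q fun i hi ↦
      (gen_commute_murphy_of_gt q Q (lt_of_le_of_lt hi h)).symm).symm
  · rw [h]
  · exact murphy_commute_of_gen q Q fun i hi ↦
      (gen_commute_murphy_of_gt q Q (lt_of_le_of_lt hi h)).symm

theorem gen_commute_murphy (i : SimpleIdx n) {k : Fin n} (h1 : k ≠ predPt i.1) (h2 : k ≠ i.1) :
    Commute (gen n q Q i.1) (murphy n q Q k) := by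
  have := predPt_val i.1
  rcases lt_or_gt_of_ne h2 with h | h
  · apply gen_commute_murphy_of_lt
    have : (k : ℕ) ≠ predPt i.1 := fun h ↦ h1 (Fin.ext h)
    have := i.2
    rw [Fin.lt_def] at h
    omega
  · exact gen_commute_murphy_of_gt q Q h

theorem isMulCommutative_adjoin_murphy :
    IsMulCommutative (Algebra.adjoin R (Set.range (murphy n q Q))) :=
  Algebra.isMulCommutative_adjoin R (by
    rintro _ ⟨j, rfl⟩ _ ⟨k, rfl⟩
    exact (murphy_commute q Q j k).eq)

open scoped IsMulCommutative in
/-- Evaluation of polynomials at the Jucys–Murphy elements. -/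
noncomputable def ev : MvPolynomial (Fin n) R →ₐ[R] Alg n q Q :=
  have := isMulCommutative_adjoin_murphy (n := n) q Q
  (Algebra.adjoin R (Set.range (murphy n q Q))).val.comp
    (aeval fun k ↦ ⟨murphy n q Q k, Algebra.subset_adjoin ⟨k, rfl⟩⟩)

@[simp] theorem ev_X (k : Fin n) : ev q Q (X k) = murphy n q Q k := by
  simp [ev]

theorem ev_aeval_X (k : Fin n) (f : Polynomial R) :
    ev q Q (Polynomial.aeval (X k) f) = Polynomial.aeval (murphy n q Q k) f := by
  rw [← Polynomial.aeval_algHom_apply, ev_X]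

/-- The correction term in the commutation of `T_i` with polynomials in the `L_k`. -/
noncomputable def dl (a : R) (i : SimpleIdx n) :
    MvPolynomial (Fin n) R →ₗ[R] MvPolynomial (Fin n) R :=
  a • (LinearMap.mulLeft R (X i.1)).comp (dd i)

theorem dl_apply (a : R) (i : SimpleIdx n) (p : MvPolynomial (Fin n) R) :
    dl a i p = a • (X i.1 * dd i p) := rfl

theorem dl_mul (a : R) (i : SimpleIdx n) (p p' : MvPolynomial (Fin n) R) :
    dl a i (p * p') = sw i p * dl a i p' + dl a i p * p' := by
  simp only [dl_apply, dd_mul, mul_add, smul_add, smul_mul_assoc, mul_smul_comm]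
  congr 2 <;> ring

theorem dl_mem_Bd (a : R) {d : Fin n → ℕ} {i : SimpleIdx n} (h : d (predPt i.1) = d i.1)
    {p : MvPolynomial (Fin n) R} (hp : p ∈ Bd R d) : dl a i p ∈ Bd R d :=
  Submodule.smul_mem _ _ (X_mul_dd_mem_Bd h hp)

/-- The Bernstein relation for polynomials in the Jucys–Murphy elements. -/
theorem gen_mul_ev (i : SimpleIdx n) (p : MvPolynomial (Fin n) R) :
    gen n q Q i.1 * ev q Q p =
      ev q Q (sw i p) * gen n q Q i.1 + ev q Q (dl ((q : R) - 1) i p) := by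
  induction p using MvPolynomial.induction_on with
  | C a =>
    have h : sw i (C a) = C (σ := Fin n) a := by simp [sw]
    rw [h, dl_apply, dd_eq_zero h, mul_zero, smul_zero, map_zero, add_zero]
    have : ev q Q (C a : MvPolynomial (Fin n) R) = algebraMap R _ a := (ev q Q).commutes a
    rw [this, Algebra.commutes]
  | add p p' hp hp' =>
    simp only [map_add, mul_add, add_mul, hp, hp']
    abel
  | mul_X p j hp =>
    -- A single variable suffices: `dl` obeys the twisted Leibniz rule `dl_mul`, which is exactly
    -- what T_i produces when it passes a product.
    have hX : gen n q Q i.1 * ev q Q (X j) =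
        ev q Q (sw i (X j)) * gen n q Q i.1 + ev q Q (dl ((q : R) - 1) i (X j)) := by
      rw [dl_apply, sw_X, ev_X, ev_X, map_smul, map_mul, ev_X]
      by_cases h1 : j = i.1
      · subst h1
        rw [gen_mul_murphy_self, dd_X_self, map_one, mul_one, simpleSwap_right]
      by_cases h2 : j = predPt i.1
      · subst h2
        rw [gen_mul_murphy_pred, dd_X_pred, map_neg, map_one, mul_neg, mul_one, smul_neg,
          ← sub_eq_add_neg, simpleSwap_left]
      · rw [(gen_commute_murphy q Q i h2 h1).eq, dd_X_of_ne h2 h1, map_zero, mul_zero, smul_zero,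
          add_zero, simpleSwap_of_ne h2 h1]
    rw [map_mul, ← mul_assoc, hp, add_mul, mul_assoc, hX, dl_mul, map_mul (sw i),
      map_add (ev q Q), map_mul (ev q Q), map_mul (ev q Q), map_mul (ev q Q), mul_add]
    simp only [mul_assoc]
    abel

end Relations

/-! ### The elements T_w and the finite Hecke algebra inside ℋ -/

section Hecke

variable {R : Type*} [CommRing R] {r n : ℕ} (q : Rˣ) (Q : Fin r → R)

/-- The word property makes `T` independent of the reduced word chosen in its definition. -/
theorem T_eq_prod {w : Equiv.Perm (Fin n)} {l : List (SimpleIdx n)} (hl : IsReduced l)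
    (h : wordPerm l = w) : T n q Q w = (l.map fun i ↦ gen n q Q i.1).prod :=
  prod_eq_of_isReduced _ (fun i j hij ↦ gen_comm q Q i.1 j.1 hij)
    (fun i j hij ↦ gen_braid q Q i j hij) (isReduced_reducedWord w) hl
    (by rw [wordPerm_reducedWord, h])

theorem T_refl : T n q Q (Equiv.refl _) = 1 := by
  rw [T_eq_prod q Q (l := []) (by simp [IsReduced, wordPerm, inv_refl]) (by rfl)]
  simp

theorem T_mul_T {u w : Equiv.Perm (Fin n)} (h : inv (u.trans w) = inv u + inv w) :
    T n q Q u * T n q Q w = T n q Q (u.trans w) := by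
  have e : wordPerm (reducedWord u ++ reducedWord w) = u.trans w := by
    rw [wordPerm_append, wordPerm_reducedWord, wordPerm_reducedWord]
  rw [T_eq_prod q Q (l := reducedWord u ++ reducedWord w) _ e, List.map_append, List.prod_append]
  · rfl
  · rw [IsReduced, e, List.length_append, length_reducedWord, length_reducedWord, h]

theorem T_simpleSwap (i : SimpleIdx n) : T n q Q (simpleSwap i) = gen n q Q i.1 := by
  rw [T_eq_prod q Q (l := [i]) _ (by rfl)]
  · simp
  · have : wordPerm [i] = simpleSwap i := rfl
    rw [IsReduced, this, inv_simpleSwap]; rfl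

theorem gen_mul_T_of_ascent {i : SimpleIdx n} {w : Equiv.Perm (Fin n)}
    (h : w (predPt i.1) < w i.1) :
    gen n q Q i.1 * T n q Q w = T n q Q ((simpleSwap i).trans w) := by
  rw [← T_simpleSwap, T_mul_T]
  rw [inv_simpleSwap_trans h, inv_simpleSwap, add_comm]

theorem gen_mul_T_of_descent {i : SimpleIdx n} {w : Equiv.Perm (Fin n)}
    (h : w i.1 < w (predPt i.1)) :
    gen n q Q i.1 * T n q Q w =
      (q : R) • T n q Q ((simpleSwap i).trans w) + ((q : R) - 1) • T n q Q w := by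
  have h1 : gen n q Q i.1 * T n q Q ((simpleSwap i).trans w) = T n q Q w := by
    rw [gen_mul_T_of_ascent, simpleSwap_trans_trans]
    simpa [simpleSwap_left, simpleSwap_right] using h
  conv_lhs => rw [← h1, ← mul_assoc, gen_mul_self, add_mul, smul_mul_assoc, smul_mul_assoc,
    one_mul, h1]
  rw [add_comm]

theorem starMap_list_prod (l : List (SimpleIdx n)) :
    starMap n q Q (l.map fun i ↦ gen n q Q i.1).prod =
      (l.reverse.map fun i ↦ gen n q Q i.1).prod := by
  induction l with
  | nil => simp [starMap]
  | cons i l ih =>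
    rw [List.map_cons, List.prod_cons, starMap_mul, ih, starMap_gen, List.reverse_cons,
      List.map_append, List.prod_append]
    simp

theorem wordPerm_reverse (l : List (SimpleIdx n)) : wordPerm l.reverse = (wordPerm l).symm := by
  induction l with
  | nil => rfl
  | cons i l ih =>
    rw [List.reverse_cons, wordPerm_append, ih]
    ext k
    simp [wordPerm]

theorem starMap_T (w : Equiv.Perm (Fin n)) : starMap n q Q (T n q Q w) = T n q Q w.symm := by
  have e : wordPerm (reducedWord w).reverse = w.symm := by
    rw [wordPerm_reverse, wordPerm_reducedWord]
  rw [T_eq_prod q Q (l := (reducedWord w).reverse) _ e, T, starMap_list_prod]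
  rw [IsReduced, e, List.length_reverse, length_reducedWord, inv_symm]

/-- The subalgebra generated by `T_i` for `0 < i < k`. -/
def HS (n k : ℕ) (q : Rˣ) (Q : Fin r → R) : Subalgebra R (Alg n q Q) :=
  Algebra.adjoin R {x | ∃ i : SimpleIdx n, (i.1 : ℕ) < k ∧ gen n q Q i.1 = x}

theorem gen_mem_HS {k : ℕ} {i : SimpleIdx n} (h : (i.1 : ℕ) < k) :
    gen n q Q i.1 ∈ HS n k q Q := Algebra.subset_adjoin ⟨i, h, rfl⟩

theorem HS_mono {k l : ℕ} (h : k ≤ l) : HS n k q Q ≤ HS n l q Q :=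
  Algebra.adjoin_mono fun _ ⟨i, hi, e⟩ ↦ ⟨i, hi.trans_le h, e⟩

theorem murphy_commute_of_mem_HS {k : Fin n} {h : Alg n q Q} (hh : h ∈ HS n k q Q) :
    Commute (murphy n q Q k) h := by
  induction hh using Algebra.adjoin_induction with
  | mem x hx =>
    obtain ⟨i, hi, rfl⟩ := hx
    exact (gen_commute_murphy_of_gt q Q hi).symm
  | algebraMap a => exact (Algebra.commutes a _).symm
  | add x y _ _ hx hy => exact hx.add_right hy
  | mul x y _ _ hx hy => exact hx.mul_right hy

/-- Since the points from `k` on are fixed, every descent of `w` has index below `k`; removing one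
keeps those points fixed. -/
theorem T_mem_HS_of_fix {k : ℕ} {w : Equiv.Perm (Fin n)} (h : ∀ j : Fin n, k ≤ j → w j = j) :
    T n q Q w ∈ HS n k q Q := by
  induction hN : inv w generalizing w with
  | zero => rw [eq_refl_of_inv_eq_zero hN, T_refl]; exact one_mem _
  | succ N ih =>
    by_cases ha : ∀ i : SimpleIdx n, w (predPt i.1) < w i.1
    · rw [eq_refl_of_ascents ha, inv_refl] at hN; omega
    push Not at ha
    obtain ⟨i, hi⟩ := ha
    have hi' := (ascent_or_descent i w).resolve_left hi.not_gt
    have hik : (i.1 : ℕ) < k := by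
      by_contra hc
      push Not at hc
      rw [h _ hc] at hi'
      have h3 : ∀ j, k ≤ (w j : ℕ) → w j = j := fun j hj ↦ w.injective (h _ hj)
      have h4 := h3 (predPt i.1) (hc.trans (Fin.lt_def.1 hi').le)
      rw [h4] at hi'
      exact hi'.asymm (predPt_lt i)
    have h1 := gen_mul_T_of_ascent q Q (i := i) (w := (simpleSwap i).trans w)
      (by simpa [simpleSwap_left, simpleSwap_right] using hi')
    rw [simpleSwap_trans_trans] at h1
    rw [← h1]
    refine mul_mem (gen_mem_HS q Q hik) (ih (fun j hj ↦ ?_) ?_)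
    · have hp := predPt_val i.1
      rw [Equiv.trans_apply, simpleSwap_of_ne, h j hj]
      · rw [Ne, Fin.ext_iff]; omega
      · rw [Ne, Fin.ext_iff]; omega
    · have := inv_simpleSwap_trans' hi'
      omega

theorem HS_le_span_T (k : ℕ) : Subalgebra.toSubmodule (HS n k q Q) ≤
    Submodule.span R (Set.range (T n q Q)) := by
  have key : ∀ h ∈ HS n k q Q, ∀ x ∈ Submodule.span R (Set.range (T n q Q)),
      h * x ∈ Submodule.span R (Set.range (T n q Q)) := by
    intro h hh
    induction hh using Algebra.adjoin_induction with
    | mem x hx =>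
      obtain ⟨i, hi, rfl⟩ := hx
      intro x hx
      have : Submodule.span R (Set.range (T n q Q)) ≤
          (Submodule.span R (Set.range (T n q Q))).comap (LinearMap.mulLeft R (gen n q Q i.1)) := by
        rw [Submodule.span_le]
        rintro _ ⟨w, rfl⟩
        change gen n q Q i.1 * T n q Q w ∈ Submodule.span R (Set.range (T n q Q))
        rcases ascent_or_descent i w with hw | hw
        · rw [gen_mul_T_of_ascent q Q hw]; exact Submodule.subset_span ⟨_, rfl⟩
        · rw [gen_mul_T_of_descent q Q hw]
          exact Submodule.add_mem _ (Submodule.smul_mem _ _ (Submodule.subset_span ⟨_, rfl⟩))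
            (Submodule.smul_mem _ _ (Submodule.subset_span ⟨_, rfl⟩))
      exact this hx
    | algebraMap a => intro x hx; rw [← Algebra.smul_def]; exact Submodule.smul_mem _ _ hx
    | add x y _ _ hx hy => intro z hz; rw [add_mul]; exact Submodule.add_mem _ (hx z hz) (hy z hz)
    | mul x y _ _ hx hy => intro z hz; rw [mul_assoc]; exact hx _ (hy z hz)
  intro h hh
  have := key h hh 1 (Submodule.subset_span ⟨Equiv.refl _, T_refl q Q⟩)
  rwa [mul_one] at this

end Hecke

/-! ### The monomials L^c T_w span ℋ; uniqueness of τ -/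

section Spanning

variable {R : Type*} [CommRing R] {r n : ℕ} (q : Rˣ) (Q : Fin r → R)

/-- The products of an element of `S` evaluated at the Jucys–Murphy elements by an element of
`HS n k`. -/
noncomputable def evHS (k : ℕ) (S : Submodule R (MvPolynomial (Fin n) R)) :
    Submodule R (Alg n q Q) :=
  S.map (ev q Q).toLinearMap * Subalgebra.toSubmodule (HS n k q Q)

theorem ev_mul_mem_evHS {k : ℕ} {S : Submodule R (MvPolynomial (Fin n) R)}
    {p : MvPolynomial (Fin n) R} (hp : p ∈ S) {h : Alg n q Q} (hh : h ∈ HS n k q Q) :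
    ev q Q p * h ∈ evHS q Q k S :=
  Submodule.mul_mem_mul (Submodule.mem_map_of_mem hp) hh

theorem evHS_mul_mem {k : ℕ} {S : Submodule R (MvPolynomial (Fin n) R)} {x h : Alg n q Q}
    (hx : x ∈ evHS q Q k S) (hh : h ∈ HS n k q Q) : x * h ∈ evHS q Q k S := by
  have := Submodule.mul_mem_mul hx (show h ∈ Subalgebra.toSubmodule (HS n k q Q) from hh)
  rwa [evHS, mul_assoc, (Subalgebra.isIdempotentElem_toSubmodule _).eq] at this

/-- To map `evHS` into a submodule it suffices to do so for the generators. -/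
theorem evHS_map {k : ℕ} {S : Submodule R (MvPolynomial (Fin n) R)} {N : Type*} [AddCommGroup N]
    [Module R N] (L : Alg n q Q →ₗ[R] N) {S' : Submodule R N}
    (h : ∀ p ∈ S, ∀ h ∈ HS n k q Q, L (ev q Q p * h) ∈ S') {x : Alg n q Q}
    (hx : x ∈ evHS q Q k S) : L x ∈ S' := by
  have : evHS q Q k S ≤ S'.comap L := by
    rw [evHS, Submodule.mul_le]
    rintro _ ⟨p, hp, rfl⟩ y hy
    exact h p hp y hy
  exact this hx

/-- If `T_i p` can be rewritten within `S`, then `evHS` is stable under `T_i`. -/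
theorem gen_mul_mem_evHS {k : ℕ} {S : Submodule R (MvPolynomial (Fin n) R)} {i : SimpleIdx n}
    (hi : (i.1 : ℕ) < k) (h1 : ∀ p ∈ S, sw i p ∈ S)
    (h2 : ∀ p ∈ S, dl ((q : R) - 1) i p ∈ S) {x : Alg n q Q}
    (hx : x ∈ evHS q Q k S) : gen n q Q i.1 * x ∈ evHS q Q k S := by
  refine evHS_map q Q (LinearMap.mulLeft R (gen n q Q i.1)) (fun p hp h hh ↦ ?_) hx
  rw [LinearMap.mulLeft_apply, ← mul_assoc, gen_mul_ev, add_mul, mul_assoc]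
  exact Submodule.add_mem _ (ev_mul_mem_evHS q Q (h1 p hp) (mul_mem (gen_mem_HS q Q hi) hh))
    (ev_mul_mem_evHS q Q (h2 p hp) hh)

/-- The first Jucys–Murphy element is T_0, so the multiple of the cyclotomic polynomial subtracted
by `redMul` evaluates to zero. -/
theorem ev_redMul {i : Fin n} (hi : (i : ℕ) = 0) (p : MvPolynomial (Fin n) R) :
    ev q Q (redMul i (cyclo Q) p) = gen n q Q i * ev q Q p := by
  rw [redMul_apply, map_sub, map_mul, map_mul, ev_aeval_X, murphy_zero q Q i hi,
    aeval_gen_cyclo q Q i hi, zero_mul, sub_zero, ev_X, murphy_zero q Q i hi]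

/-- The degree bounds `r` for the first `k` variables and `1` for the others. -/
def bound (r k : ℕ) (j : Fin n) : ℕ := if (j : ℕ) < k then r else 1

/-- For T_0 the cyclotomic relation brings the degree back below `r`. For the others the Bernstein
relation respects the bound, which is the same for both exchanged variables. -/
theorem gen_mul_mem_evHS_bound {k : ℕ} {i : Fin n} (hi : (i : ℕ) < k) {x : Alg n q Q}
    (hx : x ∈ evHS q Q k (Bd R (bound r k))) :
    gen n q Q i * x ∈ evHS q Q k (Bd R (bound r k)) := by
  nontriviality Alg n q Q
  have : Nontrivial R := (algebraMap R (Alg n q Q)).domain_nontrivial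
  by_cases h0 : (i : ℕ) = 0
  · refine evHS_map q Q (LinearMap.mulLeft R (gen n q Q i)) (fun p hp h hh ↦ ?_) hx
    rw [LinearMap.mulLeft_apply, ← mul_assoc, ← ev_redMul q Q h0]
    refine ev_mul_mem_evHS q Q (redMul_mem_Bd (cyclo_monic Q) ?_ hp) hh
    rw [natDegree_cyclo, bound, if_pos hi]
  · have hb : bound r k (predPt i) = bound r k i := by
      have := predPt_val i
      rw [bound, bound, if_pos hi, if_pos (by omega)]
    exact gen_mul_mem_evHS q Q (i := ⟨i, h0⟩) hi (fun p hp ↦ sw_mem_Bd hb hp)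
      (fun p hp ↦ dl_mem_Bd _ hb hp) hx

theorem bound_pos {k : ℕ} (hr : 0 < r) (j : Fin n) : 0 < bound r k j := by
  rw [bound]; split_ifs <;> omega

theorem one_mem_evHS_bound {k : ℕ} (hr : 0 < n → 0 < r) :
    (1 : Alg n q Q) ∈ evHS q Q k (Bd R (bound r k)) := by
  have := ev_mul_mem_evHS q Q (one_mem_Bd (R := R) fun j ↦ bound_pos (k := k) (hr j.pos) j)
    (one_mem (HS n k q Q))
  rwa [map_one, one_mul] at this

/-- The subalgebra generated by `T_0, …, T_{k-1}`. -/
def AS (n k : ℕ) (q : Rˣ) (Q : Fin r → R) : Subalgebra R (Alg n q Q) :=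
  Algebra.adjoin R {x | ∃ i : Fin n, (i : ℕ) < k ∧ gen n q Q i = x}

/-- The right side contains 1 and is stable under left multiplication by the generators. All `k` are
needed, not only `k = n`: the straightening argument normalizes inside the smaller algebras. -/
theorem AS_le_evHS (hr : 0 < n → 0 < r) (k : ℕ) : Subalgebra.toSubmodule (AS n k q Q) ≤
    evHS q Q k (Bd R (bound r k)) := by
  have key : ∀ h ∈ AS n k q Q, ∀ x ∈ evHS q Q k (Bd R (bound r k)),
      h * x ∈ evHS q Q k (Bd R (bound r k)) := by
    intro h hh
    induction hh using Algebra.adjoin_induction with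
    | mem x hx =>
      obtain ⟨i, hi, rfl⟩ := hx
      exact fun x hx ↦ gen_mul_mem_evHS_bound q Q hi hx
    | algebraMap a => intro x hx; rw [← Algebra.smul_def]; exact Submodule.smul_mem _ _ hx
    | add x y _ _ hx hy => intro z hz; rw [add_mul]; exact Submodule.add_mem _ (hx z hz) (hy z hz)
    | mul x y _ _ hx hy => intro z hz; rw [mul_assoc]; exact hx _ (hy z hz)
  intro h hh
  have := key h hh 1 (one_mem_evHS_bound q Q hr)
  rwa [mul_one] at this

theorem mem_AS (x : Alg n q Q) : x ∈ AS n n q Q := by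
  obtain ⟨y, rfl⟩ := RingQuot.mkAlgHom_surjective R (Rel n q Q) x
  induction y using FreeAlgebra.induction with
  | grade0 a => rw [AlgHom.commutes]; exact Subalgebra.algebraMap_mem _ a
  | grade1 i => exact Algebra.subset_adjoin ⟨i, i.2, rfl⟩
  | mul a b ha hb => rw [map_mul]; exact mul_mem ha hb
  | add a b ha hb => rw [map_add]; exact add_mem ha hb

theorem akMonomial_eq (c : Fin n → Fin r) (w : Equiv.Perm (Fin n)) :
    akMonomial n q Q c w =
      ev q Q (monomial (Finsupp.equivFunOnFinite.symm fun k ↦ (c k : ℕ)) 1) * T n q Q w := by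
  rw [akMonomial, monomial_eq]
  congr 1
  rw [map_one, one_mul, Finsupp.prod_fintype _ _ (by simp), ← List.prod_ofFn, map_list_prod,
    List.map_ofFn]
  congr 2
  ext k
  simp

/-- The Ariki–Koike monomials span the algebra. -/
theorem span_akMonomial (hr : 0 < n → 0 < r) :
    Submodule.span R (Set.range fun x : (Fin n → Fin r) × Equiv.Perm (Fin n) ↦
      akMonomial n q Q x.1 x.2) = ⊤ := by
  rw [eq_top_iff]
  intro x _
  have hx := AS_le_evHS q Q hr n (mem_AS q Q x)
  rw [evHS, Bd_eq_span, Submodule.map_span] at hx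
  have h2 : Submodule.span R (((ev q Q).toLinearMap : MvPolynomial (Fin n) R → Alg n q Q) ''
      ((monomial · 1) '' {e : Fin n →₀ ℕ | ∀ j, e j < bound r n j})) *
      Subalgebra.toSubmodule (HS n n q Q) ≤
      Submodule.span R (((ev q Q).toLinearMap : MvPolynomial (Fin n) R → Alg n q Q) ''
      ((monomial · 1) '' {e : Fin n →₀ ℕ | ∀ j, e j < bound r n j})) *
      Submodule.span R (Set.range (T n q Q)) :=
    mul_le_mul' le_rfl (HS_le_span_T q Q n)
  have h3 := h2 hx
  rw [Submodule.span_mul_span] at h3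
  refine Submodule.span_mono ?_ h3
  rintro _ ⟨_, ⟨_, ⟨e, he, rfl⟩, rfl⟩, _, ⟨w, rfl⟩, rfl⟩
  have he' : ∀ j, e j < r := fun j ↦ by simpa [bound] using he j
  refine ⟨(fun j ↦ ⟨e j, he' j⟩, w), ?_⟩
  simp only [akMonomial_eq, AlgHom.toLinearMap_apply]
  congr 4
  ext j
  simp

theorem isCanonicalForm_unique (hr : 0 < n → 0 < r) {τ τ' : Alg n q Q →ₗ[R] R}
    (h : IsCanonicalForm n q Q τ) (h' : IsCanonicalForm n q Q τ') : τ = τ' := by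
  apply LinearMap.ext_on_range (span_akMonomial q Q hr)
  rintro ⟨c, w⟩
  by_cases hc : (∀ k, (c k : ℕ) = 0) ∧ w = 1
  · rw [(h c w).1 hc, (h' c w).1 hc]
  · rw [(h c w).2 hc, (h' c w).2 hc]

end Spanning

end Algebra

/-! ### The operators of the representation and their relations -/

section Representation

variable {R : Type*} [CommRing R] {r n : ℕ}

/-- Functions on the symmetric group with values in polynomials: the free module on the products
of a monomial in `n` variables by an element of the symmetric group. -/
abbrev PolyFun (R : Type*) [CommRing R] (n : ℕ) : Type _ :=
  Equiv.Perm (Fin n) → MvPolynomial (Fin n) R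

/-- Reduces operator identities to constant functions, where they are identities in the regular
representation of the Hecke algebra, plus compatibility with multiplication by one variable. -/
theorem PolyFun.induction {P : PolyFun R n → Prop}
    (const : ∀ a : Equiv.Perm (Fin n) → R, P fun w ↦ C (a w))
    (add : ∀ m m', P m → P m' → P (m + m'))
    (X_smul : ∀ (j : Fin n) m, P m → P ((X j : MvPolynomial (Fin n) R) • m)) (m : PolyFun R n) :
    P m := by
  have hs : ∀ (w : Equiv.Perm (Fin n)) (p : MvPolynomial (Fin n) R), P (Pi.single w p) := by
    intro w p
    induction p using MvPolynomial.induction_on with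
    | C a =>
      convert const (Pi.single w a) using 1
      funext v
      by_cases h : v = w
      · subst h; simp
      · simp [h]
    | add p p' hp hp' => rw [Pi.single_add]; exact add _ _ hp hp'
    | mul_X p j hp =>
      convert X_smul j _ hp using 1
      rw [← Pi.single_smul, smul_eq_mul, mul_comm]
  have h0 : P 0 := by
    convert const 0 using 1
    funext v; simp
  rw [← Finset.univ_sum_single m]
  exact Finset.sum_induction _ P add h0 fun w _ ↦ hs w _

/-- The action of `T_i`, `0 < i`, on `PolyFun R n`. -/
noncomputable def opT (q : R) (i : SimpleIdx n) : PolyFun R n →ₗ[R] PolyFun R n where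
  -- Here `m` stands for the sum of the m(w) T_w. The first summand is the Bernstein correction; the
  -- second is the coefficient of T_w in the sum of the s_i(m(v)) T_i T_v.
  toFun m w := dl (q - 1) i (m w) +
    if w i.1 < w (predPt i.1) then
      sw i (m ((simpleSwap i).trans w)) + (q - 1) • sw i (m w)
    else q • sw i (m ((simpleSwap i).trans w))
  map_add' m m' := by
    funext w
    simp only [Pi.add_apply, map_add, smul_add]
    split_ifs <;> abel
  map_smul' a m := by
    funext w
    simp only [Pi.smul_apply, map_smul, RingHom.id_apply, smul_add]
    split_ifs
    · rw [smul_add, smul_comm a (q - 1)]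
    · rw [smul_comm a q]

theorem opT_apply (q : R) (i : SimpleIdx n) (m : PolyFun R n) (w : Equiv.Perm (Fin n)) :
    opT q i m w = dl (q - 1) i (m w) +
    if w i.1 < w (predPt i.1) then
      sw i (m ((simpleSwap i).trans w)) + (q - 1) • sw i (m w)
    else q • sw i (m ((simpleSwap i).trans w)) := rfl

theorem opT_smul (q : R) (i : SimpleIdx n) (p : MvPolynomial (Fin n) R) (m : PolyFun R n) :
    opT q i (p • m) = sw i p • opT q i m + dl (q - 1) i p • m := by
  funext w
  simp only [opT_apply, Pi.add_apply, Pi.smul_apply, smul_eq_mul, dl_mul, map_mul]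
  split_ifs
  · simp only [mul_add, mul_smul_comm]; abel
  · simp only [mul_add, mul_smul_comm]; abel

theorem opT_X_self (q : R) (i : SimpleIdx n) (m : PolyFun R n) :
    opT q i ((X i.1 : MvPolynomial (Fin n) R) • m) =
      (X (predPt i.1) : MvPolynomial (Fin n) R) • opT q i m +
        (q - 1) • (X i.1 : MvPolynomial (Fin n) R) • m := by
  rw [opT_smul, sw_X, simpleSwap_right, dl_apply, dd_X_self, mul_one, smul_assoc]

theorem opT_X_pred (q : R) (i : SimpleIdx n) (m : PolyFun R n) :
    opT q i ((X (predPt i.1) : MvPolynomial (Fin n) R) • m) =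
      (X i.1 : MvPolynomial (Fin n) R) • opT q i m -
        (q - 1) • (X i.1 : MvPolynomial (Fin n) R) • m := by
  rw [opT_smul, sw_X, simpleSwap_left, dl_apply, dd_X_pred, mul_neg, mul_one, smul_neg,
    neg_smul, smul_assoc]
  exact (sub_eq_add_neg _ _).symm

theorem opT_X_of_ne (q : R) {i : SimpleIdx n} {j : Fin n} (h1 : j ≠ predPt i.1) (h2 : j ≠ i.1)
    (m : PolyFun R n) : opT q i ((X j : MvPolynomial (Fin n) R) • m) =
      (X j : MvPolynomial (Fin n) R) • opT q i m := by
  rw [opT_smul, sw_X, simpleSwap_of_ne h1 h2, dl_apply, dd_X_of_ne h1 h2, mul_zero, smul_zero,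
    zero_smul, add_zero]

/-- The action of `T_i`, `0 < i`, on the regular representation of the finite Hecke algebra. -/
def heckeAct (q : R) (i : SimpleIdx n) (a : Equiv.Perm (Fin n) → R) (w : Equiv.Perm (Fin n)) : R :=
  if w i.1 < w (predPt i.1) then a ((simpleSwap i).trans w) + (q - 1) * a w
  else q * a ((simpleSwap i).trans w)

theorem opT_const (q : R) (i : SimpleIdx n) (a : Equiv.Perm (Fin n) → R) :
    opT q i (fun w ↦ C (a w)) = fun w ↦ C (heckeAct q i a w) := by
  funext w
  have h : ∀ b : R, sw i (C b) = C (σ := Fin n) b := fun b ↦ by simp [sw]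
  simp only [opT_apply, dl_apply, dd_eq_zero (h _), h, heckeAct]
  split_ifs <;> simp [smul_eq_C_mul]

theorem heckeAct_heckeAct (q : R) (i : SimpleIdx n) (a : Equiv.Perm (Fin n) → R)
    (w : Equiv.Perm (Fin n)) :
    heckeAct q i (heckeAct q i a) w = (q - 1) * heckeAct q i a w + q * a w := by
  simp only [heckeAct, Equiv.trans_apply, simpleSwap_left, simpleSwap_right,
    simpleSwap_trans_trans]
  rcases ascent_or_descent i w with h | h
  · simp only [h, h.not_gt, if_true, if_false]; ring
  · simp only [h, h.not_gt, if_true, if_false]; ring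

theorem simpleSwap_trans_comm {i j : SimpleIdx n} (hij : (i.1 : ℕ) + 1 < j.1)
    (w : Equiv.Perm (Fin n)) :
    (simpleSwap j).trans ((simpleSwap i).trans w) =
      (simpleSwap i).trans ((simpleSwap j).trans w) := by
  ext k
  simp [simpleSwap_comm hij]

theorem simpleSwap_trans_braid {i j : SimpleIdx n} (hij : (j.1 : ℕ) = i.1 + 1)
    (w : Equiv.Perm (Fin n)) :
    (simpleSwap j).trans ((simpleSwap i).trans ((simpleSwap j).trans w)) =
      (simpleSwap i).trans ((simpleSwap j).trans ((simpleSwap i).trans w)) := by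
  ext k
  simp [simpleSwap_braid hij]

theorem ne_of_far {i j : SimpleIdx n} (hij : (i.1 : ℕ) + 1 < j.1) :
    predPt i.1 ≠ predPt j.1 ∧ predPt i.1 ≠ j.1 ∧ i.1 ≠ predPt j.1 ∧ i.1 ≠ j.1 := by
  have hpi := predPt_val i.1
  have hpj := predPt_val j.1
  simp only [Ne, Fin.ext_iff]
  omega

theorem heckeAct_comm (q : R) {i j : SimpleIdx n} (hij : (i.1 : ℕ) + 1 < j.1)
    (a : Equiv.Perm (Fin n) → R) (w : Equiv.Perm (Fin n)) :
    heckeAct q i (heckeAct q j a) w = heckeAct q j (heckeAct q i a) w := by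
  obtain ⟨h1, h2, h3, h4⟩ := ne_of_far hij
  simp only [heckeAct, Equiv.trans_apply, simpleSwap_of_ne h1 h2, simpleSwap_of_ne h3 h4,
    simpleSwap_of_ne h1.symm h3.symm, simpleSwap_of_ne h2.symm h4.symm, simpleSwap_trans_comm hij]
  split_ifs <;> ring

theorem ne_of_near {i j : SimpleIdx n} (hij : (j.1 : ℕ) = i.1 + 1) :
    predPt j.1 = i.1 ∧ j.1 ≠ predPt i.1 ∧ j.1 ≠ i.1 := by
  have hpi := predPt_val i.1
  refine ⟨predPt_eq_of_val hij, ?_⟩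
  simp only [Ne, Fin.ext_iff]
  omega

theorem heckeAct_braid (q : R) {i j : SimpleIdx n} (hij : (j.1 : ℕ) = i.1 + 1)
    (a : Equiv.Perm (Fin n) → R) (w : Equiv.Perm (Fin n)) :
    heckeAct q j (heckeAct q i (heckeAct q j a)) w =
      heckeAct q i (heckeAct q j (heckeAct q i a)) w := by
  obtain ⟨hp, h1, h2⟩ := ne_of_near hij
  have si1 := simpleSwap_left i
  have si2 := simpleSwap_right i
  have si3 := simpleSwap_of_ne h1 h2
  have sj1 : simpleSwap j i.1 = j.1 := by rw [← hp, simpleSwap_left]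
  have sj2 : simpleSwap j j.1 = i.1 := by rw [simpleSwap_right, hp]
  have sj3 : simpleSwap j (predPt i.1) = predPt i.1 :=
    simpleSwap_of_ne (by rw [hp]; exact predPt_ne i) h1.symm
  simp only [heckeAct, Equiv.trans_apply, hp, si1, si2, si3, sj1, sj2, sj3,
    simpleSwap_trans_trans, simpleSwap_trans_braid hij]
  -- Which branches occur depends only on the relative order of the three values of `w`; two of the
  -- eight sign patterns contradict transitivity.
  have d1 : w (predPt i.1) ≠ w i.1 := fun h ↦ predPt_ne i (w.injective h)
  have d2 : w i.1 ≠ w j.1 := fun h ↦ h2 (w.injective h).symm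
  have d3 : w (predPt i.1) ≠ w j.1 := fun h ↦ h1 (w.injective h).symm
  generalize w (predPt i.1) = A at *
  generalize w i.1 = B at *
  generalize w j.1 = D at *
  rcases lt_or_gt_of_ne d1 with h1 | h1 <;> rcases lt_or_gt_of_ne d2 with h2 | h2 <;>
    rcases lt_or_gt_of_ne d3 with h3 | h3 <;>
    first
    | exact absurd (h1.trans h2) h3.not_gt
    | exact absurd (h2.trans h1) h3.not_gt
    | (simp only [h1, h2, h3, h1.not_gt, h2.not_gt, h3.not_gt, if_true, if_false]; done)
    | (simp only [h1, h2, h3, h1.not_gt, h2.not_gt, h3.not_gt, if_true, if_false]; ring)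

theorem opT_opT (q : R) (i : SimpleIdx n) (m : PolyFun R n) :
    opT q i (opT q i m) = (q - 1) • opT q i m + q • m := by
  induction m using PolyFun.induction with
  | const a =>
    rw [opT_const, opT_const]
    funext w
    rw [heckeAct_heckeAct]
    simp [smul_eq_C_mul]
  | add m m' h h' => simp only [map_add, h, h', smul_add]; abel
  | X_smul j m h =>
    by_cases h1 : j = i.1
    · subst h1
      simp only [opT_X_self, map_add, map_smul, opT_X_pred, h, smul_add]
      module
    by_cases h2 : j = predPt i.1
    · subst h2
      simp only [opT_X_self, map_sub, map_smul, opT_X_pred, h, smul_add]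
      module
    · simp only [opT_X_of_ne q h2 h1, h, smul_add]
      module

theorem opT_comm (q : R) {i j : SimpleIdx n} (hij : (i.1 : ℕ) + 1 < j.1) (m : PolyFun R n) :
    opT q i (opT q j m) = opT q j (opT q i m) := by
  obtain ⟨h1, h2, h3, h4⟩ := ne_of_far hij
  induction m using PolyFun.induction with
  | const a =>
    simp only [opT_const]
    funext w
    rw [heckeAct_comm q hij]
  | add m m' h h' => simp only [map_add, h, h']
  | X_smul k m h =>
    by_cases k1 : k = i.1
    · subst k1
      simp only [opT_X_self, opT_X_of_ne q h3 h4, opT_X_of_ne q h1 h2, map_add, map_smul, h]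
    by_cases k2 : k = predPt i.1
    · subst k2
      simp only [opT_X_pred, opT_X_of_ne q h3 h4, opT_X_of_ne q h1 h2, map_sub, map_smul, h]
    by_cases k3 : k = j.1
    · subst k3
      simp only [opT_X_self, opT_X_of_ne q h2.symm h4.symm, opT_X_of_ne q h1.symm h3.symm,
        map_add, map_smul, h]
    by_cases k4 : k = predPt j.1
    · subst k4
      simp only [opT_X_pred, opT_X_of_ne q h2.symm h4.symm, opT_X_of_ne q h1.symm h3.symm,
        map_sub, map_smul, h]
    · simp only [opT_X_of_ne q k2 k1, opT_X_of_ne q k4 k3, h]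

theorem opT_braid (q : R) {i j : SimpleIdx n} (hij : (j.1 : ℕ) = i.1 + 1) (m : PolyFun R n) :
    opT q j (opT q i (opT q j m)) = opT q i (opT q j (opT q i m)) := by
  obtain ⟨hp, h1, h2⟩ := ne_of_near hij
  have h3 : predPt i.1 ≠ predPt j.1 := by rw [hp]; exact predPt_ne i
  have hi := opT_opT q i
  have hj := opT_opT q j
  have xi := opT_X_self q i
  have xp := opT_X_pred q i
  have xj := opT_X_self q j
  have xjp := opT_X_pred q j
  rw [hp] at xj xjp
  have xn := opT_X_of_ne q h1 h2
  have xn' := opT_X_of_ne q h3 h1.symm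
  induction m using PolyFun.induction with
  | const a =>
    simp only [opT_const]
    funext w
    rw [heckeAct_braid q hij]
  | add m m' h h' => simp only [map_add, h, h']
  | X_smul k m h =>
    by_cases k1 : k = i.1
    · subst k1
      simp only [xi, xp, xj, xjp, xn, xn', map_add, map_sub, map_smul, h, smul_add, smul_sub]
      module
    by_cases k2 : k = predPt i.1
    · subst k2
      simp only [xp, xjp, xn, xn', map_sub, map_smul, h, smul_add, smul_sub,
        hi, hj]
      module
    by_cases k3 : k = j.1
    · subst k3
      simp only [xi, xj, xjp, xn, xn', map_add, map_smul, h, smul_add, smul_sub,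
        hi, hj]
      module
    · simp only [opT_X_of_ne q k2 k1, opT_X_of_ne q (by rwa [hp] : k ≠ predPt j.1) k3, h]

/-- The action of `T_0` on `PolyFun R n`. -/
noncomputable def opD (i : Fin n) (f : Polynomial R) : PolyFun R n →ₗ[R] PolyFun R n :=
  (redMul i f).compLeft _

theorem opD_apply (i : Fin n) (f : Polynomial R) (m : PolyFun R n) (w : Equiv.Perm (Fin n)) :
    opD i f m w = redMul i f (m w) := rfl

theorem sw_aeval (i : SimpleIdx n) (j : Fin n) (f : Polynomial R) :
    sw i (Polynomial.aeval (X j : MvPolynomial (Fin n) R) f) =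
      Polynomial.aeval (X (simpleSwap i j)) f := by
  rw [← Polynomial.aeval_algHom_apply, sw_X]

theorem redMul_sw {i : SimpleIdx n} {j : Fin n} (h1 : j ≠ predPt i.1) (h2 : j ≠ i.1)
    (f : Polynomial R) (p : MvPolynomial (Fin n) R) :
    redMul j f (sw i p) = sw i (redMul j f p) := by
  rw [redMul_apply, redMul_apply, map_sub, map_mul, map_mul, sw_X, sw_aeval,
    simpleSwap_of_ne h1 h2]
  congr 2
  exact cf_rename _ (simpleSwap_of_ne h1 h2) _ _

theorem redMul_dl (a : R) {i : SimpleIdx n} {j : Fin n} (h1 : j ≠ predPt i.1) (h2 : j ≠ i.1)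
    (f : Polynomial R) (p : MvPolynomial (Fin n) R) :
    redMul j f (dl a i p) = dl a i (redMul j f p) := by
  have e1 : dd i (Polynomial.aeval (X j : MvPolynomial (Fin n) R) f) = 0 :=
    dd_eq_zero (by rw [sw_aeval, simpleSwap_of_ne h1 h2])
  rw [redMul_apply, redMul_apply, dl_apply, dl_apply, map_sub, dd_mul, dd_mul, e1,
    dd_X_of_ne h1 h2, zero_mul, zero_mul, add_zero, add_zero, sw_X, sw_aeval,
    simpleSwap_of_ne h1 h2, map_smul, cf_X_mul_of_ne h2.symm, cf_dd h1 h2, mul_sub, smul_sub,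
    mul_smul_comm, mul_smul_comm]
  congr 2 <;> ring

theorem opD_opT (q : R) {i : SimpleIdx n} {j : Fin n} (h1 : j ≠ predPt i.1) (h2 : j ≠ i.1)
    (f : Polynomial R) (m : PolyFun R n) :
    opD j f (opT q i m) = opT q i (opD j f m) := by
  funext w
  simp only [opD_apply, opT_apply, map_add, redMul_dl _ h1 h2]
  split_ifs
  · simp only [map_add, map_smul, redMul_sw h1 h2]
  · simp only [map_smul, redMul_sw h1 h2]

/-- On polynomials of X_i-degree below deg f the operator is the companion operator of `f`. If `g`
is free of X_i, its powers give X_i^k g below the top degree, and at the top exactly the reduction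
modulo f(X_i). Hence f(D) kills `g`, and it kills X_i^k g = D^k g because it commutes with D. -/
theorem aeval_redMul_eq_zero {d : Fin n → ℕ} {i : Fin n} {f : Polynomial R}
    (hf : f.Monic) (hd : f.natDegree = d i) {p : MvPolynomial (Fin n) R}
    (hp : p ∈ Bd R d) : Polynomial.aeval (redMul i f : Module.End R _) f p = 0 := by
  have : Polynomial.aeval (redMul i f : Module.End R _) f p ∈
      (⊥ : Submodule R (MvPolynomial (Fin n) R)) := by
    refine Bd_map (Polynomial.aeval (redMul i f : Module.End R _) f) (fun e he ↦ ?_) hp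
    have hei := he i
    set D : Module.End R (MvPolynomial (Fin n) R) := redMul i f with hD
    set g : MvPolynomial (Fin n) R := monomial (e.erase i) 1 with hg
    have hcf : ∀ k, cf i k g = if 0 = k then g else 0 := by
      intro k
      rw [hg, cf_monomial]
      simp
    have hpow : ∀ k, k < d i → (D ^ k) g = X i ^ k * g := by
      intro k hk
      induction k with
      | zero => simp
      | succ k ih =>
        have e1 : f.natDegree - 1 = (f.natDegree - 1 - k) + k := by omega
        rw [pow_succ', Module.End.mul_apply, ih (by omega), hD, redMul_apply, e1, cf_X_pow_mul,
          hcf, if_neg (by omega), mul_zero, sub_zero, pow_succ', mul_assoc]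
    have htop : (D ^ f.natDegree) g = X i ^ f.natDegree * g - Polynomial.aeval (X i) f * g := by
      obtain ⟨k, hk⟩ : ∃ k, f.natDegree = k + 1 := ⟨f.natDegree - 1, by omega⟩
      rw [hk, pow_succ', Module.End.mul_apply, hpow k (by omega), hD, redMul_apply, hk]
      have : k + 1 - 1 = 0 + k := by omega
      rw [this, cf_X_pow_mul, hcf, if_pos rfl, pow_succ', mul_assoc]
    have hg0 : Polynomial.aeval D f g = 0 := by
      rw [Polynomial.aeval_eq_sum_range, LinearMap.sum_apply, Finset.sum_range_succ]
      simp only [LinearMap.smul_apply]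
      rw [htop, hf.coeff_natDegree, one_smul, aeval_X_eq_sum, Finset.sum_mul,
        Finset.sum_range_succ, hf.coeff_natDegree, one_smul,
        Finset.sum_congr rfl (g := fun j ↦ (f.coeff j • X i ^ j) * g)]
      · abel
      · intro j hj
        rw [Finset.mem_range, hd] at hj
        rw [hpow j hj, smul_mul_assoc]
    have hcomm : Polynomial.aeval D f * D ^ e i = D ^ e i * Polynomial.aeval D f := by
      rw [← Polynomial.aeval_X_pow (R := R) D, ← map_mul, mul_comm, map_mul]
    rw [monomial_eq_X_pow_mul i e, ← hg, ← hpow _ hei, ← Module.End.mul_apply, hcomm, Module.End.mul_apply, hg0, map_zero]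
    exact Submodule.zero_mem _
  simpa using this

end Representation

/-! ### The four-term braid relation for the operators -/

section BraidFour

variable {R : Type*} [CommRing R] {n : ℕ}

/-- Coefficientwise extraction of the coefficient of `X_i ^ k`. -/
noncomputable def opC (i : Fin n) (k : ℕ) : PolyFun R n →ₗ[R] PolyFun R n := (cf i k).compLeft _

theorem opC_apply (i : Fin n) (k : ℕ) (m : PolyFun R n) (w : Equiv.Perm (Fin n)) :
    opC i k m w = cf i k (m w) := rfl

theorem opD_eq (i : Fin n) (f : Polynomial R) (m : PolyFun R n) :
    opD i f m = (X i : MvPolynomial (Fin n) R) • m -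
      (Polynomial.aeval (X i) f : MvPolynomial (Fin n) R) • opC i (f.natDegree - 1) m := rfl

theorem opC_X_smul {i j : Fin n} (h : j ≠ i) (k : ℕ) (m : PolyFun R n) :
    opC i k ((X j : MvPolynomial (Fin n) R) • m) = (X j : MvPolynomial (Fin n) R) • opC i k m := by
  funext w
  simp only [opC_apply, Pi.smul_apply, smul_eq_mul, cf_X_mul_of_ne h]

theorem opC_aeval_smul {i j : Fin n} (h : j ≠ i) (k : ℕ) (f : Polynomial R) (m : PolyFun R n) :
    opC i k ((Polynomial.aeval (X j) f : MvPolynomial (Fin n) R) • m) =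
      (Polynomial.aeval (X j) f : MvPolynomial (Fin n) R) • opC i k m := by
  funext w
  simp only [opC_apply, Pi.smul_apply, smul_eq_mul, cf_aeval_mul_of_ne h]

/-- With x = X_{i-1} and y = X_i, the divided difference of x^k is minus the sum of all monomials of
degree k - 1 in x and y. As k ≤ l + 1, only its term x^{k-1} can reach x-degree `l`; the other
factor is free of x. -/
theorem cf_dd_pow_mul (i : SimpleIdx n) (l k b : ℕ) (h : k ≤ l + 1)
    (p : MvPolynomial (Fin n) R) :
    cf (predPt i.1) l (dd i (X (predPt i.1) ^ k) * cf (predPt i.1) b p) =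
      if k = l + 1 then - cf (predPt i.1) b p else 0 := by
  rw [dd_X_pow_pred, neg_mul, map_neg, Finset.sum_mul, map_sum]
  have hne := (predPt_ne i).symm
  have key : ∀ j ∈ Finset.range k, cf (predPt i.1) l
      (X i.1 ^ j * X (predPt i.1) ^ (k - 1 - j) * cf (predPt i.1) b p) =
      if k = l + 1 ∧ j = 0 then cf (predPt i.1) b p else 0 := by
    intro j hj
    rw [Finset.mem_range] at hj
    rw [mul_assoc, cf_X_pow_mul_of_ne hne]
    have e1 : l = (l - (k - 1 - j)) + (k - 1 - j) := by omega
    rw [e1, cf_X_pow_mul, ← e1, cf_cf]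
    by_cases hc : k = l + 1 ∧ j = 0
    · rw [if_pos hc, if_pos (by omega), hc.2, pow_zero, one_mul]
    · rw [if_neg hc, if_neg (by omega), mul_zero]
  rw [Finset.sum_congr rfl key]
  split_ifs with hk
  · subst hk
    rw [Finset.sum_eq_single 0]
    · simp
    · intro j _ hj; simp [hj]
    · simp
  · simp [hk]

theorem cf_dd_aeval_mul (i : SimpleIdx n) {f : Polynomial R} (hf : f.Monic)
    (hd : 0 < f.natDegree) (b : ℕ) (p : MvPolynomial (Fin n) R) :
    cf (predPt i.1) (f.natDegree - 1)
      (dd i (Polynomial.aeval (X (predPt i.1)) f) * cf (predPt i.1) b p) =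
      - cf (predPt i.1) b p := by
  rw [aeval_X_eq_sum, map_sum, Finset.sum_mul, map_sum, Finset.sum_range_succ,
    hf.coeff_natDegree, one_smul, cf_dd_pow_mul _ _ _ _ (by omega), if_pos (by omega), Finset.sum_eq_zero, zero_add]
  · intro j hj
    rw [Finset.mem_range] at hj
    rw [map_smul, smul_mul_assoc, map_smul, cf_dd_pow_mul _ _ _ _ (by omega),
      if_neg (by omega), smul_zero]

/-- Moving T_i past f(x) yields f(y) and a correction. Only the leading term of `f` contributes to
the extracted coefficient of the correction, with the value -1. -/
theorem opC_opT_aeval_smul (q : R) (i : SimpleIdx n) {f : Polynomial R} (hf : f.Monic)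
    (hd : 0 < f.natDegree) (b : ℕ) (m : PolyFun R n) :
    opC (predPt i.1) (f.natDegree - 1)
      (opT q i ((Polynomial.aeval (X (predPt i.1)) f : MvPolynomial (Fin n) R) •
        opC (predPt i.1) b m)) =
      (Polynomial.aeval (X i.1) f : MvPolynomial (Fin n) R) •
        opC (predPt i.1) (f.natDegree - 1) (opT q i (opC (predPt i.1) b m)) -
      (q - 1) • (X i.1 : MvPolynomial (Fin n) R) • opC (predPt i.1) b m := by
  have hne := (predPt_ne i).symm
  rw [opT_smul, map_add, sw_aeval, simpleSwap_left, opC_aeval_smul hne]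
  suffices h : opC (predPt i.1) (f.natDegree - 1)
      (dl (q - 1) i (Polynomial.aeval (X (predPt i.1)) f) • opC (predPt i.1) b m) =
      -((q - 1) • (X i.1 : MvPolynomial (Fin n) R) • opC (predPt i.1) b m) by
    rw [h]
    exact (sub_eq_add_neg _ _).symm
  funext w
  rw [opC_apply, Pi.smul_apply, smul_eq_mul, dl_apply, smul_mul_assoc, map_smul, mul_assoc,
    cf_X_mul_of_ne hne, opC_apply, cf_dd_aeval_mul i hf hd, mul_neg, smul_neg]
  rfl

theorem opT_symm_smul (q : R) (i : SimpleIdx n) (f : Polynomial R) (m : PolyFun R n) :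
    opT q i ((Polynomial.aeval (X (predPt i.1)) f * Polynomial.aeval (X i.1) f :
      MvPolynomial (Fin n) R) • m) =
      (Polynomial.aeval (X (predPt i.1)) f * Polynomial.aeval (X i.1) f :
        MvPolynomial (Fin n) R) • opT q i m := by
  have h : sw i (Polynomial.aeval (X (predPt i.1)) f * Polynomial.aeval (X i.1) f :
      MvPolynomial (Fin n) R) =
      Polynomial.aeval (X (predPt i.1)) f * Polynomial.aeval (X i.1) f := by
    rw [map_mul, sw_aeval, sw_aeval, simpleSwap_left, simpleSwap_right, mul_comm]
  rw [opT_smul, h, dl_apply, dd_eq_zero h, mul_zero, smul_zero, zero_smul, add_zero]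

/-- The functions whose values have bounded degrees. -/
noncomputable def boundedFun (R : Type*) [CommRing R] (d : Fin n → ℕ) :
    Submodule R (PolyFun R n) where
  carrier := {m | ∀ w, m w ∈ Bd R d}
  add_mem' h h' w := Submodule.add_mem _ (h w) (h' w)
  zero_mem' _ := Submodule.zero_mem _
  smul_mem' a _ h w := Submodule.smul_mem _ a (h w)

theorem opT_mem (q : R) {d : Fin n → ℕ} {i : SimpleIdx n} (h : d (predPt i.1) = d i.1)
    {m : PolyFun R n} (hm : m ∈ boundedFun R d) : opT q i m ∈ boundedFun R d := by
  intro w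
  rw [opT_apply]
  refine Submodule.add_mem _ (dl_mem_Bd _ h (hm w)) ?_
  split_ifs
  · exact Submodule.add_mem _ (sw_mem_Bd h (hm _)) (Submodule.smul_mem _ _ (sw_mem_Bd h (hm w)))
  · exact Submodule.smul_mem _ _ (sw_mem_Bd h (hm _))

theorem opD_mem {d : Fin n → ℕ} {i : Fin n} {f : Polynomial R}
    (hf : f.Monic) (hd : f.natDegree = d i) {m : PolyFun R n} (hm : m ∈ boundedFun R d) :
    opD i f m ∈ boundedFun R d := fun w ↦ redMul_mem_Bd hf hd (hm w)

/-- Write D = x - f(x)c, with c the top-coefficient operator. Expanding both sides, everything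
without a factor f(x) cancels, so their difference is f(x)Z. Its x-degree is below deg f because all
the operators preserve the bounds, and a multiple of f(x) of such low degree is zero. Thus Z need
not be computed to vanish. -/
theorem opD_opT_four (q : R) {d : Fin n → ℕ} {i : SimpleIdx n} {f : Polynomial R}
    (hf : f.Monic) (hpos : 0 < f.natDegree) (hd : f.natDegree = d (predPt i.1))
    (hdi : d (predPt i.1) = d i.1) {m : PolyFun R n} (hm : m ∈ boundedFun R d) :
    opD (predPt i.1) f (opT q i (opD (predPt i.1) f (opT q i m))) =
      opT q i (opD (predPt i.1) f (opT q i (opD (predPt i.1) f m))) := by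
  set x : MvPolynomial (Fin n) R := X (predPt i.1) with hx
  set y : MvPolynomial (Fin n) R := X i.1 with hy
  set fx : MvPolynomial (Fin n) R := Polynomial.aeval x f with hfx
  set fy : MvPolynomial (Fin n) R := Polynomial.aeval y f with hfy
  set c : PolyFun R n →ₗ[R] PolyFun R n := opC (predPt i.1) (f.natDegree - 1) with hc
  set t : PolyFun R n →ₗ[R] PolyFun R n := opT q i with ht
  set D : PolyFun R n →ₗ[R] PolyFun R n := opD (predPt i.1) f with hD
  have hne := (predPt_ne i).symm
  have hDm : ∀ m, D m = x • m - fx • c m := fun m ↦ opD_eq _ _ _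
  have hcy : ∀ m, c (y • m) = y • c m := fun m ↦ opC_X_smul hne _ m
  have htx : ∀ m, t (x • m) = y • t m - (q - 1) • y • m := opT_X_pred q i
  have hty : ∀ m, t (y • m) = x • t m + (q - 1) • y • m := opT_X_self q i
  have htt : ∀ m, t (t m) = (q - 1) • t m + q • m := opT_opT q i
  have hcf : ∀ m, c (t (fx • c m)) = fy • c (t (c m)) - (q - 1) • y • c m :=
    fun m ↦ opC_opT_aeval_smul q i hf hpos _ m
  have hsymm : ∀ m, t ((fx * fy) • m) = (fx * fy) • t m := opT_symm_smul q i f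
  have h1 : c (t (D m)) = y • c (t m) - fy • c (t (c m)) := by
    rw [hDm, map_sub, map_sub, hcf, htx, map_sub, hcy, map_smul, hcy]
    abel
  have h2 : t (D (t m)) = q • y • m - t (fx • c (t m)) := by
    rw [hDm, map_sub, htx, htt]
    module
  have h3 : D (t (D (t m))) = q • x • y • m - x • t (fx • c (t m)) - fx • c (t (D (t m))) := by
    rw [hDm (t (D (t m))), h2, smul_sub]
    module
  have h4 : x • t (fx • c (t m)) = t ((fx * y) • c (t m)) - (q - 1) • (fx * y) • c (t m) := by
    rw [mul_comm fx y, mul_smul, hty]; module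
  have h5 : t (D (t (D m))) = q • y • D m - t (fx • c (t (D m))) := by
    rw [hDm (t (D m)), map_sub, htx, htt]
    module
  -- The product f(x)f(y) is symmetric and passes through T_i unchanged, which exposes a factor
  -- f(x).
  have h6 : t (fx • c (t (D m))) = t ((fx * y) • c (t m)) - (fx * fy) • t (c (t (c m))) := by
    rw [h1, ← hsymm, ← map_sub]
    congr 1
    module
  have h7 : D (t (D (t m))) - t (D (t (D m))) =
      fx • ((q - 1) • y • c (t m) - c (t (D (t m))) + q • y • c m - fy • t (c (t (c m)))) := by
    rw [h3, h4, h5, h6, hDm m]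
    module
  rw [← sub_eq_zero, h7]
  have hmem : D (t (D (t m))) - t (D (t (D m))) ∈ boundedFun R d := by
    have a1 : ∀ m ∈ boundedFun R d, t m ∈ boundedFun R d := fun m ↦ opT_mem q hdi
    have a2 : ∀ m ∈ boundedFun R d, D m ∈ boundedFun R d := fun m ↦ opD_mem hf hd
    exact Submodule.sub_mem _ (a2 _ (a1 _ (a2 _ (a1 _ hm)))) (a1 _ (a2 _ (a1 _ (a2 _ hm))))
  rw [h7] at hmem
  generalize (q - 1) • y • c (t m) - c (t (D (t m))) + q • y • c m - fy • t (c (t (c m))) = Z at *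
  funext w
  have h8 := eq_zero_of_aeval_mul_mem_Bd hf hd (hmem w)
  rw [Pi.smul_apply, h8, smul_zero, Pi.zero_apply]

end BraidFour

/-! ### The representation of ℋ and the existence of τ -/

section TraceForm

attribute [local instance] algRing

variable {R : Type*} [CommRing R] {r n : ℕ} (q : Rˣ) (Q : Fin r → R)

theorem map_aeval_end {N N' : Type*} [AddCommGroup N] [Module R N] [AddCommGroup N'] [Module R N']
    (L : N →ₗ[R] N') {a : Module.End R N} {b : Module.End R N'} (h : ∀ x, L (a x) = b (L x))
    (f : Polynomial R) (x : N) :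
    L (Polynomial.aeval a f x) = Polynomial.aeval b f (L x) := by
  have hp : ∀ (k : ℕ) (x : N), L ((a ^ k) x) = (b ^ k) (L x) := by
    intro k
    induction k with
    | zero => simp
    | succ k ih =>
      intro x
      rw [pow_succ', pow_succ', Module.End.mul_apply, Module.End.mul_apply, h, ih]
  induction f using Polynomial.induction_on' with
  | add f g hf hg => simp only [map_add, LinearMap.add_apply, hf, hg]
  | monomial k c =>
    simp only [Polynomial.aeval_monomial, Module.End.mul_apply, Module.algebraMap_end_apply,
      map_smul, hp]

/-- The space on which `ℋ` acts faithfully. -/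
abbrev RepSpace (R : Type*) [CommRing R] (r n : ℕ) : Type _ :=
  boundedFun (n := n) R fun _ ↦ r

/-- The action of the generators on `RepSpace`. -/
noncomputable def genAct [Nontrivial R] (i : Fin n) : Module.End R (RepSpace R r n) :=
  if h : (i : ℕ) = 0 then
    (opD i (cyclo Q)).restrict fun _ hm ↦ opD_mem (cyclo_monic Q) (natDegree_cyclo Q) hm
  else
    (opT (q : R) ⟨i, h⟩).restrict fun _ hm ↦ opT_mem (q : R) rfl hm

theorem genAct_zero [Nontrivial R] {i : Fin n} (h : (i : ℕ) = 0) (m : RepSpace R r n) :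
    (genAct q Q i m : PolyFun R n) = opD i (cyclo Q) m := by
  rw [genAct, dif_pos h]; rfl

theorem genAct_simple [Nontrivial R] (i : SimpleIdx n) (m : RepSpace R r n) :
    (genAct q Q i.1 m : PolyFun R n) = opT (q : R) i m := by
  rw [genAct, dif_neg i.2]; rfl

/-- The representation of `ℋ` on `RepSpace`. -/
noncomputable def rep [Nontrivial R] : Alg n q Q →ₐ[R] Module.End R (RepSpace R r n) :=
  RingQuot.liftAlgHom R ⟨FreeAlgebra.lift R (genAct q Q), by
    intro a b h
    cases h with
    | cyclotomic i hi =>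
      rw [map_zero, ← Polynomial.aeval_algHom_apply, FreeAlgebra.lift_ι_apply]
      apply LinearMap.ext
      intro m
      apply Subtype.ext
      funext w
      have := map_aeval_end ((LinearMap.proj w).comp (boundedFun (n := n) R fun _ ↦ r).subtype)
        (a := genAct q Q i) (b := redMul i (cyclo Q))
        (fun m ↦ by
          simp only [LinearMap.comp_apply, Submodule.subtype_apply, LinearMap.proj_apply,
            genAct_zero q Q hi]
          rfl) (cyclo Q) m
      refine this.trans ?_
      exact aeval_redMul_eq_zero (d := fun _ ↦ r) (cyclo_monic Q) (natDegree_cyclo Q) (m.2 w)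
    | quadratic i hi =>
      simp only [map_mul, map_sub, map_add, map_one, map_zero, AlgHom.commutes,
        FreeAlgebra.lift_ι_apply]
      apply LinearMap.ext
      intro m
      apply Subtype.ext
      have h1 := genAct_simple q Q ⟨i, hi⟩
      simp only [Module.End.mul_apply, LinearMap.sub_apply, LinearMap.add_apply,
        Module.End.one_apply, Module.algebraMap_end_apply, AddSubgroupClass.coe_sub,
        Submodule.coe_add, Submodule.coe_smul, map_add, h1, LinearMap.zero_apply,
        ZeroMemClass.coe_zero, opT_opT]
      module
    | braidFour i j hi hj =>
      simp only [map_mul, FreeAlgebra.lift_ι_apply]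
      apply LinearMap.ext
      intro m
      apply Subtype.ext
      have hj0 : (j : ℕ) ≠ 0 := by omega
      have h1 := genAct_simple q Q ⟨j, hj0⟩
      have hp : predPt j = i := by ext; rw [predPt_val]; omega
      -- The four-term argument needs deg f > 0; for `r = 0` the bounded functions are zero.
      rcases Nat.eq_zero_or_pos r with rfl | hr
      · have hm : m = 0 := Subtype.ext (funext fun w ↦ eq_zero_of_cf (i := i) fun k ↦
          cf_eq_zero_of_mem_Bd (d := fun _ ↦ 0) (Nat.zero_le _) (m.2 w))
        rw [hm, map_zero, map_zero]
      simp only [Module.End.mul_apply, h1, genAct_zero q Q hi]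
      have := opD_opT_four (q : R) (d := fun _ ↦ r) (i := ⟨j, hj0⟩) (cyclo_monic Q)
        (by rw [natDegree_cyclo]; exact hr) (natDegree_cyclo Q) rfl m.2
      simpa only [hp] using this
    | braidThree i j hi hj =>
      simp only [map_mul, FreeAlgebra.lift_ι_apply]
      apply LinearMap.ext
      intro m
      apply Subtype.ext
      have hj0 : (j : ℕ) ≠ 0 := by omega
      have h1 := genAct_simple q Q ⟨j, hj0⟩
      have h2 := genAct_simple q Q ⟨i, hi⟩
      simp only [Module.End.mul_apply, h1, h2]
      exact opT_braid (q : R) (i := ⟨i, hi⟩) (j := ⟨j, hj0⟩) hj m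
    | comm i j hij =>
      simp only [map_mul, FreeAlgebra.lift_ι_apply]
      apply LinearMap.ext
      intro m
      apply Subtype.ext
      have hj0 : (j : ℕ) ≠ 0 := by omega
      have h1 := genAct_simple q Q ⟨j, hj0⟩
      by_cases hi : (i : ℕ) = 0
      · simp only [Module.End.mul_apply, h1, genAct_zero q Q hi]
        have := predPt_val j
        exact opD_opT (q : R) (i := ⟨j, hj0⟩) (by rw [Ne, Fin.ext_iff]; simp only; omega)
          (by rw [Ne, Fin.ext_iff]; simp only; omega) _ _
      · have h2 := genAct_simple q Q ⟨i, hi⟩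
        simp only [Module.End.mul_apply, h1, h2]
        exact opT_comm (q : R) (i := ⟨i, hi⟩) (j := ⟨j, hj0⟩) hij m⟩

theorem rep_gen [Nontrivial R] (i : Fin n) : rep q Q (gen n q Q i) = genAct q Q i := by
  simp [rep, gen]

theorem rep_gen_simple [Nontrivial R] (i : SimpleIdx n) (m : RepSpace R r n) :
    (rep q Q (gen n q Q i.1) m : PolyFun R n) = opT (q : R) i m := by
  rw [rep_gen, genAct_simple]

/-- `L_k` acts as multiplication by `X_k` on elements of small degree. -/
theorem rep_murphy [Nontrivial R] (hr : 0 < r) (k : Fin n) (m : RepSpace R r n)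
    (hm : (m : PolyFun R n) ∈ boundedFun R fun j ↦ if j ≤ k then r - 1 else r) :
    (rep q Q (murphy n q Q k) m : PolyFun R n) = (X k : MvPolynomial (Fin n) R) • (m : PolyFun R n) := by
  obtain ⟨k, hk⟩ := k
  induction k generalizing m with
  | zero =>
    rw [murphy_zero _ _ _ rfl, rep_gen, genAct_zero q Q rfl]
    funext w
    rw [opD_apply, redMul_eq_of_mem_Bd (d := fun j ↦ if j ≤ ⟨0, hk⟩ then r - 1 else r) _ (hm w)]
    · rfl
    · rw [natDegree_cyclo]; simp; omega
  | succ k ih =>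
    set i : SimpleIdx n := ⟨⟨k + 1, hk⟩, Nat.succ_ne_zero k⟩ with hi
    have hki : (⟨k + 1, hk⟩ : Fin n) = i.1 := rfl
    rw [hki] at hm ⊢
    rw [murphy_simple, map_smul, map_mul, map_mul, LinearMap.smul_apply, Module.End.mul_apply,
      Module.End.mul_apply, Submodule.coe_smul, rep_gen_simple]
    -- The bound `r - 1` is the same for all variables up to `i`, so T_i preserves it and the
    -- induction can use it for the previous index. What remains is T_i X_{i-1} T_i = q X_i.
    have h1 : opT (q : R) i (m : PolyFun R n) ∈
        boundedFun R fun j ↦ if j ≤ i.1 then r - 1 else r :=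
      opT_mem (q : R) (by simp only [le_refl, if_true, (predPt_lt i).le]) hm
    have h2 := ih (rep q Q (gen n q Q i.1) m) (Nat.lt_of_succ_lt hk) (by
      rw [rep_gen_simple]
      intro w
      refine Bd_mono (fun j ↦ ?_) (h1 w)
      have : j ≤ ⟨k, Nat.lt_of_succ_lt hk⟩ → j ≤ i.1 := fun h ↦ h.trans (predPt_lt i).le
      split_ifs <;> omega)
    have hp : (⟨k, Nat.lt_of_succ_lt hk⟩ : Fin n) = predPt i.1 := rfl
    rw [hp] at h2
    rw [h2, rep_gen_simple, opT_X_pred, opT_opT, smul_add, smul_comm _ ((q : R) - 1),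
      add_sub_cancel_left, smul_comm _ (q : R), smul_smul, Units.inv_mul, one_smul]

theorem single_mem {e : Fin n →₀ ℕ} (he : ∀ j, e j < r)
    (w : Equiv.Perm (Fin n)) :
    (Pi.single w (monomial e 1) : PolyFun R n) ∈ boundedFun (n := n) R fun _ ↦ r := by
  intro v
  by_cases h : v = w
  · subst h; rw [Pi.single_eq_same]; exact monomial_mem_Bd _ he
  · rw [Pi.single_eq_of_ne h]; exact Submodule.zero_mem _

/-- The basis vectors of `RepSpace`. -/
noncomputable def basisVec (R : Type*) [CommRing R] {e : Fin n →₀ ℕ} (he : ∀ j, e j < r)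
    (w : Equiv.Perm (Fin n)) : RepSpace R r n :=
  ⟨Pi.single w (monomial e 1), single_mem he w⟩

theorem coe_basisVec {e : Fin n →₀ ℕ} (he : ∀ j, e j < r) (w : Equiv.Perm (Fin n)) :
    (basisVec R he w : PolyFun R n) = Pi.single w (monomial e 1) := rfl

theorem coe_basisVec_zero (h0 : ∀ j : Fin n, (0 : Fin n →₀ ℕ) j < r) (w : Equiv.Perm (Fin n)) :
    (basisVec R h0 w : PolyFun R n) = Pi.single w 1 := by
  rw [coe_basisVec]
  congr 1

theorem opT_single {q : R} {i : SimpleIdx n} {w : Equiv.Perm (Fin n)}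
    (h : w (predPt i.1) < w i.1) :
    opT q i (Pi.single w 1) = Pi.single ((simpleSwap i).trans w) 1 := by
  have e1 : ∀ w : Equiv.Perm (Fin n), (Pi.single w 1 : PolyFun R n) =
      fun v ↦ C ((Pi.single w 1 : Equiv.Perm (Fin n) → R) v) := by
    intro w
    funext v
    by_cases hv : v = w
    · subst hv; simp
    · simp [hv]
  rw [e1, e1, opT_const]
  funext v
  congr 1
  rw [heckeAct]
  by_cases hv : v = (simpleSwap i).trans w
  · subst hv
    have hne : (simpleSwap i).trans w ≠ w := by
      intro h'
      have := DFunLike.congr_fun h' i.1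
      rw [Equiv.trans_apply, simpleSwap_right] at this
      exact h.ne this
    simp [simpleSwap_left, simpleSwap_right, h, hne]
  · have hv' : (simpleSwap i).trans v ≠ w := by
      rintro rfl
      exact hv (by rw [simpleSwap_trans_trans])
    rw [Pi.single_eq_of_ne hv, Pi.single_eq_of_ne hv']
    split_ifs with h2
    · have : v ≠ w := by rintro rfl; exact h2.asymm h
      rw [Pi.single_eq_of_ne this]; ring
    · ring

theorem rep_T [Nontrivial R] (h0 : ∀ j : Fin n, (0 : Fin n →₀ ℕ) j < r)
    (w : Equiv.Perm (Fin n)) :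
    rep q Q (T n q Q w) (basisVec R h0 (Equiv.refl _)) = basisVec R h0 w := by
  have key : ∀ l : List (SimpleIdx n), IsReduced l →
      rep q Q (l.map fun i ↦ gen n q Q i.1).prod (basisVec R h0 (Equiv.refl _)) =
        basisVec R h0 (wordPerm l) := by
    intro l
    induction l with
    | nil => intro _; simp [wordPerm]
    | cons i l ih =>
      intro hl
      obtain ⟨hl', ha⟩ := hl.tail
      rw [List.map_cons, List.prod_cons, map_mul, Module.End.mul_apply, ih hl']
      apply Subtype.ext
      rw [rep_gen_simple, coe_basisVec_zero, coe_basisVec_zero]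
      exact opT_single ha
  have := key _ (isReduced_reducedWord w)
  rw [wordPerm_reducedWord] at this
  exact this

/-- The variables are multiplied in from the last to the first. When L_a is applied the variables
before X_a are absent, so `rep_murphy` applies and no cyclotomic reduction occurs. -/
theorem rep_ev_monomial [Nontrivial R]
    (h0 : ∀ j : Fin n, (0 : Fin n →₀ ℕ) j < r) (w : Equiv.Perm (Fin n))
    {e : Fin n →₀ ℕ} (he : ∀ j, e j < r) :
    rep q Q (ev q Q (monomial e 1)) (basisVec R h0 w) = basisVec R he w := by
  induction e using Finsupp.induction_on_min with
  | zero =>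
    have : ev q Q (monomial (0 : Fin n →₀ ℕ) (1 : R)) = 1 := map_one (ev q Q)
    rw [this, map_one, Module.End.one_apply]
  | single_add a b f ha hb ih =>
    have hfa : f a = 0 := by
      by_contra h
      exact lt_irrefl _ (ha a (Finsupp.mem_support_iff.2 h))
    have hf : ∀ j, f j < r := fun j ↦ lt_of_le_of_lt (by simp) (he j)
    have hbr : b < r := by simpa [hfa] using he a
    have step : ∀ (c : ℕ) (hc : ∀ j, (Finsupp.single a c + f) j < r),
        rep q Q (ev q Q (monomial (Finsupp.single a c + f) 1)) (basisVec R h0 w) =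
          basisVec R hc w := by
      intro c
      induction c with
      | zero =>
        intro hc
        simp only [Finsupp.single_zero, zero_add]
        exact ih hf
      | succ c ihc =>
        intro hc
        have hc1 : ∀ j, (Finsupp.single a c + f) j < r := by
          intro j
          refine lt_of_le_of_lt ?_ (hc j)
          simp only [Finsupp.add_apply, Finsupp.single_apply]
          split_ifs <;> omega
        have hcr : c + 1 < r := by simpa [hfa] using hc a
        have e1 : (monomial (Finsupp.single a (c + 1) + f) 1 : MvPolynomial (Fin n) R) =
            X a * monomial (Finsupp.single a c + f) 1 := by
          rw [X, monomial_mul, mul_one, ← add_assoc, ← Finsupp.single_add, add_comm 1]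
        rw [e1, map_mul, ev_X, map_mul, Module.End.mul_apply, ihc hc1]
        apply Subtype.ext
        rw [rep_murphy q Q (by omega)]
        · rw [coe_basisVec, coe_basisVec]
          rw [← Pi.single_smul, smul_eq_mul, e1]
        · intro v
          rw [coe_basisVec]
          by_cases hv : v = w
          · subst hv
            rw [Pi.single_eq_same]
            refine monomial_mem_Bd _ fun j ↦ ?_
            by_cases hja : j = a
            · subst hja; simp [hfa]; omega
            · have hja' : ¬ a = j := fun h ↦ hja h.symm
              by_cases hlt : j ≤ a
              · have : f j = 0 := by
                  by_contra h
                  exact absurd (ha j (Finsupp.mem_support_iff.2 h)) hlt.not_gt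
                simp [hlt, hja', this]; omega
              · simpa [hlt, hja'] using hf j
          · rw [Pi.single_eq_of_ne hv]; exact Submodule.zero_mem _
    exact step b he

/-- The linear form on `ℋ` given by the coefficient of the first basis vector. -/
theorem exists_isCanonicalForm (hr : 0 < n → 0 < r) :
    ∃ τ : Alg n q Q →ₗ[R] R, IsCanonicalForm n q Q τ := by
  rcases subsingleton_or_nontrivial R with hR | hR
  · exact ⟨0, fun c w ↦ ⟨fun _ ↦ Subsingleton.elim _ _, fun _ ↦ Subsingleton.elim _ _⟩⟩
  have h0 : ∀ j : Fin n, (0 : Fin n →₀ ℕ) j < r := fun j ↦ hr j.pos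
  let τ : Alg n q Q →ₗ[R] R := (lcoeff R 0).comp ((LinearMap.proj (Equiv.refl _)).comp
    ((boundedFun (n := n) R fun _ ↦ r).subtype.comp
      ((LinearMap.applyₗ (basisVec R h0 (Equiv.refl _))).comp (rep q Q).toLinearMap)))
  -- Applied to the vector 1 at the identity, the monomials give the distinct basis vectors X^c at
  -- `w`; τ is the coefficient of the starting vector.
  have key : ∀ c w, τ (akMonomial n q Q c w) =
      coeff 0 ((Pi.single w (monomial (Finsupp.equivFunOnFinite.symm fun k ↦ (c k : ℕ)) 1) :
        PolyFun R n) (Equiv.refl _)) := by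
    intro c w
    have hc : ∀ j, (Finsupp.equivFunOnFinite.symm fun k ↦ (c k : ℕ)) j < r := fun j ↦ (c j).2
    have h1 : rep q Q (akMonomial n q Q c w) (basisVec R h0 (Equiv.refl _)) =
        basisVec R hc w := by
      rw [akMonomial_eq, map_mul, Module.End.mul_apply, rep_T,  rep_ev_monomial q Q h0 w hc]
    have h2 : τ (akMonomial n q Q c w) = coeff 0
        ((rep q Q (akMonomial n q Q c w) (basisVec R h0 (Equiv.refl _)) : PolyFun R n)
          (Equiv.refl _)) := rfl
    rw [h2, h1, coe_basisVec]
  refine ⟨τ, fun c w ↦ ⟨?_, ?_⟩⟩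
  · rintro ⟨hc, rfl⟩
    rw [key]
    have : (Finsupp.equivFunOnFinite.symm fun k ↦ (c k : ℕ)) = 0 := by
      ext k; simp [hc]
    rw [this]
    have h1 : (1 : Equiv.Perm (Fin n)) = Equiv.refl _ := rfl
    rw [h1, Pi.single_eq_same]
    simp
  · intro h
    rw [key]
    by_cases hw : w = Equiv.refl _
    · subst hw
      rw [Pi.single_eq_same, coeff_monomial, if_neg]
      intro hc
      refine h ⟨fun k ↦ ?_, rfl⟩
      have := DFunLike.congr_fun hc k
      simpa using this
    · rw [Pi.single_eq_of_ne' hw, coeff_zero]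

end TraceForm

/-! ### Straightening products of polynomials in the L_k with T_w -/

section Straightening

attribute [local instance] algRing

variable {R : Type*} [CommRing R] {r n : ℕ} (q : Rˣ) (Q : Fin r → R)

theorem ev_mul_mem_evHS_inf {k : ℕ} {S S' : Submodule R (MvPolynomial (Fin n) R)}
    {p : MvPolynomial (Fin n) R} (hp : p ∈ S) (hp' : p ∈ S') {h : Alg n q Q}
    (hh : h ∈ HS n k q Q) : ev q Q p * h ∈ evHS q Q k (S ⊓ S') :=
  ev_mul_mem_evHS q Q (Submodule.mem_inf.2 ⟨hp, hp'⟩) hh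

theorem X_pow_mul_mem_Bd {d d' : Fin n → ℕ} {k : Fin n} {l : ℕ} (hk : d k + l ≤ d' k)
    (h : ∀ j, d j ≤ d' j) {p : MvPolynomial (Fin n) R} (hp : p ∈ Bd R d) :
    X k ^ l * p ∈ Bd R d' := by
  refine Bd_map (LinearMap.mulLeft R (X k ^ l)) (fun e he ↦ ?_) hp
  rw [LinearMap.mulLeft_apply, X_pow_eq_monomial, monomial_mul]
  refine monomial_mem_Bd _ fun j ↦ ?_
  have h1 := h j
  have h2 := he j
  by_cases hj : k = j
  · subst hj; simp; omega
  · simp [hj]; omega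

theorem aeval_mul_mem_Bd {d d' : Fin n → ℕ} {k : Fin n} {f : Polynomial R}
    (hk : d k + f.natDegree ≤ d' k) (h : ∀ j, d j ≤ d' j) {p : MvPolynomial (Fin n) R}
    (hp : p ∈ Bd R d) : Polynomial.aeval (X k) f * p ∈ Bd R d' := by
  rw [aeval_X_eq_sum, Finset.sum_mul]
  refine Submodule.sum_mem _ fun j hj ↦ ?_
  rw [Finset.mem_range] at hj
  rw [smul_mul_assoc]
  exact Submodule.smul_mem _ _ (X_pow_mul_mem_Bd (by omega) h hp)

theorem prod_aeval_mem_Bd {d : Fin n → ℕ} (hd : ∀ j, 0 < d j) (s : Finset (Fin n))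
    (f : Fin n → Polynomial R) (h : ∀ j ∈ s, (f j).natDegree < d j) :
    ∏ j ∈ s, Polynomial.aeval (X j : MvPolynomial (Fin n) R) (f j) ∈ Bd R d := by
  have key : ∏ j ∈ s, Polynomial.aeval (X j : MvPolynomial (Fin n) R) (f j) ∈
      Bd R fun j ↦ if j ∈ s then d j else 1 := by
    induction s using Finset.induction_on with
    | empty => simpa using one_mem_Bd (R := R) (d := fun _ : Fin n ↦ 1) fun _ ↦ Nat.one_pos
    | insert k s hk ih =>
      rw [Finset.prod_insert hk]
      refine aeval_mul_mem_Bd ?_ (fun j ↦ ?_)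
        (ih fun j hj ↦ h j (Finset.mem_insert_of_mem hj))
      · have := h k (Finset.mem_insert_self _ _)
        simp [hk]; omega
      · have := hd j
        by_cases hj : j ∈ s
        · simp [hj]
        · simp only [hj, if_false]; split_ifs <;> omega
  refine Bd_mono (fun j ↦ ?_) key
  have := hd j
  split_ifs <;> omega

/-- Polynomials divisible by `X_k`, as a submodule. -/
noncomputable def divX (R : Type*) [CommRing R] (k : Fin n) :
    Submodule R (MvPolynomial (Fin n) R) :=
  LinearMap.range (LinearMap.mulLeft R (X k))

theorem X_mul_mem_divX (k : Fin n) (p : MvPolynomial (Fin n) R) : X k * p ∈ divX R k := ⟨p, rfl⟩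

/-- Polynomials without constant term, as a submodule. -/
noncomputable def noConst (R : Type*) [CommRing R] (n : ℕ) :
    Submodule R (MvPolynomial (Fin n) R) := LinearMap.ker (lcoeff R 0)

theorem mem_noConst {p : MvPolynomial (Fin n) R} :
    p ∈ noConst R n ↔ constantCoeff p = 0 := Iff.rfl

theorem restrict_map {N : Type*} [AddCommGroup N] [Module R N] {S : Submodule R N}
    {s : Set (Fin n →₀ ℕ)} (L : MvPolynomial (Fin n) R →ₗ[R] N)
    (h : ∀ e ∈ s, L (monomial e 1) ∈ S)
    {p : MvPolynomial (Fin n) R} (hp : ∀ e, coeff e p ≠ 0 → e ∈ s) : L p ∈ S := by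
  have hp' : p ∈ restrictSupport R s := by
    rw [mem_restrictSupport_iff]
    intro e he
    exact hp e (mem_support_iff.1 he)
  have : restrictSupport R s ≤ S.comap L := by
    rw [restrictSupport_eq_span, Submodule.span_le]
    rintro _ ⟨e, he, rfl⟩
    exact h e he
  exact this hp'

theorem lt_of_mem_Bd {d : Fin n → ℕ} {p : MvPolynomial (Fin n) R} (hp : p ∈ Bd R d)
    {e : Fin n →₀ ℕ} (he : coeff e p ≠ 0) (j : Fin n) : e j < d j := by
  have h1 : (p.support : Set (Fin n →₀ ℕ)) ⊆ {e | ∀ j, e j < d j} :=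
    (mem_restrictSupport_iff R).1 hp
  exact h1 (mem_support_iff.2 he) j

theorem Bd_divX_map {N : Type*} [AddCommGroup N] [Module R N] {S : Submodule R N}
    {d : Fin n → ℕ} {k : Fin n} (L : MvPolynomial (Fin n) R →ₗ[R] N)
    (h : ∀ e : Fin n →₀ ℕ, (∀ j, e j < d j) → 0 < e k → L (monomial e 1) ∈ S)
    {p : MvPolynomial (Fin n) R} (hp : p ∈ Bd R d) (hp' : p ∈ divX R k) : L p ∈ S := by
  refine restrict_map (s := {e | (∀ j, e j < d j) ∧ 0 < e k}) L (fun e he ↦ h e he.1 he.2)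
    fun e he ↦ ⟨lt_of_mem_Bd hp he, ?_⟩
  obtain ⟨p', rfl⟩ := hp'
  rw [LinearMap.mulLeft_apply, coeff_X_mul'] at he
  rw [Nat.pos_iff_ne_zero]
  intro h0
  rw [if_neg (by simpa using h0)] at he
  exact he rfl

theorem Bd_noConst_map {N : Type*} [AddCommGroup N] [Module R N] {S : Submodule R N}
    {d : Fin n → ℕ} (L : MvPolynomial (Fin n) R →ₗ[R] N)
    (h : ∀ e : Fin n →₀ ℕ, (∀ j, e j < d j) → e ≠ 0 → L (monomial e 1) ∈ S)
    {p : MvPolynomial (Fin n) R} (hp : p ∈ Bd R d) (hp' : p ∈ noConst R n) : L p ∈ S := by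
  refine restrict_map (s := {e | (∀ j, e j < d j) ∧ e ≠ 0}) L (fun e he ↦ h e he.1 he.2)
    fun e he ↦ ⟨lt_of_mem_Bd hp he, ?_⟩
  rintro rfl
  exact he hp'

theorem inv_trans_simpleSwap {i : SimpleIdx n} {w : Equiv.Perm (Fin n)}
    (h : w.symm (predPt i.1) < w.symm i.1) :
    inv (w.trans (simpleSwap i)) = inv w + inv (simpleSwap i) := by
  refine inv_trans fun a b hab hw ↦ ?_
  by_contra hc
  have hc' : simpleSwap i (w a) < simpleSwap i (w b) := by
    refine lt_of_le_of_ne (not_lt.1 hc) fun h' ↦ hab.ne ?_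
    exact w.injective ((simpleSwap i).injective h')
  obtain ⟨h1, h2⟩ := simpleSwap_inversion hw hc'
  rw [← h1, ← h2, Equiv.symm_apply_apply, Equiv.symm_apply_apply] at h
  exact h.asymm hab

theorem perm_le_of_fix {π : Equiv.Perm (Fin n)} {k : ℕ}
    (h : ∀ j : Fin n, k ≤ j → π j = j) (j : Fin n) : ((π j : ℕ) < k ↔ (j : ℕ) < k) := by
  constructor
  · intro h1
    by_contra h2
    rw [h j (not_lt.1 h2)] at h1
    exact h2 h1
  · intro h1
    by_contra h2
    have := π.injective (h (π j) (not_lt.1 h2))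
    rw [this] at h2
    exact h2 h1

theorem bound_perm {π : Equiv.Perm (Fin n)} {k : ℕ} (D : ℕ)
    (h : ∀ j : Fin n, k ≤ j → π j = j) (j : Fin n) : bound D k (π j) = bound D k j := by
  simp only [bound, perm_le_of_fix h]

/-- Factorization `T_w = T_{w'} C` of a permutation of the first `k + 1` points, where `w'` fixes
the last of these points, together with the straightening rule for `C` and polynomials in the
Jucys–Murphy elements. -/
theorem exists_T_factor (k : Fin n) (w : Equiv.Perm (Fin n))
    (hw : ∀ j : Fin n, (k : ℕ) + 1 ≤ j → w j = j) :
    ∃ (w' π : Equiv.Perm (Fin n)) (c : Alg n q Q), (∀ j : Fin n, (k : ℕ) ≤ j → w' j = j) ∧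
      c ∈ HS n (k + 1) q Q ∧ T n q Q w = T n q Q w' * c ∧ (∀ j, π (w j) = w' j) ∧
      (∀ j : Fin n, (k : ℕ) + 1 ≤ j → π j = j) ∧
      ∀ (D : ℕ), ∀ p ∈ Bd R (bound D (k + 1)),
        c * ev q Q p - ev q Q (rename π p) * c ∈
          evHS q Q (k + 1) (Bd R (bound D (k + 1)) ⊓ divX R k) := by
  induction hN : (k : ℕ) - w k generalizing w with
  | zero =>
    have hk : w k = k := by
      have h1 := (perm_le_of_fix hw k).2 (by omega)
      ext; omega
    refine ⟨w, Equiv.refl _, 1, fun j hj ↦ ?_, one_mem _, (mul_one _).symm, fun _ ↦ rfl,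
      fun _ _ ↦ rfl, fun D p _ ↦ ?_⟩
    · rcases hj.eq_or_lt with h | h
      · rw [← Fin.ext h, hk]
      · exact hw j h
    · have : rename (Equiv.refl (Fin n)) p = p := rename_id_apply p
      rw [this, one_mul, mul_one, sub_self]
      exact Submodule.zero_mem _
  | succ N ih =>
    have hlt : (w k : ℕ) + 1 < n := by have := k.2; omega
    -- This transposition moves the image of `k` one step closer to `k`. Unwound, `c` is T_k T_{k-1}
    -- ⋯ T_{w k + 1}.
    set i : SimpleIdx n := ⟨⟨w k + 1, hlt⟩, Nat.succ_ne_zero _⟩ with hi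
    have hival : (i.1 : ℕ) = w k + 1 := rfl
    have hip : predPt i.1 = w k := Fin.ext rfl
    set v := w.trans (simpleSwap i) with hv
    have hvk : v k = i.1 := by rw [hv, Equiv.trans_apply, ← hip, simpleSwap_left]
    have hsj : ∀ j : Fin n, (k : ℕ) + 1 ≤ j → simpleSwap i j = j := by
      intro j hj
      have := predPt_val i.1
      refine simpleSwap_of_ne ?_ ?_
      · rw [Ne, Fin.ext_iff]; omega
      · rw [Ne, Fin.ext_iff]; omega
    have hvfix : ∀ j : Fin n, (k : ℕ) + 1 ≤ j → v j = j := by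
      intro j hj
      rw [hv, Equiv.trans_apply, hw j hj, hsj j hj]
    have hvw : v.trans (simpleSwap i) = w := by
      ext j; simp [hv]
    obtain ⟨w', π, c, h1, h2, h3, h4, h5, h6⟩ := ih v hvfix (by rw [hvk]; omega)
    have hT : T n q Q w = T n q Q v * gen n q Q i.1 := by
      rw [← T_simpleSwap, T_mul_T, hvw]
      apply inv_trans_simpleSwap
      rw [← hvk, Equiv.symm_apply_apply]
      have h7 : v.symm (predPt i.1) ≠ k := by
        intro h
        rw [Equiv.symm_apply_eq, hvk] at h
        exact predPt_ne i h
      refine lt_of_le_of_ne ?_ (by rwa [hvk])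
      by_contra h8
      push Not at h8
      rw [hvk] at h8
      have h9 := hvfix _ (show (k : ℕ) + 1 ≤ v.symm (predPt i.1) from h8)
      rw [Equiv.apply_symm_apply] at h9
      rw [← h9, hip, Fin.lt_def] at h8
      omega
    have hgen : gen n q Q i.1 ∈ HS n (k + 1) q Q := gen_mem_HS q Q (by omega)
    refine ⟨w', (simpleSwap i).trans π, c * gen n q Q i.1, h1, mul_mem h2 hgen, ?_, fun j ↦ ?_,
      fun j hj ↦ ?_, fun D p hp ↦ ?_⟩
    · rw [hT, h3, mul_assoc]
    · have := h4 j
      rwa [hv, Equiv.trans_apply] at this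
    · rw [Equiv.trans_apply, hsj j hj, h5 j hj]
    · have hren : rename ((simpleSwap i).trans π) p = rename π (sw i p) := by
        rw [sw, rename_rename]; rfl
      have hb : bound D (k + 1) (predPt i.1) = bound D (k + 1) i.1 := by
        rw [bound, bound, if_pos, if_pos]
        · omega
        · rw [hip]; omega
      have hs := sw_mem_Bd hb hp
      have hd := dl_mem_Bd ((q : R) - 1) hb hp
      -- After the Bernstein relation for T_i, the induction covers both commutators with `c`; the
      -- new term is the permuted correction in front of `c`.
      have e1 : c * gen n q Q i.1 * ev q Q p -
          ev q Q (rename ((simpleSwap i).trans π) p) * (c * gen n q Q i.1) =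
          (c * ev q Q (sw i p) - ev q Q (rename π (sw i p)) * c) * gen n q Q i.1 +
          (c * ev q Q (dl ((q : R) - 1) i p) -
            ev q Q (rename π (dl ((q : R) - 1) i p)) * c) +
          ev q Q (rename π (dl ((q : R) - 1) i p)) * c := by
        rw [hren, mul_assoc, gen_mul_ev]
        noncomm_ring
      rw [e1]
      refine Submodule.add_mem _ (Submodule.add_mem _ (evHS_mul_mem q Q (h6 D _ hs) hgen)
        (h6 D _ hd)) (ev_mul_mem_evHS_inf q Q (rename_mem_Bd π (bound_perm D h5) hd) ?_ h2)
      -- The correction is divisible by X_i, and `π` carries `i` to `k`: this is the origin of the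
      -- factor X_k.
      have hπ : π i.1 = k := by rw [← hvk, h4, h1 k le_rfl]
      rw [dl_apply, map_smul, map_mul, rename_X, hπ]
      exact Submodule.smul_mem _ _ (X_mul_mem_divX _ _)

theorem commute_aeval_murphy {k : Fin n} {h : Alg n q Q} (hh : h ∈ HS n k q Q)
    (f : Polynomial R) : Commute h (ev q Q (Polynomial.aeval (X k) f)) := by
  rw [ev_aeval_X]
  have hc := (murphy_commute_of_mem_HS q Q hh).symm
  induction f using Polynomial.induction_on' with
  | add f g hf hg => rw [map_add]; exact hf.add_right hg
  | monomial l a =>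
    rw [Polynomial.aeval_monomial]
    exact Commute.mul_right (show Commute h (algebraMap R _ a) from (Algebra.commutes a h).symm)
      (hc.pow_right l)

theorem HS_le_AS (k : ℕ) : HS n k q Q ≤ AS n k q Q :=
  Algebra.adjoin_mono fun _ ⟨i, hi, e⟩ ↦ ⟨i.1, hi, e⟩

theorem murphy_mem_AS {j : Fin n} {k : ℕ} (h : (j : ℕ) < k) :
    murphy n q Q j ∈ AS n k q Q := by
  obtain ⟨j, hj⟩ := j
  induction j with
  | zero =>
    rw [murphy_zero _ _ _ rfl]
    exact Algebra.subset_adjoin ⟨_, h, rfl⟩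
  | succ j ih =>
    rw [murphy_simple q Q ⟨⟨j + 1, hj⟩, Nat.succ_ne_zero j⟩]
    have h1 : gen n q Q ⟨j + 1, hj⟩ ∈ AS n k q Q := Algebra.subset_adjoin ⟨_, h, rfl⟩
    exact Subalgebra.smul_mem _ (mul_mem (mul_mem h1 (ih (Nat.lt_of_succ_lt hj)
      (Nat.lt_of_succ_lt h))) h1) _

theorem ev_monomial_mem_AS {k : ℕ} {e : Fin n →₀ ℕ} (he : ∀ j : Fin n, k ≤ j → e j = 0) :
    ev q Q (monomial e 1) ∈ AS n k q Q := by
  have : monomial e (1 : R) ∈ (AS n k q Q).comap (ev q Q) := by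
    rw [monomial_eq, map_one, one_mul]
    refine Subalgebra.prod_mem _ fun j hj ↦ pow_mem ?_ _
    rw [Subalgebra.mem_comap, ev_X]
    refine murphy_mem_AS q Q ?_
    by_contra h
    exact Finsupp.mem_support_iff.1 hj (he j (not_lt.1 h))
  exact this

theorem ev_prod_mem_AS (k : ℕ) (f : Fin n → Polynomial R) :
    ev q Q (∏ j ∈ Finset.univ.filter (fun j : Fin n ↦ (j : ℕ) < k),
      Polynomial.aeval (X j) (f j)) ∈ AS n k q Q := by
  have : (∏ j ∈ Finset.univ.filter (fun j : Fin n ↦ (j : ℕ) < k),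
      Polynomial.aeval (X j : MvPolynomial (Fin n) R) (f j)) ∈ (AS n k q Q).comap (ev q Q) := by
    refine Subalgebra.prod_mem _ fun j hj ↦ ?_
    rw [Finset.mem_filter] at hj
    rw [aeval_X_eq_sum]
    refine Subalgebra.sum_mem _ fun l _ ↦ Subalgebra.smul_mem _ (pow_mem ?_ _) _
    rw [Subalgebra.mem_comap, ev_X]
    exact murphy_mem_AS q Q hj.2
  exact this

/-- The span of the `L_1^{c_1} ⋯ L_k^{c_k} T_w` with `c ≠ 0` and `w` in `𝔖_k`. -/
noncomputable def augSpan (k : ℕ) : Submodule R (Alg n q Q) :=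
  evHS q Q k (Bd R (bound r k) ⊓ noConst R n)

theorem constantCoeff_aeval_X (k : Fin n) (f : Polynomial R) :
    constantCoeff (Polynomial.aeval (X k : MvPolynomial (Fin n) R) f) = f.eval 0 := by
  induction f using Polynomial.induction_on' with
  | add f g hf hg => simp only [map_add, hf, hg, Polynomial.eval_add]
  | monomial l a =>
    rw [Polynomial.aeval_monomial, map_mul, map_pow, constantCoeff_X, Polynomial.eval_monomial]
    simp

theorem filter_succ (k : Fin n) :
    Finset.univ.filter (fun j : Fin n ↦ (j : ℕ) < k + 1) =
      insert k (Finset.univ.filter fun j : Fin n ↦ (j : ℕ) < k) := by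
  ext j
  simp only [Finset.mem_filter, Finset.mem_univ, true_and, Finset.mem_insert, Fin.ext_iff]
  omega

/-- Split off the positive power of L_k. The rest lies in the algebra of T_0, …, T_{k-1}, where it
can be normalized; its Hecke part commutes with L_k, so the power of L_k, still below `r`, returns
untouched and excludes a constant term. -/
theorem straighten_low (k : Fin n) {y : Alg n q Q} (hy : y ∈ AS n k q Q)
    {p : MvPolynomial (Fin n) R} (hp : p ∈ Bd R (bound r (k + 1))) (hp' : p ∈ divX R k)
    {h : Alg n q Q} (hh : h ∈ HS n (k + 1) q Q) :
    y * (ev q Q p * h) ∈ augSpan q Q (n := n) (k + 1) := by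
  refine Bd_divX_map ((LinearMap.mulLeft R y).comp ((LinearMap.mulRight R h).comp
    (ev q Q).toLinearMap)) (fun e he hk ↦ ?_) hp hp'
  simp only [LinearMap.comp_apply, LinearMap.mulLeft_apply, LinearMap.mulRight_apply,
    AlgHom.toLinearMap_apply]
  have hek : e k < r := by simpa [bound] using he k
  have hlow : ev q Q (monomial (e.erase k) 1) ∈ AS n k q Q := by
    refine ev_monomial_mem_AS q Q fun j hj ↦ ?_
    by_cases hjk : j = k
    · subst hjk; simp
    · rw [Finsupp.erase_ne hjk]
      have hjk' : (j : ℕ) ≠ k := fun h ↦ hjk (Fin.ext h)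
      have := he j
      rw [bound, if_neg (by omega)] at this
      omega
  have hy1 : y * ev q Q (monomial (e.erase k) 1) ∈ AS n k q Q := mul_mem hy hlow
  have hy2 := AS_le_evHS q Q (fun _ ↦ by omega) k hy1
  have e1 : y * (ev q Q (monomial e 1) * h) =
      (y * ev q Q (monomial (e.erase k) 1)) * (ev q Q (X k ^ e k) * h) := by
    rw [monomial_eq_X_pow_mul k e, mul_comm (X k ^ e k), map_mul]
    simp only [mul_assoc]
  rw [e1]
  refine evHS_map q Q (LinearMap.mulRight R (ev q Q (X k ^ e k) * h)) (fun p' hp' h' hh' ↦ ?_) hy2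
  have hc : Commute h' (ev q Q (X k ^ e k)) := by
    have := commute_aeval_murphy q Q hh' (Polynomial.X ^ e k)
    rwa [map_pow, Polynomial.aeval_X] at this
  have e2 : LinearMap.mulRight R (ev q Q (X k ^ e k) * h) (ev q Q p' * h') =
      ev q Q (X k ^ e k * p') * (h' * h) := by
    rw [LinearMap.mulRight_apply, mul_comm (X k ^ e k), map_mul]
    calc ev q Q p' * h' * (ev q Q (X k ^ e k) * h)
        = ev q Q p' * (h' * ev q Q (X k ^ e k)) * h := by simp only [mul_assoc]
      _ = ev q Q p' * (ev q Q (X k ^ e k) * h') * h := by rw [hc.eq]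
      _ = _ := by simp only [mul_assoc]
  rw [e2]
  refine ev_mul_mem_evHS_inf q Q (X_pow_mul_mem_Bd ?_ (fun j ↦ ?_) hp') ?_
    (mul_mem (HS_mono q Q (Nat.le_succ _) hh') hh)
  · simp [bound]; omega
  · simp only [bound]; split_ifs <;> omega
  · rw [mem_noConst, map_mul, map_pow, constantCoeff_X, zero_pow (by omega), zero_mul]

/-- A polynomial in L_k commutes with the Hecke part of `y` and involves a new variable, so it
neither creates a constant term nor breaks the bounds. -/
theorem straighten_high (k : Fin n) {y : Alg n q Q} (hy : y ∈ augSpan q Q (n := n) k)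
    {f : Polynomial R} (hf : f.natDegree < r) {c : Alg n q Q} (hc : c ∈ HS n (k + 1) q Q) :
    y * (ev q Q (Polynomial.aeval (X k) f) * c) ∈ augSpan q Q (n := n) (k + 1) := by
  refine evHS_map q Q (LinearMap.mulRight R (ev q Q (Polynomial.aeval (X k) f) * c))
    (fun p hp h hh ↦ ?_) hy
  have hcomm := commute_aeval_murphy q Q hh f
  have e2 : LinearMap.mulRight R (ev q Q (Polynomial.aeval (X k) f) * c) (ev q Q p * h) =
      ev q Q (Polynomial.aeval (X k) f * p) * (h * c) := by
    rw [LinearMap.mulRight_apply, mul_comm (Polynomial.aeval (X k) f), map_mul]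
    calc ev q Q p * h * (ev q Q (Polynomial.aeval (X k) f) * c)
        = ev q Q p * (h * ev q Q (Polynomial.aeval (X k) f)) * c := by simp only [mul_assoc]
      _ = ev q Q p * (ev q Q (Polynomial.aeval (X k) f) * h) * c := by rw [hcomm.eq]
      _ = _ := by simp only [mul_assoc]
  rw [e2]
  refine ev_mul_mem_evHS_inf q Q (aeval_mul_mem_Bd ?_ (fun j ↦ ?_) hp.1) ?_
    (mul_mem (HS_mono q Q (Nat.le_succ _) hh) hc)
  · simp [bound]; omega
  · simp only [bound]; split_ifs <;> omega
  · have : constantCoeff p = 0 := hp.2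
    rw [mem_noConst, map_mul, this, mul_zero]

/-- The constant term of a product `∏ G_j(L_j) T_w ∏ F_{w⁻¹ j}(L_j)`, if the degrees are small. -/
theorem straighten (F G : Fin n → Polynomial R)
    (hFG : ∀ i j, i ≤ j → (F i).natDegree + (G j).natDegree < r) (k : ℕ) (hk : k ≤ n)
    (w : Equiv.Perm (Fin n)) (hw : ∀ j : Fin n, k ≤ j → w j = j) :
    ev q Q (∏ j ∈ Finset.univ.filter (fun j : Fin n ↦ (j : ℕ) < k),
        Polynomial.aeval (X j) (G j)) * T n q Q w *
      ev q Q (∏ j ∈ Finset.univ.filter (fun j : Fin n ↦ (j : ℕ) < k),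
        Polynomial.aeval (X j) (F (w.symm j))) -
      (∏ j ∈ Finset.univ.filter (fun j : Fin n ↦ (j : ℕ) < k),
        ((G j).eval 0 * (F j).eval 0)) • T n q Q w ∈ augSpan q Q (n := n) k := by
  induction k generalizing w with
  | zero => simp
  | succ k ih =>
    obtain ⟨κ, rfl⟩ : ∃ κ : Fin n, (κ : ℕ) = k := ⟨⟨k, hk⟩, rfl⟩
    obtain ⟨w', π, c, h1, h2, h3, h4, h5, h6⟩ := exists_T_factor q Q κ w hw
    have hr : 0 < r := by have := hFG κ κ le_rfl; omega
    have hwsymm : ∀ j, w'.symm (π j) = w.symm j := by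
      intro j
      rw [Equiv.symm_apply_eq, ← h4, Equiv.apply_symm_apply]
    have hw'k : w'.symm κ = κ := by rw [Equiv.symm_apply_eq, h1 κ le_rfl]
    have hwle : ∀ j : Fin n, (j : ℕ) < κ + 1 → w.symm j ≤ κ := by
      intro j hj
      have := (perm_le_of_fix hw (w.symm j)).1 (by rwa [Equiv.apply_symm_apply])
      rw [Fin.le_def]; omega
    -- The room left in L_κ once G_κ(L_κ) is multiplied in. All F-factors fit, as w⁻¹ j ≤ κ for j ≤
    -- κ.
    set D := r - (G κ).natDegree with hD
    have hDpos : 0 < D := by have := hFG κ κ le_rfl; omega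
    set p : MvPolynomial (Fin n) R := ∏ j ∈ Finset.univ.filter (fun j : Fin n ↦ (j : ℕ) < κ + 1),
        Polynomial.aeval (X j) (F (w.symm j)) with hp
    have hpB : p ∈ Bd R (bound D (κ + 1)) := by
      refine prod_aeval_mem_Bd (fun j ↦ bound_pos hDpos j) _ (fun j ↦ F (w.symm j)) fun j hj ↦ ?_
      rw [Finset.mem_filter] at hj
      have := hFG _ _ (hwle j hj.2)
      rw [bound, if_pos hj.2]
      omega
    have hE := h6 D p hpB
    set G₀ : MvPolynomial (Fin n) R := ∏ j ∈ Finset.univ.filter (fun j : Fin n ↦ (j : ℕ) < κ),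
        Polynomial.aeval (X j) (G j) with hG₀
    set F₀ : MvPolynomial (Fin n) R := ∏ j ∈ Finset.univ.filter (fun j : Fin n ↦ (j : ℕ) < κ),
        Polynomial.aeval (X j) (F (w'.symm j)) with hF₀
    set a : R := ∏ j ∈ Finset.univ.filter (fun j : Fin n ↦ (j : ℕ) < κ),
        ((G j).eval 0 * (F j).eval 0) with ha
    have hnot : κ ∉ Finset.univ.filter (fun j : Fin n ↦ (j : ℕ) < κ) := by simp
    have hren : rename π p = Polynomial.aeval (X κ) (F κ) * F₀ := by
      have e1 : rename π p = ∏ j ∈ Finset.univ.filter (fun j : Fin n ↦ (j : ℕ) < κ + 1),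
          Polynomial.aeval (X j) (F (w'.symm j)) := by
        rw [hp, map_prod]
        refine Finset.prod_equiv π (fun j ↦ ?_) fun j _ ↦ ?_
        · simp only [Finset.mem_filter, Finset.mem_univ, true_and, perm_le_of_fix h5]
        · rw [← Polynomial.aeval_algHom_apply, rename_X, hwsymm]
      rw [e1, filter_succ, Finset.prod_insert hnot, hw'k]
    have hGprod : ∏ j ∈ Finset.univ.filter (fun j : Fin n ↦ (j : ℕ) < κ + 1),
        Polynomial.aeval (X j : MvPolynomial (Fin n) R) (G j) =
        G₀ * Polynomial.aeval (X κ) (G κ) := by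
      rw [filter_succ, Finset.prod_insert hnot, mul_comm]
    have haprod : ∏ j ∈ Finset.univ.filter (fun j : Fin n ↦ (j : ℕ) < κ + 1),
        ((G j).eval 0 * (F j).eval 0) = ((G κ).eval 0 * (F κ).eval 0) * a := by
      rw [filter_succ, Finset.prod_insert hnot]
    rw [hGprod, haprod]
    have hT' : T n q Q w' ∈ HS n κ q Q := T_mem_HS_of_fix q Q h1
    have hTw : T n q Q w ∈ HS n (κ + 1) q Q := T_mem_HS_of_fix q Q hw
    have hg := commute_aeval_murphy q Q hT' (G κ)
    have hgf := commute_aeval_murphy q Q hT' (G κ * F κ)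
    set x := c * ev q Q p - ev q Q (rename π p) * c with hx
    set g := Polynomial.aeval (X κ : MvPolynomial (Fin n) R) (G κ) with hgdef
    set gf := Polynomial.aeval (X κ : MvPolynomial (Fin n) R) (G κ * F κ) with hgfdef
    have hgf' : gf = g * Polynomial.aeval (X κ) (F κ) := by rw [hgfdef, map_mul]
    set ν := ev q Q G₀ * T n q Q w' * ev q Q F₀ - a • T n q Q w' with hν
    have hνmem : ν ∈ augSpan q Q (n := n) κ := ih κ.2.le w' h1
    set b := (G κ).eval 0 * (F κ).eval 0 with hb
    -- Three error terms: the inductive one for `w'`, multiplied by (G_κ F_κ)(L_κ) and `c`; the part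
    -- of (G_κ F_κ)(L_κ) without constant term; and the corrections `x` from moving `c`, all
    -- divisible by X_κ.
    have e3 : ev q Q (G₀ * g) * T n q Q w * ev q Q p - (b * a) • T n q Q w =
        ν * (ev q Q gf * c) + a • (ev q Q (gf - C b) * T n q Q w) +
          (ev q Q G₀ * T n q Q w') * (ev q Q g * x) := by
      have e4 : ev q Q (C b : MvPolynomial (Fin n) R) = algebraMap R _ b := (ev q Q).commutes b
      have e5 : ev q Q (G₀ * g) * T n q Q w * ev q Q p =
          ev q Q G₀ * T n q Q w' * (ev q Q g * (c * ev q Q p)) := by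
        rw [map_mul, h3]
        calc ev q Q G₀ * ev q Q g * (T n q Q w' * c) * ev q Q p
            = ev q Q G₀ * (ev q Q g * T n q Q w') * c * ev q Q p := by simp only [mul_assoc]
          _ = ev q Q G₀ * (T n q Q w' * ev q Q g) * c * ev q Q p := by rw [hg.eq]
          _ = _ := by simp only [mul_assoc]
      have e6 : c * ev q Q p = x + ev q Q (rename π p) * c := by rw [hx]; abel
      have e7 : ev q Q g * (ev q Q (rename π p) * c) = ev q Q F₀ * (ev q Q gf * c) := by
        rw [hren, ← mul_assoc, ← map_mul, ← mul_assoc (ev q Q F₀), ← map_mul, hgf']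
        congr 2; ring
      have e8 : T n q Q w' * (ev q Q gf * c) = ev q Q gf * T n q Q w := by
        rw [← mul_assoc, hgf.eq, mul_assoc, ← h3]
      have e9 : ν * (ev q Q gf * c) = ev q Q G₀ * T n q Q w' * (ev q Q F₀ * (ev q Q gf * c)) -
          a • (ev q Q gf * T n q Q w) := by
        rw [hν, sub_mul, smul_mul_assoc, e8]
        simp only [mul_assoc]
      rw [e5, e6, mul_add, e7, mul_add, e9, map_sub, e4, sub_mul, smul_sub, ← Algebra.smul_def,
        smul_smul, mul_comm a b]
      abel
    rw [e3]
    have hdeg : (G κ * F κ).natDegree < r :=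
      lt_of_le_of_lt Polynomial.natDegree_mul_le (by have := hFG κ κ le_rfl; omega)
    refine Submodule.add_mem _ (Submodule.add_mem _ (straighten_high q Q κ hνmem hdeg h2)
      (Submodule.smul_mem _ _ (ev_mul_mem_evHS_inf q Q ?_ ?_ hTw))) ?_
    · refine Submodule.sub_mem _ ?_ (monomial_mem_Bd _ fun j ↦ by simpa using bound_pos hr j)
      have := aeval_mul_mem_Bd (d := fun _ ↦ 1) (d' := bound r (κ + 1)) (k := κ)
        (f := G κ * F κ) (by simp [bound]; omega) (fun j ↦ bound_pos hr j)
        (one_mem_Bd (R := R) fun _ ↦ Nat.one_pos)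
      rwa [mul_one] at this
    · rw [mem_noConst, map_sub, constantCoeff_C, hgfdef, constantCoeff_aeval_X,
        Polynomial.eval_mul, sub_self]
    -- The corrections have X_κ-degree below `D`, so multiplying by G_κ keeps it below `r` and
    -- `straighten_low` applies.
    · refine evHS_map q Q (LinearMap.mulLeft R (ev q Q G₀ * T n q Q w' * ev q Q g))
        (S' := augSpan q Q (n := n) (κ + 1)) (fun p' hp' h' hh' ↦ ?_) hE |> fun h ↦ by
          rwa [LinearMap.mulLeft_apply, mul_assoc _ (ev q Q g)] at h
      rw [LinearMap.mulLeft_apply, mul_assoc _ (ev q Q g), ← mul_assoc (ev q Q g), ← map_mul]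
      refine straighten_low q Q κ (mul_mem (ev_prod_mem_AS q Q κ G) (HS_le_AS q Q κ hT'))
        (aeval_mul_mem_Bd ?_ (fun j ↦ ?_) hp'.1) ?_ hh'
      · have := hFG κ κ le_rfl
        simp [bound]; omega
      · simp only [bound]; split_ifs <;> omega
      · obtain ⟨p'', rfl⟩ := hp'.2
        rw [LinearMap.mulLeft_apply, mul_left_comm]
        exact X_mul_mem_divX _ _

end Straightening

/-! ### Values of τ -/

section CanonicalForm

attribute [local instance] algRing

variable {R : Type*} [CommRing R] {r n : ℕ} {q : Rˣ} {Q : Fin r → R}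

theorem T_mem_HS (w : Equiv.Perm (Fin n)) : T n q Q w ∈ HS n n q Q :=
  T_mem_HS_of_fix q Q fun j hj ↦ absurd j.2 (not_lt.2 hj)

/-- Swapping variables preserves the constant term, and the Bernstein correction is divisible by a
variable. -/
theorem HS_mul_mem_augSpan {h x : Alg n q Q} (hh : h ∈ HS n n q Q)
    (hx : x ∈ augSpan q Q (n := n) n) : h * x ∈ augSpan q Q (n := n) n := by
  induction hh using Algebra.adjoin_induction generalizing x with
  | mem y hy =>
    obtain ⟨i, hi, rfl⟩ := hy
    have hb : bound r n (predPt i.1) = bound r n i.1 := by simp [bound]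
    refine gen_mul_mem_evHS q Q hi (fun p hp ↦ Submodule.mem_inf.2
      ⟨sw_mem_Bd hb hp.1, ?_⟩) (fun p hp ↦ Submodule.mem_inf.2 ⟨dl_mem_Bd _ hb hp.1, ?_⟩) hx
    · rw [mem_noConst, sw, constantCoeff_rename]
      exact hp.2
    · rw [dl_apply]
      refine Submodule.smul_mem _ _ ?_
      rw [mem_noConst, map_mul, constantCoeff_X, zero_mul]
  | algebraMap a => rw [← Algebra.smul_def]; exact Submodule.smul_mem _ _ hx
  | add y z _ _ hy hz => rw [add_mul]; exact Submodule.add_mem _ (hy hx) (hz hx)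
  | mul y z _ _ hy hz => rw [mul_assoc]; exact hy (hz hx)

namespace IsCanonicalForm

variable {τ : Alg n q Q →ₗ[R] R}

theorem apply_augSpan (h : IsCanonicalForm n q Q τ) {x : Alg n q Q}
    (hx : x ∈ augSpan q Q (n := n) n) : τ x = 0 := by
  have : τ x ∈ (⊥ : Submodule R R) := by
    refine evHS_map q Q τ (fun p hp y hy ↦ ?_) hx
    have key : Submodule.span R (Set.range (T n q Q)) ≤
        (⊥ : Submodule R R).comap (τ.comp (LinearMap.mulLeft R (ev q Q p))) := by
      rw [Submodule.span_le]
      rintro _ ⟨w, rfl⟩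
      refine Bd_noConst_map (S := (⊥ : Submodule R R)) (τ.comp ((LinearMap.mulRight R (T n q Q w)).comp
        (ev q Q).toLinearMap)) (fun e he he0 ↦ ?_) hp.1 hp.2
      have he' : ∀ j, e j < r := fun j ↦ by simpa [bound] using he j
      have e1 := (h (fun j ↦ ⟨e j, he' j⟩) w).2 fun hc ↦ he0 (Finsupp.ext hc.1)
      rw [akMonomial_eq] at e1
      rw [Submodule.mem_bot, ← e1]
      simp only [LinearMap.comp_apply, LinearMap.mulRight_apply, AlgHom.toLinearMap_apply]
      congr 5
      ext j
      simp
    exact key (HS_le_span_T q Q n hy)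
  simpa using this

theorem apply_T (h : IsCanonicalForm n q Q τ) (hr : 0 < n → 0 < r) (w : Equiv.Perm (Fin n)) :
    τ (T n q Q w) = if w = Equiv.refl _ then 1 else 0 := by
  have e1 : akMonomial n q Q (fun j ↦ ⟨0, hr j.pos⟩) w = T n q Q w := by
    rw [akMonomial_eq]
    have : Finsupp.equivFunOnFinite.symm (fun _ : Fin n ↦ 0) = (0 : Fin n →₀ ℕ) := by ext; simp
    simp only [this]
    rw [← C_apply, map_one, map_one, one_mul]
  obtain ⟨h1, h2⟩ := h (fun j ↦ ⟨0, hr j.pos⟩) w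
  rw [e1] at h1 h2
  split_ifs with hw
  · exact h1 ⟨fun _ ↦ rfl, hw⟩
  · exact h2 fun hc ↦ hw hc.2

/-- The last letter of `a` is moved onto `b`, by induction on the length of `a`. If `b` = a⁻¹, each
letter meets a descent and contributes a factor q. -/
theorem apply_T_mul_T (h : IsCanonicalForm n q Q τ) (hr : 0 < n → 0 < r)
    (a b : Equiv.Perm (Fin n)) :
    τ (T n q Q a * T n q Q b) = if a.trans b = Equiv.refl _ then (q : R) ^ inv a else 0 := by
  induction hm : inv a generalizing a b with
  | zero =>
    rw [eq_refl_of_inv_eq_zero hm, T_refl, one_mul, apply_T h hr, Equiv.refl_trans, pow_zero]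
  | succ m ih =>
    have hex : ∃ i : SimpleIdx n, a.symm i.1 < a.symm (predPt i.1) := by
      by_contra! hc
      have := eq_refl_of_ascents (w := a.symm) fun i ↦
        (ascent_or_descent i a.symm).resolve_right (not_lt.2 (hc i))
      rw [← inv_symm, this, inv_refl] at hm
      omega
    obtain ⟨i, hi⟩ := hex
    have h1 := inv_simpleSwap_trans' hi
    set a' := ((simpleSwap i).trans a.symm).symm with ha'
    have haa : a'.trans (simpleSwap i) = a := by
      ext k
      simp [ha', simpleSwap_simpleSwap]
    have h2 : inv a' + 1 = inv a := by
      rw [ha', inv_symm, h1, inv_symm]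
    have hab (b : Equiv.Perm (Fin n)) : a'.trans ((simpleSwap i).trans b) = a.trans b := by
      rw [← Equiv.trans_assoc, haa]
    have hTa : T n q Q a = T n q Q a' * gen n q Q i.1 := by
      rw [← T_simpleSwap, T_mul_T q Q (by rw [haa, inv_simpleSwap, h2]), haa]
    have hsymm {c b : Equiv.Perm (Fin n)} (hc : c.trans b = Equiv.refl _) : b = c.symm := by
      ext k
      have := Equiv.congr_fun hc (c.symm k)
      rw [Equiv.trans_apply, Equiv.apply_symm_apply] at this
      rw [this]; rfl
    rw [hTa, mul_assoc]
    rcases ascent_or_descent i b with hb | hb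
    · rw [gen_mul_T_of_ascent q Q hb, ih a' _ (by omega), hab, if_neg, if_neg] <;>
      · intro hc
        rw [hsymm hc] at hb
        exact absurd hb hi.asymm
    · rw [gen_mul_T_of_descent q Q hb, mul_add, mul_smul_comm, mul_smul_comm, map_add, map_smul,
        map_smul, ih a' _ (by omega), ih a' _ (by omega), hab, if_neg (c := a'.trans b = _)]
      · split_ifs <;> simp [pow_succ']
      -- The (q - 1)-term vanishes: if `b` were the inverse of `a'`, it would have an ascent at `i`,
      -- not a descent.
      · intro hc
        have := hsymm hc
        rw [ha', Equiv.symm_symm] at this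
        rw [this, Equiv.trans_apply, Equiv.trans_apply, simpleSwap_left, simpleSwap_right] at hb
        exact absurd hb hi.asymm

/-- The value of `τ` on `T_u ∏ G_j(L_j) T_x ∏ F_{x⁻¹ j}(L_j) T_w^*`. -/
theorem apply_straighten (h : IsCanonicalForm n q Q τ) (hr : 0 < n → 0 < r)
    (F G : Fin n → Polynomial R)
    (hFG : ∀ i j, i ≤ j → (F i).natDegree + (G j).natDegree < r)
    {u x : Equiv.Perm (Fin n)} (hux : inv (u.trans x) = inv u + inv x) (w : Equiv.Perm (Fin n)) :
    τ (T n q Q u * (ev q Q (∏ j, Polynomial.aeval (X j) (G j)) * T n q Q x *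
      ev q Q (∏ j, Polynomial.aeval (X j) (F (x.symm j)))) * T n q Q w.symm) =
      if u.trans x = w then (∏ j, (G j).eval 0 * (F j).eval 0) * (q : R) ^ inv w else 0 := by
  have hs := straighten q Q F G hFG n le_rfl x fun j hj ↦ absurd j.2 (not_lt.2 hj)
  simp only [Fin.is_lt, Finset.filter_true] at hs
  have h1 := apply_augSpan h (evHS_mul_mem q Q (HS_mul_mem_augSpan (T_mem_HS u) hs)
    (T_mem_HS w.symm))
  rw [mul_sub, sub_mul, map_sub, sub_eq_zero] at h1
  rw [h1, mul_smul_comm, smul_mul_assoc, map_smul, T_mul_T q Q hux, apply_T_mul_T h hr,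
    smul_eq_mul]
  have hiff : (u.trans x).trans w.symm = Equiv.refl _ ↔ u.trans x = w := by
    constructor
    · intro hc
      ext k
      have := Equiv.congr_fun hc k
      rw [Equiv.trans_apply, Equiv.symm_apply_eq] at this
      rw [this]; rfl
    · rintro rfl; exact Equiv.self_trans_symm _
  simp only [hiff]
  split_ifs with hc
  · rw [hc]
  · rw [mul_zero]

end IsCanonicalForm

end CanonicalForm

end AK

namespace AK

/-! ### Combinatorics of 𝔱^λ, w_λ and the row stabilizers -/

namespace Multipartition

variable {r n : ℕ} (lam : Multipartition r n)

/-- The column of `𝔱^λ` that contains `k`. -/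
def colOf (k : Fin n) : ℕ := (ofLex (ofLex (lam.rowTableau.symm k).1).2).2

theorem lt_iff (a b : Fin n) : a < b ↔
    (lam.rowOf a).1 < (lam.rowOf b).1 ∨ (lam.rowOf a).1 = (lam.rowOf b).1 ∧
      ((lam.rowOf a).2 < (lam.rowOf b).2 ∨ (lam.rowOf a).2 = (lam.rowOf b).2 ∧
        lam.colOf a < lam.colOf b) := by
  have h1 : a < b ↔ (lam.rowTableau.symm a).1 < (lam.rowTableau.symm b).1 :=
    ((lam.nodes.orderIsoOfFin lam.card_nodes).lt_iff_lt (x := a) (y := b)).symm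
  rw [h1, Prod.Lex.lt_iff, Prod.Lex.lt_iff]
  rfl

theorem conj_rowTableau_symm_wPerm (k : Fin n) :
    lam.conj.rowTableau.symm (lam.wPerm k) = lam.nodesConj (lam.rowTableau.symm k) := by
  simp [wPerm, colTableau]

/-- w_λ carries the entry of 𝔱^λ at a node to the entry of 𝔱^{λ'} at the conjugate node, so columns
become rows and components are reversed. -/
theorem conj_rowOf_wPerm (k : Fin n) :
    lam.conj.rowOf (lam.wPerm k) = ((lam.rowOf k).1.rev, lam.colOf k) := by
  rw [rowOf, conj_rowTableau_symm_wPerm]; rfl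

theorem conj_colOf_wPerm (k : Fin n) : lam.conj.colOf (lam.wPerm k) = (lam.rowOf k).2 := by
  rw [colOf, conj_rowTableau_symm_wPerm]; rfl

theorem comp_mono {a b : Fin n} (h : a ≤ b) : (lam.rowOf a).1 ≤ (lam.rowOf b).1 := by
  rcases h.eq_or_lt with rfl | h
  · exact le_rfl
  · rcases (lam.lt_iff a b).1 h with h | h
    · exact h.le
    · exact h.1.le

theorem mem_rowStab {w : Equiv.Perm (Fin n)} :
    w ∈ lam.rowStab ↔ ∀ k, lam.rowOf (w k) = lam.rowOf k := by
  simp [rowStab]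

theorem symm_mem_rowStab {w : Equiv.Perm (Fin n)} (h : w ∈ lam.rowStab) :
    w.symm ∈ lam.rowStab := by
  rw [mem_rowStab] at h ⊢
  intro k
  rw [← h (w.symm k), Equiv.apply_symm_apply]

theorem refl_mem_rowStab : Equiv.refl _ ∈ lam.rowStab := lam.mem_rowStab.2 fun _ ↦ rfl

/-- A permutation that is increasing on the rows is a minimal coset representative. -/
theorem inv_trans_of_mem_rowStab {u w : Equiv.Perm (Fin n)} (hu : u ∈ lam.rowStab)
    (hw : ∀ a b, a < b → lam.rowOf a = lam.rowOf b → w a < w b) :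
    inv (u.trans w) = inv u + inv w := by
  rw [mem_rowStab] at hu
  refine inv_trans fun a b hab hba ↦ hw _ _ hba ?_
  have h1 := (lam.lt_iff _ _).1 hab
  have h2 := (lam.lt_iff _ _).1 hba
  rw [hu, hu] at h2
  rw [hu, hu]
  have h3 : (lam.rowOf a).1 = (lam.rowOf b).1 := by
    rcases h1 with h1 | h1 <;> rcases h2 with h2 | h2
    · exact absurd h1 h2.asymm
    · exact h2.1.symm
    · exact h1.1
    · exact h1.1
  refine Prod.ext h3.symm ?_
  rw [h3] at h1 h2
  simp only [lt_irrefl, true_and, false_or] at h1 h2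
  omega

theorem wPerm_lt {a b : Fin n} (hab : a < b) (h : lam.rowOf a = lam.rowOf b) :
    lam.wPerm a < lam.wPerm b := by
  rw [lam.lt_iff, h] at hab
  simp only [lt_irrefl, true_and, false_or] at hab
  rw [lam.conj.lt_iff, conj_rowOf_wPerm, conj_rowOf_wPerm, h]
  exact Or.inr ⟨rfl, Or.inl hab⟩

/-- Two entries in a row of 𝔱^{λ'} come from one column of 𝔱^λ, hence from different rows of it; `u`
moves entries only within rows and cannot change their order. -/
theorem wPerm_symm_lt {u : Equiv.Perm (Fin n)} (hu : u ∈ lam.rowStab) {a b : Fin n}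
    (hab : a < b) (h : lam.conj.rowOf a = lam.conj.rowOf b) :
    (u.trans lam.wPerm).symm a < (u.trans lam.wPerm).symm b := by
  obtain ⟨a, rfl⟩ := lam.wPerm.surjective a
  obtain ⟨b, rfl⟩ := lam.wPerm.surjective b
  rw [lam.conj.lt_iff, h, conj_colOf_wPerm, conj_colOf_wPerm] at hab
  simp only [lt_irrefl, true_and, false_or] at hab
  rw [conj_rowOf_wPerm, conj_rowOf_wPerm, Prod.mk.injEq, Fin.rev_inj] at h
  have hu' := (lam.mem_rowStab).1 (lam.symm_mem_rowStab hu)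
  simp only [Equiv.symm_trans_apply, Equiv.symm_apply_apply]
  rw [lam.lt_iff, hu', hu']
  exact Or.inr ⟨h.1, Or.inl hab⟩

/-- `u` is split off on the left because w_λ increases along rows. Then `v` is split off on the
right by passing to inverses, where (u w_λ)⁻¹ increases along the rows of 𝔱^{λ'}. -/
theorem inv_trans_wPerm_trans {u v : Equiv.Perm (Fin n)} (hu : u ∈ lam.rowStab)
    (hv : v ∈ lam.conj.rowStab) :
    inv (u.trans (lam.wPerm.trans v)) = inv u + inv lam.wPerm + inv v := by
  have h1 := lam.inv_trans_of_mem_rowStab hu fun a b ↦ lam.wPerm_lt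
  have h2 := lam.conj.inv_trans_of_mem_rowStab (lam.conj.symm_mem_rowStab hv)
    fun a b ↦ lam.wPerm_symm_lt hu
  have h3 : v.symm.trans (u.trans lam.wPerm).symm = (u.trans (lam.wPerm.trans v)).symm := by
    ext k; simp
  rw [h3, inv_symm, inv_symm, inv_symm, h1] at h2
  omega

theorem inv_wPerm_trans {v : Equiv.Perm (Fin n)} (hv : v ∈ lam.conj.rowStab) :
    inv (lam.wPerm.trans v) = inv lam.wPerm + inv v := by
  have := lam.inv_trans_wPerm_trans lam.refl_mem_rowStab hv
  rwa [Equiv.refl_trans, inv_refl, zero_add] at this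

theorem inv_trans_wPerm_trans' {u v : Equiv.Perm (Fin n)} (hu : u ∈ lam.rowStab)
    (hv : v ∈ lam.conj.rowStab) :
    inv (u.trans (lam.wPerm.trans v)) = inv u + inv (lam.wPerm.trans v) := by
  rw [inv_trans_wPerm_trans lam hu hv, inv_wPerm_trans lam hv, add_assoc]

/-- Additivity of lengths forces ℓ(u) = ℓ(v) = 0. This leaves a single nonzero term in the double
sum for τ. -/
theorem trans_wPerm_trans_eq_iff {u v : Equiv.Perm (Fin n)} (hu : u ∈ lam.rowStab)
    (hv : v ∈ lam.conj.rowStab) :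
    u.trans (lam.wPerm.trans v) = lam.wPerm ↔ u = Equiv.refl _ ∧ v = Equiv.refl _ := by
  constructor
  · intro h
    have h1 := lam.inv_trans_wPerm_trans hu hv
    rw [h] at h1
    exact ⟨eq_refl_of_inv_eq_zero (by omega), eq_refl_of_inv_eq_zero (by omega)⟩
  · rintro ⟨rfl, rfl⟩; rfl

/-- The component of `𝔱^{λ'}` containing an entry, in terms of `𝔱^λ`. -/
theorem conj_rowOf_fst {v : Equiv.Perm (Fin n)} (hv : v ∈ lam.conj.rowStab) (k : Fin n) :
    (lam.conj.rowOf k).1 = (lam.rowOf ((lam.wPerm.trans v).symm k)).1.rev := by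
  obtain ⟨k, rfl⟩ := (lam.wPerm.trans v).surjective k
  rw [Equiv.symm_apply_apply, Equiv.trans_apply, lam.conj.mem_rowStab.1 hv, conj_rowOf_wPerm]

theorem card_comp (s : Fin r) :
    (Finset.univ.filter fun k ↦ (lam.rowOf k).1 = s).card = (lam.part s).card := by
  rw [YoungDiagram.card]
  refine Finset.card_bij' (fun k _ ↦ ((lam.rowOf k).2, lam.colOf k))
    (fun x hx ↦ lam.rowTableau ⟨toLex (s, toLex (x.1, x.2)), (lam.mem_nodes s _ _).2 hx⟩)
    (fun k hk ↦ ?_) (fun x hx ↦ ?_) (fun k hk ↦ ?_) (fun x hx ↦ ?_)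
  · obtain rfl := (Finset.mem_filter.1 hk).2
    have := (lam.rowTableau.symm k).2
    exact (lam.mem_nodes _ _ _).1 this
  · exact Finset.mem_filter.2 ⟨Finset.mem_univ _, by simp [rowOf]⟩
  · obtain rfl := (Finset.mem_filter.1 hk).2
    rw [← Equiv.eq_symm_apply]
    rfl
  · simp [rowOf, colOf]

theorem card_comp_lt (s : Fin r) :
    (Finset.univ.filter fun k ↦ (lam.rowOf k).1 < s).card = lam.before s := by
  rw [before, Finset.card_eq_sum_card_fiberwise (f := fun k ↦ (lam.rowOf k).1)
    (t := Finset.univ.filter (· < s)) (fun k hk ↦ by simpa using hk)]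
  refine Finset.sum_congr rfl fun t ht ↦ ?_
  rw [← lam.card_comp t, Finset.filter_filter]
  congr 1
  ext k
  simp only [Finset.mem_filter, Finset.mem_univ, true_and, and_iff_right_iff_imp] at ht ⊢
  rintro rfl
  exact ht

/-- The components are filled one after another, so the entries in components before `s` form an
initial segment, of size `before s`. -/
theorem lt_before_iff (s : Fin r) (k : Fin n) :
    (k : ℕ) < lam.before s ↔ (lam.rowOf k).1 < s := by
  rw [← card_comp_lt]
  constructor
  · intro h
    by_contra hk
    refine absurd h (not_lt.2 ?_)
    rw [← Fin.card_Iio k]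
    refine Finset.card_le_card fun j hj ↦ ?_
    rw [Finset.mem_filter] at hj
    rw [Finset.mem_Iio]
    by_contra hjk
    exact hk ((lam.comp_mono (not_lt.1 hjk)).trans_lt hj.2)
  · intro h
    rw [Nat.lt_iff_add_one_le, ← Fin.card_Iic k]
    refine Finset.card_le_card fun j hj ↦ ?_
    rw [Finset.mem_Iic] at hj
    exact Finset.mem_filter.2 ⟨Finset.mem_univ _, (lam.comp_mono hj).trans_lt h⟩

/-- An entry lies in some component; `r ≥ 1` is therefore not assumed separately, and for `n = 0` it
plays no role. -/
theorem pos_of_pos {r n : ℕ} (lam : Multipartition r n) (hn : 0 < n) : 0 < r :=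
  (lam.rowOf ⟨0, hn⟩).1.pos

theorem card_part_le (s : Fin r) : (lam.part s).card ≤ n := by
  rw [← lam.card_comp s]
  simpa using Finset.card_le_univ (Finset.univ.filter fun k ↦ (lam.rowOf k).1 = s)

theorem sum_sub_card : ∑ s, (n - (lam.part s).card) = n * (r - 1) := by
  have h1 : ∑ s, (n - (lam.part s).card) + ∑ s, (lam.part s).card = r * n := by
    rw [← Finset.sum_add_distrib, Finset.sum_congr rfl fun s _ ↦
      Nat.sub_add_cancel (lam.card_part_le s)]
    simp
  rw [lam.sum_card] at h1
  rw [Nat.mul_sub, mul_one, mul_comm]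
  omega

theorem card_comp_ne (s : Fin r) :
    (Finset.univ.filter fun k ↦ (lam.rowOf k).1 ≠ s).card = n - (lam.part s).card := by
  have := Finset.card_filter_add_card_filter_not (s := Finset.univ)
    fun k : Fin n ↦ (lam.rowOf k).1 = s
  rw [lam.card_comp, Finset.card_univ, Fintype.card_fin] at this
  simp only [ne_eq]
  omega

end Multipartition

end AK

namespace AK

/-! ### Factorization of u^± by entries and evaluation of τ(z_λ T_{w_λ}^*) -/

section Evaluation

open Polynomial

attribute [local instance] algRing

variable {R : Type*} [CommRing R] {r n : ℕ} (q : Rˣ) (Q : Fin r → R)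

/-- `∏_{t > s} (X - Q_t)`. -/
noncomputable def upperPoly (s : Fin r) : R[X] := ∏ t ∈ Finset.Ioi s, (X - C (Q t))

/-- `∏_{t < s} (X - Q_t)`. -/
noncomputable def lowerPoly (s : Fin r) : R[X] := ∏ t ∈ Finset.Iio s, (X - C (Q t))

theorem natDegree_prod_X_sub_C_le (S : Finset (Fin r)) :
    (∏ t ∈ S, (X - C (Q t))).natDegree ≤ S.card := by
  refine (natDegree_prod_le _ _).trans ?_
  exact (Finset.sum_le_card_nsmul S (fun t ↦ (X - C (Q t)).natDegree) 1
    fun t _ ↦ natDegree_X_sub_C_le _).trans (by rw [smul_eq_mul, mul_one])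

/-- With zero-based indices there are `s` factors below and `r - 1 - t` above: the parameters
strictly below `s` and strictly above `t` miss at least one. -/
theorem natDegree_lowerPoly_add_upperPoly_lt {s t : Fin r} (h : s ≤ t) :
    (lowerPoly Q s).natDegree + (upperPoly Q t).natDegree < r := by
  have h1 := natDegree_prod_X_sub_C_le Q (Finset.Iio s)
  have h2 := natDegree_prod_X_sub_C_le Q (Finset.Ioi t)
  rw [Fin.card_Iio] at h1
  rw [Fin.card_Ioi] at h2
  rw [lowerPoly, upperPoly]
  rw [Fin.le_def] at h
  have := t.2
  omega

theorem eval_upperPoly_mul_eval_lowerPoly (s : Fin r) :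
    (upperPoly Q s).eval 0 * (lowerPoly Q s).eval 0 =
      ∏ t, if s ≠ t then -Q t else 1 := by
  rw [upperPoly, lowerPoly, eval_prod, eval_prod, ← Finset.prod_union, ← Finset.prod_filter]
  · refine Finset.prod_congr ?_ fun t _ ↦ by simp
    ext t
    simp only [Finset.mem_union, Finset.mem_Ioi, Finset.mem_Iio, Finset.mem_filter,
      Finset.mem_univ, true_and, ne_iff_lt_or_gt]
  · rw [Finset.disjoint_left]
    intro t h1 h2
    exact (Finset.mem_Ioi.1 h1).asymm (Finset.mem_Iio.1 h2)

theorem murphyProd_eq_ev (a : ℕ) (x : R) : murphyProd n q Q a x =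
    ev q Q (∏ k : Fin n, aeval (MvPolynomial.X k) (if (k : ℕ) < a then X - C x else 1)) := by
  rw [murphyProd, ← List.prod_ofFn, map_list_prod, List.map_ofFn]
  congr 2
  ext k
  rw [Function.comp_apply, ev_aeval_X]
  split_ifs <;> simp

variable (lam : Multipartition r n)

/-- Collect the factors with the same L_k: by `lt_before_iff`, L_k - Q_s occurs exactly when `s`
lies after the component of `k`. -/
theorem uPlus_eq_ev : uPlus q Q lam =
    ev q Q (∏ k : Fin n, aeval (MvPolynomial.X k) (upperPoly Q (lam.rowOf k).1)) := by
  have h1 : uPlus q Q lam = ev q Q (∏ s : Fin r, ∏ k : Fin n, aeval (MvPolynomial.X k)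
      (if (k : ℕ) < lam.before s then X - C (Q s) else 1)) := by
    rw [uPlus, ← List.prod_ofFn, map_list_prod, List.map_ofFn]
    congr 2
    ext s
    rw [murphyProd_eq_ev]; rfl
  rw [h1, Finset.prod_comm]
  congr 1
  refine Finset.prod_congr rfl fun k _ ↦ ?_
  rw [← map_prod, upperPoly]
  congr 1
  simp only [lam.lt_before_iff]
  rw [← Finset.prod_filter]
  congr 1
  ext t; simp

/-- The reversal of components in λ' cancels the reversal of the parameters. The right side does not
depend on `v`, which preserves the rows of 𝔱^{λ'}; keeping `v` gives the shape F_{x⁻¹k} with x = w_λ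
v demanded by `straighten`. -/
theorem uMinus_conj_eq_ev {v : Equiv.Perm (Fin n)} (hv : v ∈ lam.conj.rowStab) :
    uMinus q Q lam.conj = ev q Q (∏ k : Fin n, aeval (MvPolynomial.X k)
      (lowerPoly Q (lam.rowOf ((lam.wPerm.trans v).symm k)).1)) := by
  have h1 : uMinus q Q lam.conj = ev q Q (∏ s : Fin r, ∏ k : Fin n, aeval (MvPolynomial.X k)
      (if (k : ℕ) < lam.conj.before s then X - C (Q s.rev) else 1)) := by
    rw [uMinus, ← List.prod_ofFn, map_list_prod, List.map_ofFn]
    congr 2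
    ext s
    rw [murphyProd_eq_ev]; rfl
  rw [h1, Finset.prod_comm]
  congr 1
  refine Finset.prod_congr rfl fun k _ ↦ ?_
  rw [← map_prod, lowerPoly]
  congr 1
  simp only [lam.conj.lt_before_iff, lam.conj_rowOf_fst hv]
  rw [← Equiv.prod_comp Fin.revPerm, ← Finset.prod_filter]
  refine Finset.prod_congr ?_ fun t _ ↦ by simp
  ext t; simp

/-- Entry `k` contributes -Q_t for each `t` other than its component, so -Q_t occurs once for every
entry outside component `t`. -/
theorem prod_eval_upperPoly_mul_eval_lowerPoly :
    ∏ k, (upperPoly Q (lam.rowOf k).1).eval 0 * (lowerPoly Q (lam.rowOf k).1).eval 0 =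
      (-1) ^ (n * (r - 1)) * ∏ s, Q s ^ (n - (lam.part s).card) := by
  simp only [eval_upperPoly_mul_eval_lowerPoly]
  rw [Finset.prod_comm]
  simp only [← Finset.prod_filter, Finset.prod_const, lam.card_comp_ne]
  rw [← lam.sum_sub_card, ← Finset.prod_pow_eq_pow_sum, ← Finset.prod_mul_distrib]
  exact Finset.prod_congr rfl fun s _ ↦ neg_pow _ _

theorem IsCanonicalForm.apply_zElt_mul {τ : Alg n q Q →ₗ[R] R} (h : IsCanonicalForm n q Q τ) :
    τ (zElt q Q lam * starMap n q Q (T n q Q lam.wPerm)) =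
      (-1) ^ (n * (r - 1)) * (q : R) ^ len lam.wPerm *
        ∏ s : Fin r, Q s ^ (n - (lam.part s).card) := by
  -- The contribution of one pair from the two row sums, without its weight (-q)^{-ℓ(v)}, which is 1
  -- for the only surviving pair.
  have hterm (u v : Equiv.Perm (Fin n)) (hu : u ∈ lam.rowStab) (hv : v ∈ lam.conj.rowStab) :
      τ (T n q Q u * uPlus q Q lam * T n q Q lam.wPerm * (T n q Q v * uMinus q Q lam.conj) *
        T n q Q lam.wPerm.symm) = if u = Equiv.refl _ ∧ v = Equiv.refl _ then
          (-1) ^ (n * (r - 1)) * (q : R) ^ len lam.wPerm *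
            ∏ s : Fin r, Q s ^ (n - (lam.part s).card) else 0 := by
    have h1 := h.apply_straighten (fun hn ↦ lam.pos_of_pos hn)
      (fun k ↦ lowerPoly Q (lam.rowOf k).1) (fun k ↦ upperPoly Q (lam.rowOf k).1)
      (fun i j hij ↦ natDegree_lowerPoly_add_upperPoly_lt Q (lam.comp_mono hij))
      (lam.inv_trans_wPerm_trans' hu hv) lam.wPerm
    rw [← uPlus_eq_ev, ← uMinus_conj_eq_ev q Q lam hv, ← T_mul_T q Q (lam.inv_wPerm_trans hv),
      prod_eval_upperPoly_mul_eval_lowerPoly] at h1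
    simp only [lam.trans_wPerm_trans_eq_iff hu hv, mul_assoc] at h1 ⊢
    rw [h1, len_eq_inv, mul_comm (∏ s, _)]
  rw [starMap_T, zElt, mElt, nElt, xElt, yElt, Finset.sum_mul, Finset.sum_mul, Finset.sum_mul,
    Finset.sum_mul, map_sum]
  simp only [Finset.sum_mul, Finset.mul_sum, map_sum, smul_mul_assoc, mul_smul_comm, map_smul]
  rw [Finset.sum_eq_single_of_mem _ lam.refl_mem_rowStab,
    Finset.sum_eq_single_of_mem _ lam.conj.refl_mem_rowStab,
    hterm _ _ lam.refl_mem_rowStab lam.conj.refl_mem_rowStab, if_pos ⟨rfl, rfl⟩, len_eq_inv,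
    inv_refl, pow_zero, Units.val_one, one_smul, len_eq_inv]
  · intro v hv hv1
    rw [hterm _ _ lam.refl_mem_rowStab hv, if_neg fun hc ↦ hv1 hc.2, smul_zero]
  · intro u hu hu1
    refine Finset.sum_eq_zero fun v hv ↦ ?_
    rw [hterm _ _ hu hv, if_neg fun hc ↦ hu1 hc.1, smul_zero]

end Evaluation

end AK

theorem proposition5p13 {R : Type*} [CommRing R] {r n : ℕ} (q : Rˣ) (Q : Fin r → R)
    (lam : AK.Multipartition r n) :
    (∃! τ : AK.Alg n q Q →ₗ[R] R, AK.IsCanonicalForm n q Q τ) ∧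
    ∀ τ : AK.Alg n q Q →ₗ[R] R, AK.IsCanonicalForm n q Q τ →
      τ (AK.zElt q Q lam * AK.starMap n q Q (AK.T n q Q lam.wPerm)) =
        (-1) ^ (n * (r - 1)) * (q : R) ^ AK.len lam.wPerm *
          ∏ s : Fin r, Q s ^ (n - (lam.part s).card) := by
  have hr : 0 < n → 0 < r := fun hn ↦ lam.pos_of_pos hn
  obtain ⟨τ, hτ⟩ := AK.exists_isCanonicalForm q Q hr
  exact ⟨⟨τ, hτ, fun τ' hτ' ↦ AK.isCanonicalForm_unique q Q hr hτ' hτ⟩,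
    fun τ' hτ' ↦ hτ'.apply_zElt_mul q Q lam⟩
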